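/- Let $m,c>0$, $e\in\mathbb R\setminus\{0\}$, $\lambda_0=\left(\frac{3mc^2}{2e^2}\right)^2$, and let $M$ be the orthogonal projection of the square integrable vector fields on $\mathbb R^3$ onto the subspace $L^2_*$ of divergence-free ones; $H^s_*$ denotes the divergence-free fields in the Sobolev space $H^s(\mathbb R^3;\mathbb R^3)$. Fix $\lambda>0$ and put $G_\lambda(x)=\frac{e^{-\sqrt\lambda|x|}}{4\pi|x|}$, $G_0(x)=\frac1{4\pi|x|}$; here $MQG_0$ denotes the transverse part $\frac1{8\pi|x|}\left(Q+\frac{x\,(x\cdot Q)}{|x|^2}\right)$ of $QG_0$. The space $D(F_m)$ consists of the $A\in L^2_*$ for which there is a (unique) $Q_A\in\mathbb R^3$ with $A_\lambda:=A-\frac{4\pi e}{c}MQ_AG_\lambda\in H^1_*$; it carries the topology of $H^1_*\times\mathbb R^3$ through $A\mapsto(A_\lambda,Q_A)$. For $p\in\mathbb R^3$, the domain $D(H_m^p)$ consists of the $A\in D(F_m)$ with $A_\lambda\in H^2_*$ and $$\lim_{r\downarrow0}\frac1{4\pi r^2}\int_{|x|=r}\Big(A-\frac{4\pi e}{c}MQ_AG_0\Big)\,d\mu_r=-\frac{mc}{e}Q_A+\frac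 cep ,$$ and $(H_m^p+\lambda)A:=(-\Delta+\lambda)A_\lambda$. **Theorem.** Let $V:\mathbb R^3\to\mathbb R$ be differentiable with $\nabla V$ Lipschitz, let $T>0$, $A_0\in D(H_m^{p_0})$, $E_0\in D(F_m)$, $q_0,p_0\in\mathbb R^3$, and let $$(A,E,q,p)\in C^1([0,T];D(F_m))\times C^1([0,T];L^2_*)\times C^2([0,T];\mathbb R^3)\times C^1([0,T];\mathbb R^3)$$ be a strict solution (so $A(t)\in D(H_m^{p(t)})$ for all $t$) of $$\dot A=4\pi c^2E,\quad \dot E=-\frac1{4\pi}H_m^{p}A,\quad \dot q=Q_A,\quad \dot p=-\nabla V(q),$$ with $A(0)=A_0$, $E(0)=E_0$, $q(0)=q_0$, $p(0)=p_0$. Then for all $t\in[0,T]$ $$A(t)=A_f(t)+\frac{4\pi e}{c}\,MA_\delta(t),$$ where $A_f$ is the unique weak solution in $C([0,T];L^2(\mathbb R^3;\mathbb R^3))$ of the free wave equation $\ddot A_f=c^2\Delta A_f$ with initial data $A_f(0)=A_0$, $\dot A_f(0)=4\pi c^2E_0$, and $A_\delta$ is the (square integrable) retarded potential of the source $Q_A\delta_0$,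 with $\theta$ the Heaviside function: $$A_\delta(t,x)=\frac1{4\pi}\,\frac{\theta(ct-|x|)}{|x|}\,Q_{A(t-|x|/c)} .$$ Moreover, for $0<t\le T$ the field $A_f(t)$ is continuous near the origin, its value $A_f(t,0)$ there extends continuously to $t=0$, and, with that extension, for all $t\in[0,T]$ (one-sided derivatives at the end points) $$\dot Q_{A(t)}=c\sqrt{\lambda_0}\,Q_{A(t)}+\frac{3c^2}{2e}\,A_f(t,0)-\frac{3c^3}{2e^2}\,p(t).$$ -/

import Mathlib

open MeasureTheory Set Filter Topology
open scoped ContDiff RealInnerProductSpace Gradient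

namespace PointCharge

noncomputable section

/-- Physical space with its Euclidean norm. -/
abbrev E3 : Type := EuclideanSpace ℝ (Fin 3)

/-- The Hilbert space of square integrable (real) vector fields on `ℝ³`. -/
abbrev L2V : Type := Lp E3 2 (volume : Measure E3)

/-- The mass `m > 0`, the velocity of light `c > 0` and the electric charge `e ≠ 0` (of either
sign). -/
structure Constants where
  m : ℝ
  c : ℝ
  e : ℝ
  m_pos : 0 < m
  c_pos : 0 < c
  e_ne : e ≠ 0

/-- The coupling constant `4πe/c`. -/
def Constants.kappa (K : Constants) : ℝ := 4 * Real.pi * K.e / K.c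

/-- `λ₀ = (3mc²/(2e²))²`, where `-λ₀` is the negative eigenvalue of the point interaction. -/
def Constants.lam0 (K : Constants) : ℝ := (3 * K.m * K.c ^ 2 / (2 * K.e ^ 2)) ^ 2

/-- The class in `L²` of a vector field (`0` if the field is not square integrable). -/
def toL2 (f : E3 → E3) : L2V :=
  open Classical in if h : MemLp f 2 (volume : Measure E3) then h.toLp f else 0

/-! ### Test functions, divergence-free fields, weak derivatives, Sobolev spaces -/

/-- Smooth compactly supported functions on `ℝ³` with values in a normed space. -/
def IsTest {F : Type*} [NormedAddCommGroup F] [NormedSpace ℝ F] (φ : E3 → F) : Prop :=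
  ContDiff ℝ ∞ φ ∧ HasCompactSupport φ

/-- The square integrable divergence-free vector fields: those `u` with `∫ u · ∇φ = 0` for every
test function `φ`, that is, whose distributional divergence vanishes. -/
def L2div : Submodule ℝ L2V :=
  (Submodule.span ℝ
    {g : L2V | ∃ φ : E3 → ℝ, IsTest φ ∧ (g : E3 → E3) =ᵐ[volume] fun x => ∇ φ x})ᗮ

instance instCompleteL2div : CompleteSpace L2div := Submodule.instOrthogonalCompleteSpace _

instance instProjL2div : L2div.HasOrthogonalProjection :=
  Submodule.HasOrthogonalProjection.ofCompleteSpace _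

/-- The orthogonal projection `M` of the square integrable vector fields onto the
divergence-free ones. -/
def M : L2V →L[ℝ] L2V := L2div.starProjection

/-- The field `v` is the weak derivative `∂ᵢ u`. -/
def IsWeakDeriv (i : Fin 3) (u v : L2V) : Prop :=
  ∀ φ : E3 → E3, IsTest φ →
    ∫ x, ⟪u x, fderiv ℝ φ x (EuclideanSpace.single i 1)⟫ = -∫ x, ⟪v x, φ x⟫

/-- The weak derivative `∂ᵢ u`, when it exists in `L²` (it is then unique). -/
def weakDeriv (i : Fin 3) (u : L2V) : L2V := Classical.epsilon (IsWeakDeriv i u)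

/-- `u ∈ H¹`: all first weak derivatives exist in `L²`. -/
def MemH1 (u : L2V) : Prop := ∀ i, ∃ v, IsWeakDeriv i u v

/-- `u ∈ H²`: all weak derivatives up to the second order exist in `L²`. -/
def MemH2 (u : L2V) : Prop := MemH1 u ∧ ∀ i, MemH1 (weakDeriv i u)

/-- The Laplacian of `u ∈ H²`. -/
def weakLaplacian (u : L2V) : L2V := ∑ i, weakDeriv i (weakDeriv i u)

/-! ### The point interaction -/

/-- `G_λ(x) = exp(-√λ |x|) / (4π|x|)`. -/
def yukawa (lam : ℝ) (x : E3) : ℝ := Real.exp (-(√lam * ‖x‖)) / (4 * Real.pi * ‖x‖)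

theorem memLp_yukawa_smul {lam : ℝ} (hlam : 0 < lam) (Q : E3) :
    MemLp (fun x => yukawa lam x • Q) 2 (volume : Measure E3) := by
  have hmeas : Measurable (yukawa lam) := by unfold yukawa; fun_prop
  have h1 : MemLp (yukawa lam) 2 (volume : Measure E3) := by
    rw [memLp_two_iff_integrable_sq hmeas.aestronglyMeasurable]
    have := (integrable_fun_norm_addHaar (volume : Measure E3)
      (f := fun r : ℝ => (Real.exp (-(√lam * r)) / (4 * Real.pi * r)) ^ 2)).2 (by
        have hs : 0 < √lam := Real.sqrt_pos.2 hlam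
        have h2 := (integrableOn_exp_mul_Ioi (a := -(2 * √lam)) (by linarith) 0).mul_const
          ((4 * Real.pi) ^ 2)⁻¹
        refine IntegrableOn.congr_fun h2 ?_ measurableSet_Ioi
        intro r hr
        have hr' : (r : ℝ) ≠ 0 := ne_of_gt hr
        have hexp : Real.exp (-(2 * √lam) * r) = Real.exp (-(√lam * r)) ^ 2 := by
          rw [← Real.exp_nat_mul]; congr 1; push_cast; ring
        simp only [finrank_euclideanSpace, Fintype.card_fin, smul_eq_mul, hexp]
        field_simp)
    exact this
  refine MemLp.of_le_mul (c := ‖Q‖) h1 (hmeas.smul_const Q).aestronglyMeasurable ?_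
  exact Eventually.of_forall fun x => by rw [norm_smul, mul_comm]

/-- The divergence-free field `M Q G_λ`. -/
def singularField (lam : ℝ) (Q : E3) : L2V := M (toL2 fun x => yukawa lam x • Q)

/-- The transverse part `M Q G₀` of the (not square integrable) field `Q G₀(x) = Q / (4π|x|)`,
namely `(8π|x|)⁻¹ (Q + x (x·Q) / |x|²)`: it is divergence-free, and
`Q G₀ - M Q G₀ = ∇ (x·Q / (8π|x|))` is a gradient. -/
def coulombField (Q : E3) (x : E3) : E3 :=
  (8 * Real.pi * ‖x‖)⁻¹ • (Q + (⟪x, Q⟫ / ‖x‖ ^ 2) • x)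

/-- `A_λ = A - (4πe/c) M Q G_λ` lies in `H¹` and is divergence-free. -/
def IsCharge (K : Constants) (lam : ℝ) (A : L2V) (Q : E3) : Prop :=
  A - K.kappa • singularField lam Q ∈ L2div ∧ MemH1 (A - K.kappa • singularField lam Q)

/-- The form domain `D(F_m)`. -/
def MemFormDomain (K : Constants) (lam : ℝ) (A : L2V) : Prop := ∃ Q, IsCharge K lam A Q

/-- The charge `Q_A` of `A ∈ D(F_m)` (it is unique since `M Q G_λ ∉ H¹` for `Q ≠ 0`). -/
def charge (K : Constants) (lam : ℝ) (A : L2V) : E3 := Classical.epsilon (IsCharge K lam A)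

/-- The regular part `A_λ = A - (4πe/c) M Q_A G_λ` of `A ∈ D(F_m)`. -/
def regPart (K : Constants) (lam : ℝ) (A : L2V) : L2V :=
  A - K.kappa • singularField lam (charge K lam A)

/-- The mean `(4πr²)⁻¹ ∫_{S_r} f dμ_r` over the sphere of radius `r` centred at the origin. -/
def sphereMean (f : E3 → E3) (r : ℝ) : E3 :=
  ⨍ y : Metric.sphere (0 : E3) 1, f (r • (y : E3)) ∂(volume : Measure E3).toSphere

/-- The spherical means of `f` tend to `b` as `r ↓ 0`. A class in `L²` determines its spherical
means for almost every `r` only, so the limit is taken along the complement of a null set. -/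
def SphereMeanTendsto (f : E3 → E3) (b : E3) : Prop :=
  Tendsto (sphereMean f) (𝓝[>] (0 : ℝ) ⊓ ae (volume : Measure ℝ)) (𝓝 b)

/-- The domain `D(H_m^p)` of the affine point interaction: `A_λ ∈ H²` is divergence-free, and
the spherical means of `A - (4πe/c) M Q_A G₀` tend to `-(mc/e) Q_A + (c/e) p`. -/
def MemOpDomain (K : Constants) (lam : ℝ) (p : E3) (A : L2V) : Prop :=
  MemFormDomain K lam A ∧ MemH2 (regPart K lam A) ∧
    SphereMeanTendsto (fun x => A x - K.kappa • coulombField (charge K lam A) x)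
      (-(K.m * K.c / K.e) • charge K lam A + (K.c / K.e) • p)

/-- The affine operator `H_m^p`, acting on its domain by `(H_m^p + λ) A = (-Δ + λ) A_λ`. -/
def opH (K : Constants) (lam : ℝ) (A : L2V) : L2V :=
  -weakLaplacian (regPart K lam A) + lam • regPart K lam A - lam • A

/-- The curve `A` is in `C¹([0,T]; D(F_m))`. Through `A ↦ (A_λ, Q_A)` the space `D(F_m)` with its
form norm is the product of the divergence-free part of `H¹` and `ℝ³`; a curve is `C¹` in `H¹` when
it and its weak derivatives are `C¹` in `L²`. -/
def IsC1FormDomain (K : Constants) (lam T : ℝ) (A : ℝ → L2V) : Prop :=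
  (∀ t ∈ Icc 0 T, MemFormDomain K lam (A t)) ∧
  ContDiffOn ℝ 1 (fun t => charge K lam (A t)) (Icc 0 T) ∧
  ContDiffOn ℝ 1 (fun t => regPart K lam (A t)) (Icc 0 T) ∧
  ∀ i, ContDiffOn ℝ 1 (fun t => weakDeriv i (regPart K lam (A t))) (Icc 0 T)

/-- A strict solution on `[0,T]` of
`Ȧ = 4πc² E`, `Ė = -(1/4π) H_m^p A`, `q̇ = Q_A`, `ṗ = -∇V(q)`
with initial data `A₀ ∈ D(H_m^{p₀})`, `E₀ ∈ D(F_m)`, `q₀`, `p₀`. -/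
structure IsStrictSolution (K : Constants) (lam : ℝ) (V : E3 → ℝ) (T : ℝ)
    (A₀ E₀ : L2V) (q₀ p₀ : E3) (A E : ℝ → L2V) (q p : ℝ → E3) : Prop where
  A_reg : IsC1FormDomain K lam T A
  E_mem : ∀ t ∈ Icc 0 T, E t ∈ L2div
  E_reg : ContDiffOn ℝ 1 E (Icc 0 T)
  q_reg : ContDiffOn ℝ 2 q (Icc 0 T)
  p_reg : ContDiffOn ℝ 1 p (Icc 0 T)
  A_dom : ∀ t ∈ Icc 0 T, MemOpDomain K lam (p t) (A t)
  A_eq : ∀ t ∈ Icc 0 T, HasDerivWithinAt A ((4 * Real.pi * K.c ^ 2) • E t) (Icc 0 T) t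
  E_eq : ∀ t ∈ Icc 0 T,
    HasDerivWithinAt E (-(1 / (4 * Real.pi)) • opH K lam (A t)) (Icc 0 T) t
  q_eq : ∀ t ∈ Icc 0 T, HasDerivWithinAt q (charge K lam (A t)) (Icc 0 T) t
  p_eq : ∀ t ∈ Icc 0 T, HasDerivWithinAt p (-∇ V (q t)) (Icc 0 T) t
  A_init : A 0 = A₀
  E_init : E 0 = E₀
  q_init : q 0 = q₀
  p_init : p 0 = p₀
  A₀_mem : MemOpDomain K lam p₀ A₀
  E₀_mem : MemFormDomain K lam E₀

/-! ### The free wave and the retarded potential -/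

/-- The curve `u ∈ C([0,T]; L²)` is the weak solution of the free wave equation `ü = c² Δu` with
`u(0) = u₀`, `u̇(0) = u₁`. -/
structure IsFreeWave (c T : ℝ) (u₀ u₁ : L2V) (u : ℝ → L2V) : Prop where
  cont : ContinuousOn u (Icc 0 T)
  init : u 0 = u₀
  wave : ∀ ψ : E3 → E3, IsTest ψ → ∃ h : ℝ → ℝ,
    h 0 = ∫ x, ⟪ψ x, u₁ x⟫ ∧
    ∀ t ∈ Icc 0 T,
      HasDerivWithinAt (fun s => ∫ x, ⟪ψ x, u s x⟫) (h t) (Icc 0 T) t ∧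
      HasDerivWithinAt h (c ^ 2 * ∫ x, ⟪Laplacian.laplacian ψ x, u t x⟫) (Icc 0 T) t

/-- The retarded potential `(4π|x|)⁻¹ θ(ct - |x|) Q(t - |x|/c)` of the point source `Q δ₀`
switched on at time `0`. -/
def retardedPotential (c : ℝ) (Q : ℝ → E3) (t : ℝ) (x : E3) : E3 :=
  open Classical in
  if ‖x‖ ≤ c * t then (4 * Real.pi * ‖x‖)⁻¹ • Q (t - ‖x‖ / c) else 0

/-- The class `u` has the value `a` at the origin: near the origin it agrees almost everywhere with
a continuous field whose value at the origin is `a`. -/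
def HasValueAtZero (u : L2V) (a : E3) : Prop :=
  ∃ U ∈ 𝓝 (0 : E3), ∃ f : E3 → E3, ContinuousOn f U ∧
    (∀ᵐ x ∂(volume : Measure E3), x ∈ U → u x = f x) ∧ f 0 = a

end

end PointCharge

open PointCharge

open MeasureTheory Set Filter Topology
open scoped ContDiff RealInnerProductSpace Gradient

namespace PointCharge

noncomputable section

/-! Write κ = 4πe/c, Y = Q_A G_λ and D for the retarded potential, so that A = A_λ + κ M Y. The
field equation says Ä = c²Δ A_λ + c²λκ M Y. Since (λ - Δ) Y = Q_A δ₀, the wave equation for D takes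
the form D̈ = c²Δ(D - Y) + c²λY, in which every field is square integrable, so M can be applied to
it. Subtracting κ M D from A cancels all terms with Y: the field A_f = A - κ M D solves the free
wave equation, with the data of A because M D starts from rest at zero
(`IsStrictSolution.isFreeWave`). The energy method gives uniqueness (`eq_zero_of_weakLap_prim`).

For the charge, write A_f = A_λ + κ M(Y - D). The H² field A_λ is continuous. In Y - D the
singularities 1/|x| cancel, and the radial profile tends to (4π)⁻¹(-√λ Q + Q̇/c) at the origin. For
a radial field w(|x|) the projection is explicit: its longitudinal part is, formally, the gradient
of x · W(|x|) with W(r) = r⁻³ ∫₀ʳ s² w(s) ds (`RadialDecay.M_eq`). Hence M w has at the origin 2/3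
of the limit of w (`RadialDecay.continuousOn_transField`). The same computation with the Coulomb
field in place of D turns the boundary condition of D(H_m^p) into a formula for A_λ(0)
(`MemOpDomain.value_regPart`). When both are added the terms with √λ cancel and A_f(t,0) =
(2e/(3c²)) Q̇ - (mc/e) Q + (c/e) p, which is solved for Q̇.

Two devices replace Fourier analysis. A weak Laplacian g = Δu is equivalent to N_h * g = (12/h²)(R_h
* u - u) for all h > 0, with explicit radial kernels N_h, R_h of mass one (`WeakLap.avg_eq`,
`weakLap_of_avg_eq`). Only bounded operators occur in it, so symmetry, sign, continuity of u and
commutation with M follow at once. And a functional of radial profiles that vanishes on smooth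
profiles supported off the origin is represented by a density, which du Bois-Reymond's lemma makes
constant and decay at infinity makes zero (`integral_eq_zero_of_test`). -/

/-! ### Polar coordinates -/

/-- The unit sphere of `ℝ³`. -/
abbrev S2 : Type := Metric.sphere (0 : E3) 1

/-- The surface measure of the unit sphere. -/
abbrev surf : Measure S2 := (volume : Measure E3).toSphere

/-- The measure `r² dr` on the positive half-line. -/
def radMeasure : Measure ℝ := (volume.restrict (Ioi 0)).withDensity fun r => ENNReal.ofReal (r ^ 2)

instance sigmaFinite_radMeasure : SigmaFinite radMeasure := by
  unfold radMeasure; infer_instance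

theorem measurePreserving_val_volumeIoiPow :
    MeasurePreserving (Subtype.val : Ioi (0 : ℝ) → ℝ) (Measure.volumeIoiPow 2) radMeasure := by
  refine ⟨measurable_subtype_coe, ?_⟩
  ext s hs
  rw [Measure.map_apply measurable_subtype_coe hs, Measure.volumeIoiPow, radMeasure,
    withDensity_apply _ (measurable_subtype_coe hs), withDensity_apply _ hs,
    Measure.restrict_restrict hs, setLIntegral_subtype measurableSet_Ioi _
      fun a : ℝ ↦ ENNReal.ofReal (a ^ 2)]
  simp [inter_comm]

/-- The origin is a null set, so polar coordinates can be used with a radius in `ℝ` and a measure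
carried by the positive half-line, without subtypes. -/
theorem measurePreserving_polar :
    MeasurePreserving (fun p : S2 × ℝ => p.2 • (p.1 : E3)) (surf.prod radMeasure) volume := by
  have h1 : MeasurePreserving (Prod.map id Subtype.val : S2 × Ioi (0 : ℝ) → S2 × ℝ)
      (surf.prod (Measure.volumeIoiPow 2)) (surf.prod radMeasure) :=
    (MeasurePreserving.id _).prod measurePreserving_val_volumeIoiPow
  have h2 := (volume : Measure E3).measurePreserving_homeomorphUnitSphereProd
  have hd : Module.finrank ℝ E3 - 1 = 2 := by simp
  rw [hd] at h2
  have h3 : MeasurePreserving (Subtype.val : ({0}ᶜ : Set E3) → E3)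
      ((volume : Measure E3).comap Subtype.val) volume := by
    refine ⟨measurable_subtype_coe, ?_⟩
    rw [map_comap_subtype_coe (measurableSet_singleton _).compl,
      MeasureTheory.restrict_compl_singleton]
  have h4 := h3.comp (h2.symm (homeomorphUnitSphereProd E3).toMeasurableEquiv)
  have hm : Measurable fun p : S2 × ℝ => p.2 • (p.1 : E3) := by fun_prop
  refine ⟨hm, ?_⟩
  rw [← h1.map_eq, Measure.map_map hm h1.measurable, ← h4.map_eq]
  rfl

theorem integrable_polar {F : Type*} [NormedAddCommGroup F] {f : E3 → F} (hf : Integrable f) :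
    Integrable (fun p : S2 × ℝ => f (p.2 • (p.1 : E3))) (surf.prod radMeasure) :=
  measurePreserving_polar.integrable_comp_of_integrable hf

theorem integral_radMeasure {F : Type*} [NormedAddCommGroup F] [NormedSpace ℝ F] (g : ℝ → F) :
    ∫ r, g r ∂radMeasure = ∫ r in Ioi (0 : ℝ), r ^ 2 • g r := by
  rw [radMeasure, integral_withDensity_eq_integral_toReal_smul (by fun_prop) (by simp)]
  refine integral_congr_ae (Eventually.of_forall fun r => ?_)
  simp [ENNReal.toReal_ofReal (sq_nonneg r)]

theorem integrable_radMeasure {F : Type*} [NormedAddCommGroup F] [NormedSpace ℝ F] {g : ℝ → F} :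
    Integrable g radMeasure ↔ IntegrableOn (fun r => r ^ 2 • g r) (Ioi 0) := by
  rw [radMeasure, integrable_withDensity_iff_integrable_smul' (by fun_prop) (by simp)]
  refine integrable_congr (Eventually.of_forall fun r => ?_)
  simp [ENNReal.toReal_ofReal (sq_nonneg r)]

theorem integral_polar {F : Type*} [NormedAddCommGroup F] [NormedSpace ℝ F] {f : E3 → F}
    (hf : Integrable f) :
    ∫ x, f x = ∫ r, (∫ z : S2, f (r • (z : E3)) ∂surf) ∂radMeasure := by
  rw [← integral_prod_symm _ (integrable_polar hf), ← measurePreserving_polar.map_eq,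
    integral_map measurePreserving_polar.measurable.aemeasurable]
  rw [measurePreserving_polar.map_eq]; exact hf.1

theorem ae_radMeasure {P : ℝ → Prop} :
    (∀ᵐ r ∂radMeasure, P r) ↔ ∀ᵐ r : ℝ, 0 < r → P r := by
  rw [radMeasure, ae_withDensity_iff (by fun_prop), ae_restrict_iff' measurableSet_Ioi]
  refine eventually_congr (Eventually.of_forall fun r => ?_)
  refine forall_congr' fun (hr : 0 < r) => ?_
  have : ENNReal.ofReal (r ^ 2) ≠ 0 := by simp; positivity
  simp [this]

theorem ae_polar {P : E3 → Prop} (h : ∀ᵐ x, P x) :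
    ∀ᵐ r ∂radMeasure, ∀ᵐ z : S2 ∂surf, P (r • (z : E3)) := by
  have h1 : ∀ᵐ p ∂(surf.prod radMeasure), P (p.2 • (p.1 : E3)) :=
    measurePreserving_polar.quasiMeasurePreserving.ae h
  have h2 := (Measure.measurePreserving_swap (μ := radMeasure) (ν := surf)).quasiMeasurePreserving.ae h1
  exact Measure.ae_ae_of_ae_prod h2

theorem surf_real_univ : surf.real univ = 4 * Real.pi := by
  rw [Measure.toSphere_real_apply_univ, measureReal_def, EuclideanSpace.volume_ball_fin_three]
  have h : (ENNReal.ofReal (Real.pi * 4 / 3)).toReal = Real.pi * 4 / 3 :=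
    ENNReal.toReal_ofReal (by positivity)
  simp [h]
  ring

theorem integral_radial_smul {F : Type*} [NormedAddCommGroup F] [NormedSpace ℝ F] {w : ℝ → ℝ}
    {f : E3 → F} (hf : Integrable fun x => w ‖x‖ • f x) :
    ∫ x, w ‖x‖ • f x
      = ∫ r in Ioi (0 : ℝ), (r ^ 2 * w r) • ∫ z : S2, f (r • (z : E3)) ∂surf := by
  rw [integral_polar hf, integral_radMeasure]
  refine setIntegral_congr_fun measurableSet_Ioi fun r (hr : 0 < r) => ?_
  have : ∀ z : S2, ‖r • (z : E3)‖ = r := fun z => by simp [norm_smul, abs_of_pos hr]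
  simp only [this]
  rw [integral_smul, smul_smul]

/-! ### Test functions -/

section Test

variable {F : Type*} [NormedAddCommGroup F] [NormedSpace ℝ F]

/-- The standard basis vectors of `ℝ³`. -/
abbrev stdE (i : Fin 3) : E3 := EuclideanSpace.single i 1

theorem IsTest.fderiv_apply {φ : E3 → F} (hφ : IsTest φ) (v : E3) :
    IsTest fun x => fderiv ℝ φ x v := by
  refine ⟨?_, hφ.2.fderiv_apply ℝ v⟩
  exact (hφ.1.fderiv_right (m := ∞) (by simp)).clm_apply contDiff_const

theorem IsTest.differentiable {φ : E3 → F} (hφ : IsTest φ) : Differentiable ℝ φ :=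
  hφ.1.differentiable (by simp)

theorem IsTest.integrable {φ : E3 → F} (hφ : IsTest φ) : Integrable φ :=
  hφ.1.continuous.integrable_of_hasCompactSupport hφ.2

theorem IsTest.memLp {φ : E3 → F} (hφ : IsTest φ) (p : ENNReal) : MemLp φ p volume :=
  hφ.1.continuous.memLp_of_hasCompactSupport hφ.2

theorem IsTest.add {φ ψ : E3 → F} (hφ : IsTest φ) (hψ : IsTest ψ) : IsTest fun x => φ x + ψ x :=
  ⟨hφ.1.add hψ.1, hφ.2.add hψ.2⟩

theorem IsTest.sum {ι : Type*} {s : Finset ι} {φ : ι → E3 → F} (h : ∀ i ∈ s, IsTest (φ i)) :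
    IsTest fun x => ∑ i ∈ s, φ i x := by
  classical
  induction s using Finset.induction_on with
  | empty => simpa using ⟨contDiff_const, HasCompactSupport.zero⟩
  | insert i s hi ih =>
    simp only [Finset.sum_insert hi]
    exact (h i (Finset.mem_insert_self i s)).add
      (ih fun j hj => h j (Finset.mem_insert_of_mem hj))

theorem IsTest.smul {g : E3 → ℝ} {φ : E3 → F} (hg : IsTest g) (hφ : ContDiff ℝ ∞ φ) :
    IsTest fun x => g x • φ x :=
  ⟨hg.1.smul hφ, hg.2.smul_right⟩

theorem laplacian_eq_sum_fderiv {φ : E3 → F} (hφ : ContDiff ℝ ∞ φ) (x : E3) :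
    Laplacian.laplacian φ x
      = ∑ i, fderiv ℝ (fun y => fderiv ℝ φ y (stdE i)) x (stdE i) := by
  rw [InnerProductSpace.laplacian_eq_iteratedFDeriv_orthonormalBasis φ (EuclideanSpace.basisFun (Fin 3) ℝ)]
  refine Finset.sum_congr rfl fun i _ => ?_
  have hd : DifferentiableAt ℝ (fderiv ℝ φ) x :=
    ((hφ.fderiv_right (m := ∞) (by simp)).differentiable (by simp)) x
  rw [iteratedFDeriv_two_apply, fderiv_clm_apply hd (differentiableAt_const _)]
  simp

theorem IsTest.laplacian {φ : E3 → F} (hφ : IsTest φ) : IsTest (Laplacian.laplacian φ) := by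
  have : Laplacian.laplacian φ
      = fun x => ∑ i, fderiv ℝ (fun y => fderiv ℝ φ y (stdE i)) x (stdE i) :=
    funext fun x => laplacian_eq_sum_fderiv hφ.1 x
  rw [this]
  exact IsTest.sum fun i _ => (hφ.fderiv_apply _).fderiv_apply _

theorem IsTest.comp_add_right {φ : E3 → F} (hφ : IsTest φ) (a : E3) :
    IsTest fun x => φ (x + a) :=
  ⟨hφ.1.comp (contDiff_id.add contDiff_const), hφ.2.comp_homeomorph (Homeomorph.addRight a)⟩

theorem laplacian_comp_add_right {φ : E3 → F} (hφ : IsTest φ) (a x : E3) :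
    Laplacian.laplacian (fun y => φ (y + a)) x = Laplacian.laplacian φ (x + a) := by
  rw [laplacian_eq_sum_fderiv hφ.1, laplacian_eq_sum_fderiv (hφ.comp_add_right a).1]
  refine Finset.sum_congr rfl fun i _ => ?_
  simp only [fderiv_comp_add_right]
  rw [fderiv_comp_add_right (f := fun z => fderiv ℝ φ z (stdE i))]

end Test

/-! ### The lemma of du Bois-Reymond on the half-line -/

section DuBoisReymond

variable {F : Type*} [NormedAddCommGroup F] [NormedSpace ℝ F] [CompleteSpace F]

/-- A smooth function with compact support in the half-line and mean zero has a primitive of the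
same kind. -/
theorem exists_primitive_Ioi {h : ℝ → ℝ} (h1 : ContDiff ℝ ∞ h) (h2 : HasCompactSupport h)
    (h3 : tsupport h ⊆ Ioi 0) (h4 : ∫ r, h r = 0) :
    ∃ g : ℝ → ℝ, ContDiff ℝ ∞ g ∧ HasCompactSupport g ∧ tsupport g ⊆ Ioi 0 ∧
      ∀ r, HasDerivAt g (h r) r := by
  obtain ⟨a, b, ha, hab⟩ : ∃ a b : ℝ, 0 < a ∧ tsupport h ⊆ Icc a b := by
    rcases (tsupport h).eq_empty_or_nonempty with he | hne
    · exact ⟨1, 1, one_pos, by simp [he]⟩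
    · obtain ⟨b, hb⟩ := h2.isCompact.bddAbove
      obtain ⟨a, ha, ha'⟩ := h2.isCompact.exists_isLeast hne
      exact ⟨a, b, h3 ha, fun x hx => ⟨ha' hx, hb hx⟩⟩
  have hz : ∀ r, r ∉ Icc a b → h r = 0 := fun r hr =>
    image_eq_zero_of_notMem_tsupport fun hh => hr (hab hh)
  have hd : ∀ r, HasDerivAt (fun r => ∫ s in (0 : ℝ)..r, h s) (h r) r := fun r =>
    intervalIntegral.integral_hasDerivAt_right (h1.continuous.intervalIntegrable _ _)
      (h1.continuous.stronglyMeasurableAtFilter _ _) h1.continuous.continuousAt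
  have hs : Function.support (fun r => ∫ s in (0 : ℝ)..r, h s) ⊆ Icc a b := by
    intro r hr
    by_contra hr'
    apply hr
    rw [mem_Icc, not_and_or, not_le, not_le] at hr'
    rcases hr' with hr' | hr'
    · refine (intervalIntegral.integral_congr (g := fun _ => (0 : ℝ)) fun s hs => ?_).trans (by simp)
      refine hz s fun hs' => ?_
      rcases le_total 0 r with h0 | h0
      · rw [uIcc_of_le h0] at hs; linarith [hs.2, hs'.1]
      · rw [uIcc_of_ge h0] at hs; linarith [hs.2, hs'.1]
    · rcases lt_or_ge r 0 with h0 | h0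
      · refine (intervalIntegral.integral_congr (g := fun _ => (0 : ℝ)) fun s hs => ?_).trans
          (by simp)
        refine hz s fun hs' => ?_
        rw [uIcc_of_ge h0.le] at hs; linarith [hs.2, hs'.1]
      · change ∫ s in (0 : ℝ)..r, h s = 0
        rw [intervalIntegral.integral_of_le h0]
        -- Beyond `b` the primitive is the whole integral of `h`, which is zero.
        refine Eq.trans ?_ h4
        refine setIntegral_eq_integral_of_forall_compl_eq_zero fun s hs => hz s fun hs' => hs ?_
        exact ⟨lt_of_lt_of_le ha hs'.1, hs'.2.trans hr'.le⟩
  have hts : tsupport (fun r => ∫ s in (0 : ℝ)..r, h s) ⊆ Icc a b :=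
    closure_minimal hs isClosed_Icc
  refine ⟨_, ?_, ?_, fun r hr => lt_of_lt_of_le ha (hts hr).1, hd⟩
  · rw [contDiff_infty_iff_deriv]
    refine ⟨fun r => (hd r).differentiableAt, ?_⟩
    rwa [show deriv (fun r => ∫ s in (0 : ℝ)..r, h s) = h from funext fun r => (hd r).deriv]
  · exact isCompact_Icc.of_isClosed_subset (isClosed_tsupport _) hts

theorem exists_bump_Ioi {R : ℝ} (hR : 0 < R) :
    ∃ h : ℝ → ℝ, ContDiff ℝ ∞ h ∧ HasCompactSupport h ∧ tsupport h ⊆ Ioi 0 ∧ ∫ r, h r = 1 := by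
  let f : ContDiffBump (R : ℝ) := ⟨R / 4, R / 2, by positivity, by linarith⟩
  refine ⟨f.normed volume, f.contDiff_normed, f.hasCompactSupport_normed, ?_, f.integral_normed⟩
  rw [f.tsupport_normed_eq, Real.closedBall_eq_Icc]
  intro r hr
  have : R - R / 2 ≤ r := hr.1
  exact lt_of_lt_of_le (by linarith) this

omit [CompleteSpace F] in
theorem integrable_smul_of_tsupport_subset {n : ℝ → F} (hn : LocallyIntegrableOn n (Ioi 0))
    {h : ℝ → ℝ} (h1 : Continuous h) (h2 : HasCompactSupport h) (h3 : tsupport h ⊆ Ioi 0) :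
    Integrable fun r => h r • n r := by
  have hi : IntegrableOn (fun r => h r • n r) (tsupport h) := by
    have := hn.integrableOn_compact_subset h3 h2
    exact this.continuousOn_smul h1.continuousOn h2
  rw [integrableOn_iff_integrable_of_support_subset] at hi
  · exact hi
  · exact (Function.support_smul_subset_left _ _).trans (subset_tsupport _)

/-- Fix a bump `k` of mass one. A test function `f` minus `(∫ f) k` has mean zero, hence is the
derivative of a test function. So `n` pairs with `f` as the constant `∫ k n` does. -/
theorem ae_eq_const_of_integral_deriv_smul_eq_zero {n : ℝ → F}
    (hn : LocallyIntegrableOn n (Ioi 0))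
    (h : ∀ g : ℝ → ℝ, ContDiff ℝ ∞ g → HasCompactSupport g → tsupport g ⊆ Ioi 0 →
      ∫ r, deriv g r • n r = 0) :
    ∃ C : F, ∀ᵐ r : ℝ, 0 < r → n r = C := by
  obtain ⟨k, k1, k2, k3, k4⟩ := exists_bump_Ioi one_pos
  refine ⟨∫ r, k r • n r, ?_⟩
  have key : ∀ᵐ r : ℝ, r ∈ Ioi (0 : ℝ) → n r - ∫ r, k r • n r = 0 := by
    refine isOpen_Ioi.ae_eq_zero_of_integral_contDiff_smul_eq_zero
      (hn.sub ((locallyIntegrable_const _).locallyIntegrableOn _)) fun f f1 f2 f3 => ?_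
    obtain ⟨g, g1, g2, g3, g4⟩ := exists_primitive_Ioi (h := fun r => f r - (∫ s, f s) * k r)
      (f1.sub (contDiff_const.mul k1)) (f2.sub k2.mul_left)
      ((tsupport_sub _ _).trans (union_subset f3
        ((tsupport_mul_subset_right).trans k3))) (by
        rw [integral_sub (f1.continuous.integrable_of_hasCompactSupport f2)
          ((k1.continuous.integrable_of_hasCompactSupport k2).const_mul _), integral_const_mul,
          k4]; simp)
    have h0 := h g g1 g2 g3
    have if1 := integrable_smul_of_tsupport_subset hn f1.continuous f2 f3
    have ik1 := integrable_smul_of_tsupport_subset hn k1.continuous k2 k3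
    have hde : ∀ r, deriv g r • n r = f r • n r - (∫ s, f s) • (k r • n r) := fun r => by
      rw [(g4 r).deriv, sub_smul, smul_smul]
    simp only [hde] at h0
    rw [integral_sub if1 (ik1.fun_smul _), integral_smul] at h0
    simp only [smul_sub]
    rw [integral_sub if1 ((f1.continuous.integrable_of_hasCompactSupport f2).smul_const _),
      integral_smul_const, h0]
  filter_upwards [key] with r hr h0
  exact sub_eq_zero.1 (hr h0)

end DuBoisReymond

/-! ### Spherical means of smooth functions -/

section Spherical

variable {F : Type*} [NormedAddCommGroup F] [NormedSpace ℝ F]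

/-- The integral of `ψ` over the sphere of radius `r`, without the factor `r²`. -/
def sphInt (ψ : E3 → F) (r : ℝ) : F := ∫ z : S2, ψ (r • (z : E3)) ∂surf

/-- The integral over the unit sphere of the radial derivative of `ψ` at distance `r`. -/
def sphDeriv (ψ : E3 → F) (r : ℝ) : F := ∫ z : S2, fderiv ℝ ψ (r • (z : E3)) z ∂surf

theorem continuous_integral_sphere {f : ℝ → S2 → F} (hf : Continuous f.uncurry) :
    Continuous fun r => ∫ z, f r z ∂surf := by
  simpa using continuous_parametric_integral_of_continuous (μ := surf) hf isCompact_univ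

theorem continuous_sphInt {ψ : E3 → F} (hψ : Continuous ψ) : Continuous (sphInt ψ) :=
  continuous_integral_sphere (f := fun r z => ψ (r • (z : E3))) (by
    simp only [Function.uncurry_def]; fun_prop)

theorem continuous_sphDeriv {ψ : E3 → F} (hψ : ContDiff ℝ ∞ ψ) : Continuous (sphDeriv ψ) := by
  have := hψ.continuous_fderiv (by simp)
  refine continuous_integral_sphere (f := fun r z => fderiv ℝ ψ (r • (z : E3)) z) ?_
  simp only [Function.uncurry_def]; fun_prop

theorem hasDerivAt_sphInt {ψ : E3 → F} (hψ : ContDiff ℝ ∞ ψ) (r : ℝ) :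
    HasDerivAt (sphInt ψ) (sphDeriv ψ r) r := by
  have hc := hψ.continuous_fderiv (by simp)
  have hc' : Continuous fun p : ℝ × S2 => fderiv ℝ ψ (p.1 • (p.2 : E3)) p.2 := by fun_prop
  obtain ⟨B, hB⟩ := ((isCompact_Icc (a := r - 1) (b := r + 1)).prod
    (isCompact_univ (X := S2))).exists_bound_of_continuousOn hc'.continuousOn
  have hcψ : ∀ r : ℝ, Continuous fun z : S2 => ψ (r • (z : E3)) := fun r => by
    have := hψ.continuous; fun_prop
  refine (hasDerivAt_integral_of_dominated_loc_of_deriv_le (bound := fun _ => B)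
    (F := fun r (z : S2) => ψ (r • (z : E3)))
    (F' := fun r (z : S2) => fderiv ℝ ψ (r • (z : E3)) z)
    (Icc_mem_nhds (sub_one_lt r) (lt_add_one r)) ?_ ?_ ?_ ?_ ?_ ?_).2
  · exact Eventually.of_forall fun r => (hcψ r).aestronglyMeasurable
  · exact (hcψ r).integrable_of_hasCompactSupport (HasCompactSupport.of_compactSpace _)
  · exact (hc'.comp (Continuous.prodMk_right r)).aestronglyMeasurable
  · exact Eventually.of_forall fun z s hs => hB (s, z) ⟨hs, mem_univ _⟩
  · exact integrable_const _
  · refine Eventually.of_forall fun z s _ => ?_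
    have h1 : HasDerivAt (fun s : ℝ => s • (z : E3)) (z : E3) s := by
      simpa using (hasDerivAt_id s).smul_const (z : E3)
    exact ((hψ.differentiable (by simp)) _).hasFDerivAt.comp_hasDerivAt s h1

variable {g : ℝ → ℝ}

theorem eventually_eq_zero_of_tsupport_subset_Ioi (hg : tsupport g ⊆ Ioi 0) :
    ∀ᶠ x : E3 in 𝓝 0, g ‖x‖ = 0 := by
  have h0 : g =ᶠ[𝓝 0] 0 := notMem_tsupport_iff_eventuallyEq.1 fun h => lt_irrefl (0 : ℝ) (hg h)
  have : Tendsto (fun x : E3 => ‖x‖) (𝓝 0) (𝓝 0) := tendsto_norm_zero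
  exact this.eventually h0

/-- The norm is not smooth at the origin, but `g ‖x‖` vanishes near it. -/
theorem isTest_radial (h1 : ContDiff ℝ ∞ g) (h2 : HasCompactSupport g) (h3 : tsupport g ⊆ Ioi 0) :
    IsTest fun x : E3 => g ‖x‖ := by
  refine ⟨contDiff_iff_contDiffAt.2 fun x => ?_, ?_⟩
  · rcases eq_or_ne x 0 with rfl | hx
    · exact (contDiffAt_const (c := (0 : ℝ))).congr_of_eventuallyEq
        (eventually_eq_zero_of_tsupport_subset_Ioi h3)
    · exact h1.contDiffAt.comp x (contDiffAt_norm ℝ hx)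
  · obtain ⟨R, hR⟩ := h2.isCompact.isBounded.subset_closedBall 0
    refine HasCompactSupport.intro (isCompact_closedBall (0 : E3) R) fun x hx => ?_
    refine image_eq_zero_of_notMem_tsupport fun h => hx ?_
    simpa using hR h

theorem fderiv_radial (h1 : ContDiff ℝ ∞ g) (h3 : tsupport g ⊆ Ioi 0) (x v : E3) :
    fderiv ℝ (fun x : E3 => g ‖x‖) x v = deriv g ‖x‖ / ‖x‖ * ⟪x, v⟫ := by
  rcases eq_or_ne x 0 with rfl | hx
  · rw [Filter.EventuallyEq.fderiv_eq
      (show (fun x : E3 => g ‖x‖) =ᶠ[𝓝 0] fun _ => 0 from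
        eventually_eq_zero_of_tsupport_subset_Ioi h3)]
    simp
  · have hn : HasFDerivAt (fun x : E3 => ‖x‖) (‖x‖⁻¹ • innerSL ℝ x) x := by
      have h := ((hasStrictFDerivAt_norm_sq x).hasFDerivAt).sqrt (by positivity)
      simp only [Real.sqrt_sq (norm_nonneg _)] at h
      refine h.congr_fderiv ?_
      ext v
      simp
      field_simp
    have hd := ((h1.differentiable (by simp)) ‖x‖).hasDerivAt.comp_hasFDerivAt x hn
    rw [show (fun x : E3 => g ‖x‖) = g ∘ fun x : E3 => ‖x‖ from rfl, hd.fderiv]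
    simp
    ring

theorem sum_fderiv_radial_smul (h1 : ContDiff ℝ ∞ g) (h3 : tsupport g ⊆ Ioi 0)
    (L : E3 →L[ℝ] F) (x : E3) :
    ∑ i, fderiv ℝ (fun x : E3 => g ‖x‖) x (stdE i) • L (stdE i) = (deriv g ‖x‖ / ‖x‖) • L x := by
  have hx : ∑ i, x i • stdE i = x := by
    have := (EuclideanSpace.basisFun (Fin 3) ℝ).sum_repr x
    simpa using this
  have hL : L x = ∑ i, x i • L (stdE i) := by
    conv_lhs => rw [← hx, map_sum]
    simp only [map_smul]
  rw [hL, Finset.smul_sum]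
  refine Finset.sum_congr rfl fun i _ => ?_
  have hi : ⟪x, stdE i⟫ = x i := by simp [stdE, EuclideanSpace.inner_single_right]
  rw [fderiv_radial h1 h3, smul_smul, hi]

/-- Integration by parts in each coordinate. The gradient of a radial weight is radial, so only the
derivative of `ψ` along `x` survives. -/
theorem integral_radial_smul_laplacian {ψ : E3 → F} (hψ : IsTest ψ)
    (h1 : ContDiff ℝ ∞ g) (h2 : HasCompactSupport g) (h3 : tsupport g ⊆ Ioi 0) :
    ∫ x : E3, g ‖x‖ • Laplacian.laplacian ψ x
      = -∫ x : E3, (deriv g ‖x‖ / ‖x‖) • fderiv ℝ ψ x x := by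
  have hG := isTest_radial h1 h2 h3
  have hi : ∀ {a : E3 → ℝ} {b : E3 → F}, IsTest a → IsTest b → Integrable fun x => a x • b x :=
    fun ha hb => (ha.smul hb.1).integrable
  have key : ∀ i, ∫ x : E3, g ‖x‖ • fderiv ℝ (fun y => fderiv ℝ ψ y (stdE i)) x (stdE i)
      = -∫ x : E3, fderiv ℝ (fun x : E3 => g ‖x‖) x (stdE i) • fderiv ℝ ψ x (stdE i) := fun i =>
    integral_smul_fderiv_eq_neg_fderiv_smul_of_integrable
      (hi (hG.fderiv_apply _) (hψ.fderiv_apply _))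
      (hi hG ((hψ.fderiv_apply _).fderiv_apply _)) (hi hG (hψ.fderiv_apply _))
      (fun x _ => hG.differentiable x) (fun x _ => (hψ.fderiv_apply _).differentiable x)
  simp only [laplacian_eq_sum_fderiv hψ.1, Finset.smul_sum, ← sum_fderiv_radial_smul h1 h3]
  rw [integral_finsetSum _ fun i _ => hi hG ((hψ.fderiv_apply _).fderiv_apply _),
    integral_finsetSum _ fun i _ => hi (hG.fderiv_apply _) (hψ.fderiv_apply _),
    ← Finset.sum_neg_distrib]
  exact Finset.sum_congr rfl fun i _ => key i

variable [CompleteSpace F]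

/-- The divergence theorem on balls, for gradients. -/
theorem sq_smul_sphDeriv {ψ : E3 → F} (hψ : IsTest ψ) {r : ℝ} (hr : 0 ≤ r) :
    r ^ 2 • sphDeriv ψ r = ∫ s in (0 : ℝ)..r, s ^ 2 • sphInt (Laplacian.laplacian ψ) s := by
  set I : ℝ → F := fun r => ∫ s in (0 : ℝ)..r, s ^ 2 • sphInt (Laplacian.laplacian ψ) s with hI
  have hcS : Continuous fun s : ℝ => s ^ 2 • sphInt (Laplacian.laplacian ψ) s :=
    (continuous_pow 2).smul (continuous_sphInt hψ.laplacian.1.continuous)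
  have hId : ∀ r, HasDerivAt I (r ^ 2 • sphInt (Laplacian.laplacian ψ) r) r := fun r =>
    intervalIntegral.integral_hasDerivAt_right (hcS.intervalIntegrable _ _)
      (hcS.stronglyMeasurableAtFilter _ _) hcS.continuousAt
  have hIc : Continuous I := continuous_iff_continuousAt.2 fun r => (hId r).continuousAt
  have hcD : Continuous fun s : ℝ => s ^ 2 • sphDeriv ψ s :=
    (continuous_pow 2).smul (continuous_sphDeriv hψ.1)
  have hcn : Continuous fun r : ℝ => r ^ 2 • sphDeriv ψ r - I r := hcD.sub hIc
  -- Green's identity with radial weights, in polar coordinates, says that the difference of the two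
  -- sides has zero distributional derivative on the half-line.
  have hweak : ∀ g : ℝ → ℝ, ContDiff ℝ ∞ g → HasCompactSupport g → tsupport g ⊆ Ioi 0 →
      ∫ r, deriv g r • (r ^ 2 • sphDeriv ψ r - I r) = 0 := by
    intro g g1 g2 g3
    have hdg : Continuous (deriv g) := (contDiff_infty_iff_deriv.1 g1).2.continuous
    have hcs : HasCompactSupport (deriv g) := g2.deriv
    have hz : ∀ r : ℝ, r ≤ 0 → g r = 0 := fun r hr =>
      image_eq_zero_of_notMem_tsupport fun h => absurd (g3 h) (not_lt.2 hr)
    have hz' : ∀ r : ℝ, r ≤ 0 → deriv g r = 0 := fun r hr =>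
      image_eq_zero_of_notMem_tsupport fun h =>
        absurd (g3 (tsupport_deriv_subset (𝕜 := ℝ) h)) (not_lt.2 hr)
    have e1 := integral_radial_smul_laplacian hψ g1 g2 g3
    have hG := isTest_radial g1 g2 g3
    rw [integral_radial_smul (hG.smul hψ.laplacian.1).integrable] at e1
    have hint : Integrable fun x : E3 => (deriv g ‖x‖ / ‖x‖) • fderiv ℝ ψ x x := by
      simp only [← sum_fderiv_radial_smul g1 g3]
      exact integrable_finsetSum _ fun i _ =>
        ((hG.fderiv_apply (stdE i)).smul (hψ.fderiv_apply (stdE i)).1).integrable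
    rw [integral_radial_smul (w := fun r => deriv g r / r) hint] at e1
    have e2 : ∫ r in Ioi (0 : ℝ), (r ^ 2 * (deriv g r / r)) •
        (∫ z : S2, fderiv ℝ ψ (r • (z : E3)) (r • (z : E3)) ∂surf)
        = ∫ r, deriv g r • (r ^ 2 • sphDeriv ψ r) := by
      rw [← setIntegral_eq_integral_of_forall_compl_eq_zero (s := Ioi (0 : ℝ))
        (f := fun r => deriv g r • (r ^ 2 • sphDeriv ψ r))
        fun r hr => by rw [hz' r (not_lt.1 hr), zero_smul]]
      refine setIntegral_congr_fun measurableSet_Ioi fun r (hr : 0 < r) => ?_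
      simp only [map_smul, integral_smul, smul_smul, sphDeriv]
      congr 1
      field_simp
    have e3 : ∫ r in Ioi (0 : ℝ), (r ^ 2 * g r) •
        (∫ z : S2, Laplacian.laplacian ψ (r • (z : E3)) ∂surf)
        = ∫ r, g r • (r ^ 2 • sphInt (Laplacian.laplacian ψ) r) := by
      rw [← setIntegral_eq_integral_of_forall_compl_eq_zero (s := Ioi (0 : ℝ))
        (f := fun r => g r • (r ^ 2 • sphInt (Laplacian.laplacian ψ) r))
        fun r hr => by rw [hz r (not_lt.1 hr), zero_smul]]
      refine setIntegral_congr_fun measurableSet_Ioi fun r (hr : 0 < r) => ?_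
      simp only [smul_smul, sphInt, mul_comm]
    have i1 : Integrable fun r => g r • (r ^ 2 • sphInt (Laplacian.laplacian ψ) r) :=
      (g1.continuous.smul hcS).integrable_of_hasCompactSupport g2.smul_right
    have i2 : Integrable fun r => deriv g r • I r :=
      (hdg.smul hIc).integrable_of_hasCompactSupport hcs.smul_right
    have i3 : Integrable fun r => g r • I r :=
      (g1.continuous.smul hIc).integrable_of_hasCompactSupport g2.smul_right
    have e4 := integral_bilinear_hasDerivAt_right_eq_neg_left_of_integrable
      (L := ContinuousLinearMap.lsmul ℝ ℝ)
      (fun r _ => ((g1.differentiable (by simp)) r).hasDerivAt) (fun r _ => hId r) i1 i2 i3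
    simp only [ContinuousLinearMap.lsmul_apply] at e4
    rw [e2, e3, e4, neg_inj] at e1
    simp only [smul_sub]
    rw [integral_sub _ i2, e1, sub_self]
    exact (hdg.smul hcD).integrable_of_hasCompactSupport hcs.smul_right
  obtain ⟨C, hC⟩ := ae_eq_const_of_integral_deriv_smul_eq_zero
    (n := fun r => r ^ 2 • sphDeriv ψ r - I r) (hcn.locallyIntegrable.locallyIntegrableOn _)  hweak
  have h1 : EqOn (fun r => r ^ 2 • sphDeriv ψ r - I r) (fun _ => C) (Ioi 0) := by
    refine Measure.eqOn_open_of_ae_eq (μ := volume) ?_ isOpen_Ioi hcn.continuousOn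
      continuousOn_const
    exact (ae_restrict_iff' measurableSet_Ioi).2 hC
  have h2 : EqOn (fun r => r ^ 2 • sphDeriv ψ r - I r) (fun _ => C) (closure (Ioi 0)) :=
    h1.closure hcn continuous_const
  rw [closure_Ioi] at h2
  -- The difference is continuous up to the radius zero, where it vanishes; this fixes the constant.
  have h0 : (0 : F) = C := by simpa [hI] using h2 (self_mem_Ici (a := (0 : ℝ)))
  have := h2 (mem_Ici.2 hr)
  rw [← h0] at this
  exact sub_eq_zero.1 this

/-- `r` times the spherical mean of `ψ` over the sphere of radius `r`. -/
def radMean (ψ : E3 → F) (r : ℝ) : F := (r / (4 * Real.pi)) • sphInt ψ r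

/-- The derivative of `radMean ψ`. -/
def radMeanDeriv (ψ : E3 → F) (r : ℝ) : F :=
  (4 * Real.pi)⁻¹ • (sphInt ψ r + r • sphDeriv ψ r)

omit [CompleteSpace F] in
theorem continuous_radMean {ψ : E3 → F} (hψ : Continuous ψ) : Continuous (radMean ψ) :=
  (by fun_prop : Continuous fun r : ℝ => r / (4 * Real.pi)).smul (continuous_sphInt hψ)

omit [CompleteSpace F] in
theorem continuous_radMeanDeriv {ψ : E3 → F} (hψ : ContDiff ℝ ∞ ψ) :
    Continuous (radMeanDeriv ψ) :=
  ((continuous_sphInt hψ.continuous).add (continuous_id.smul (continuous_sphDeriv hψ))).const_smul _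

omit [CompleteSpace F] in
theorem hasDerivAt_radMean {ψ : E3 → F} (hψ : ContDiff ℝ ∞ ψ) (r : ℝ) :
    HasDerivAt (radMean ψ) (radMeanDeriv ψ r) r := by
  have h := ((hasDerivAt_id r).div_const (4 * Real.pi)).smul (hasDerivAt_sphInt hψ r)
  refine h.congr_deriv ?_
  rw [radMeanDeriv]
  simp only [id]
  module

omit [CompleteSpace F] in
theorem radMean_zero (ψ : E3 → F) : radMean ψ 0 = 0 := by simp [radMean]

/-- This boundary value is what produces the Dirac measure in the integrations by parts below. -/
theorem radMeanDeriv_zero (ψ : E3 → F) : radMeanDeriv ψ 0 = ψ 0 := by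
  have : (4 * Real.pi)⁻¹ * (4 * Real.pi) = 1 := by field_simp
  simp only [radMeanDeriv, sphInt, zero_smul, integral_const, surf_real_univ, add_zero, smul_smul,
    this, one_smul]

/-- Darboux's equation for the spherical means. -/
theorem hasDerivAt_radMeanDeriv {ψ : E3 → F} (hψ : IsTest ψ) {r : ℝ} (hr : 0 < r) :
    HasDerivAt (radMeanDeriv ψ) (radMean (Laplacian.laplacian ψ) r) r := by
  set I : ℝ → F := fun r => ∫ s in (0 : ℝ)..r, s ^ 2 • sphInt (Laplacian.laplacian ψ) s with hI
  have hcS : Continuous fun s : ℝ => s ^ 2 • sphInt (Laplacian.laplacian ψ) s :=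
    (continuous_pow 2).smul (continuous_sphInt hψ.laplacian.1.continuous)
  have hId : HasDerivAt I (r ^ 2 • sphInt (Laplacian.laplacian ψ) r) r :=
    intervalIntegral.integral_hasDerivAt_right (hcS.intervalIntegrable _ _)
      (hcS.stronglyMeasurableAtFilter _ _) hcS.continuousAt
  -- The divergence theorem expresses `sphDeriv` through a primitive, which is differentiable
  -- without differentiating once more under the spherical integral.
  have heq : ∀ s : ℝ, 0 < s → s • sphDeriv ψ s = s⁻¹ • I s := fun s hs => by
    rw [show I s = s ^ 2 • sphDeriv ψ s from (sq_smul_sphDeriv hψ hs.le).symm, smul_smul]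
    congr 1
    field_simp
  have h1 : HasDerivAt (fun s => s⁻¹ • I s) (r⁻¹ • (r ^ 2 • sphInt (Laplacian.laplacian ψ) r)
      + (-(r ^ 2)⁻¹) • I r) r := (hasDerivAt_inv hr.ne').smul hId
  have h2 := ((hasDerivAt_sphInt hψ.1 r).add (h1.congr_of_eventuallyEq
    (f₁ := fun s => s • sphDeriv ψ s) (by
      filter_upwards [lt_mem_nhds hr] with s hs using heq s hs))).const_smul (4 * Real.pi)⁻¹
  refine h2.congr_deriv ?_
  have hIr : I r = r ^ 2 • sphDeriv ψ r := (sq_smul_sphDeriv hψ hr.le).symm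
  rw [hIr, radMean, smul_smul, smul_smul, neg_mul, inv_mul_cancel₀ (by positivity),
    show r⁻¹ * r ^ 2 = r by field_simp, show r / (4 * Real.pi) = (4 * Real.pi)⁻¹ * r by
      field_simp]
  module

omit [CompleteSpace F] in
/-- Integration of a function times a radial weight, in terms of spherical means. -/
theorem integral_radial_smul_eq_radMean {w : ℝ → ℝ} {f : E3 → F}
    (hf : Integrable fun x => w ‖x‖ • f x) :
    ∫ x, w ‖x‖ • f x = ∫ r in Ioi (0 : ℝ), (4 * Real.pi * r * w r) • radMean f r := by
  rw [integral_radial_smul hf]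
  refine setIntegral_congr_fun measurableSet_Ioi fun r _ => ?_
  simp only [radMean, sphInt, smul_smul]
  congr 1
  field_simp

end Spherical

/-! ### Square integrable fields -/

theorem toL2_eq {f : E3 → E3} (h : MemLp f 2 (volume : Measure E3)) : toL2 f = h.toLp f :=
  dif_pos h

theorem coeFn_toL2 {f : E3 → E3} (h : MemLp f 2 (volume : Measure E3)) : toL2 f =ᵐ[volume] f := by
  rw [toL2_eq h]; exact h.coeFn_toLp

theorem toL2_congr {f g : E3 → E3} (hf : MemLp f 2 (volume : Measure E3)) (h : f =ᵐ[volume] g) :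
    toL2 f = toL2 g := by
  rw [toL2_eq hf, toL2_eq (hf.ae_eq h)]
  exact (MemLp.toLp_eq_toLp_iff _ _).2 h

theorem inner_toL2 {f : E3 → E3} (h : MemLp f 2 (volume : Measure E3)) (u : L2V) :
    ⟪toL2 f, u⟫ = ∫ x, ⟪f x, u x⟫ := by
  rw [L2.inner_def]
  refine integral_congr_ae ?_
  filter_upwards [coeFn_toL2 h] with x hx
  rw [hx]

theorem integrable_inner_of_memLp {f : E3 → E3} (h : MemLp f 2 (volume : Measure E3)) (u : L2V) :
    Integrable fun x => ⟪f x, u x⟫ := by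
  refine (L2.integrable_inner (𝕜 := ℝ) (toL2 f) u).congr ?_
  filter_upwards [coeFn_toL2 h] with x hx
  rw [hx]

theorem memLp_smul_vec {k : E3 → ℝ} (hk : MemLp k 2 (volume : Measure E3)) (c : E3) :
    MemLp (fun x => k x • c) 2 (volume : Measure E3) := by
  refine MemLp.of_le_mul (c := ‖c‖) hk (hk.1.smul_const c) ?_
  exact Eventually.of_forall fun x => by rw [norm_smul, mul_comm]

theorem integrable_smul_L2 {k : E3 → ℝ} (hk : MemLp k 2 (volume : Measure E3)) (u : L2V) :
    Integrable fun x => k x • u x :=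
  memLp_one_iff_integrable.1 ((Lp.memLp u).smul hk)

/-- The pairing `u ↦ ∫ k u` with a square integrable scalar function `k`. -/
def pairing (k : E3 → ℝ) : L2V →L[ℝ] E3 :=
  ∑ i, (innerSL ℝ (toL2 fun x => k x • stdE i)).smulRight (stdE i)

theorem pairing_apply {k : E3 → ℝ} (hk : MemLp k 2 (volume : Measure E3)) (u : L2V) :
    pairing k u = ∫ x, k x • u x := by
  have h1 := (EuclideanSpace.basisFun (Fin 3) ℝ).sum_repr (∫ x, k x • u x)
  rw [← h1, pairing, sum_apply]
  refine Finset.sum_congr rfl fun i _ => ?_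
  rw [ContinuousLinearMap.smulRight_apply, innerSL_apply_apply, inner_toL2 (memLp_smul_vec hk _)]
  have h2 : (EuclideanSpace.basisFun (Fin 3) ℝ).repr (∫ x, k x • u x) i
      = ⟪stdE i, ∫ x, k x • u x⟫ := by
    simp [EuclideanSpace.inner_single_left]
  rw [h2, ← integral_inner (integrable_smul_L2 hk u)]
  simp [inner_smul_left, inner_smul_right]

theorem eq_of_forall_inner_test {u v : L2V}
    (h : ∀ ψ : E3 → E3, IsTest ψ → ⟪toL2 ψ, u⟫ = ⟪toL2 ψ, v⟫) : u = v := by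
  refine Lp.ext (ae_eq_of_integral_contDiff_smul_eq
    ((Lp.memLp u).locallyIntegrable (by norm_num)) ((Lp.memLp v).locallyIntegrable (by norm_num))
    fun g g1 g2 => ?_)
  have hg : IsTest g := ⟨g1, g2⟩
  rw [← pairing_apply (hg.memLp 2), ← pairing_apply (hg.memLp 2)]
  simp only [pairing, sum_apply, ContinuousLinearMap.smulRight_apply,
    innerSL_apply_apply]
  exact Finset.sum_congr rfl fun i _ => by rw [h _ (hg.smul contDiff_const)]

/-! ### Translations -/

/-- The translation `(trans y u)(x) = u(x + y)`. -/
def trans (y : E3) : L2V →ₗᵢ[ℝ] L2V :=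
  Lp.compMeasurePreservingₗᵢ ℝ (fun x => x + y) (measurePreserving_add_right volume y)

theorem coeFn_trans (y : E3) (u : L2V) : trans y u =ᵐ[volume] fun x => u (x + y) :=
  Lp.coeFn_compMeasurePreserving u (measurePreserving_add_right volume y)

theorem continuous_trans (u : L2V) : Continuous fun y => trans y u :=
  Continuous.compMeasurePreservingLp (f := fun _ : E3 => u)
    (g := fun y : E3 => ⟨fun x : E3 => x + y, by fun_prop⟩) continuous_const
    (ContinuousMap.continuous_of_continuous_uncurry _ (by
      simp only [Function.uncurry_def]
      exact continuous_snd.add continuous_fst))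
    (fun y => measurePreserving_add_right volume y) (by simp)

theorem memLp_comp_add_right {f : E3 → E3} (h : MemLp f 2 (volume : Measure E3)) (y : E3) :
    MemLp (fun x => f (x + y)) 2 (volume : Measure E3) :=
  h.comp_measurePreserving (measurePreserving_add_right volume y)

theorem trans_toL2 {f : E3 → E3} (h : MemLp f 2 (volume : Measure E3)) (y : E3) :
    trans y (toL2 f) = toL2 fun x => f (x + y) := by
  rw [toL2_eq h, toL2_eq (memLp_comp_add_right h y)]
  rfl

theorem inner_trans_left (y : E3) (u v : L2V) : ⟪trans y u, v⟫ = ⟪u, trans (-y) v⟫ := by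
  rw [L2.inner_def, L2.inner_def,
    ← (measurePreserving_add_right volume y).integral_comp'
      (f := MeasurableEquiv.addRight y) (fun x => ⟪u x, trans (-y) v x⟫)]
  refine integral_congr_ae ?_
  filter_upwards [coeFn_trans y u, (measurePreserving_add_right volume y).quasiMeasurePreserving.ae
    (coeFn_trans (-y) v)] with x h1 h2
  simp only [MeasurableEquiv.coe_addRight]
  rw [h1, h2]
  simp

theorem trans_zero (u : L2V) : trans 0 u = u := by
  refine Lp.ext ?_
  filter_upwards [coeFn_trans 0 u] with x hx
  simpa using hx

theorem gradient_comp_add_right (φ : E3 → ℝ) (y x : E3) :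
    ∇ (fun x => φ (x + y)) x = ∇ φ (x + y) := by
  simp only [gradient, fderiv_comp_add_right]

theorem isTest_gradient {φ : E3 → ℝ} (hφ : IsTest φ) : IsTest fun x => ∇ φ x := by
  refine ⟨?_, ?_⟩
  · exact (InnerProductSpace.toDual ℝ E3).symm.toContinuousLinearEquiv.contDiff.comp
      (hφ.1.fderiv_right (m := ∞) (by simp))
  · exact (hφ.2.fderiv ℝ).comp_left (g := (InnerProductSpace.toDual ℝ E3).symm) (map_zero _)

theorem mem_L2div_iff {u : L2V} :
    u ∈ L2div ↔ ∀ φ : E3 → ℝ, IsTest φ → ⟪toL2 fun x => ∇ φ x, u⟫ = 0 := by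
  rw [L2div, Submodule.mem_orthogonal]
  constructor
  · intro h φ hφ
    exact h _ (Submodule.subset_span ⟨φ, hφ, coeFn_toL2 ((isTest_gradient hφ).memLp 2)⟩)
  · intro h w hw
    induction hw using Submodule.span_induction with
    | mem w hw =>
      obtain ⟨φ, hφ, hw⟩ := hw
      have : w = toL2 fun x => ∇ φ x :=
        Lp.ext (hw.trans (coeFn_toL2 ((isTest_gradient hφ).memLp 2)).symm)
      rw [this, h φ hφ]
    | zero => simp
    | add a b _ _ ha hb => rw [inner_add_left, ha, hb, add_zero]
    | smul c a _ ha => rw [inner_smul_left, ha, mul_zero]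

theorem trans_mem_L2div {u : L2V} (hu : u ∈ L2div) (y : E3) : trans y u ∈ L2div := by
  rw [mem_L2div_iff] at *
  intro φ hφ
  have h := inner_trans_left (-y) (toL2 fun x => ∇ φ x) u
  rw [neg_neg, trans_toL2 ((isTest_gradient hφ).memLp 2)] at h
  rw [← h]
  simpa only [gradient_comp_add_right] using hu _ (hφ.comp_add_right (-y))

/-- Translations are unitary and preserve the divergence-free fields, hence also their orthogonal
complement. -/
theorem trans_M (y : E3) (u : L2V) : trans y (M u) = M (trans y u) := by
  refine (Submodule.eq_starProjection_of_mem_of_inner_eq_zero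
    (trans_mem_L2div (L2div.starProjection_apply_mem u) y) fun w hw => ?_).symm
  rw [← map_sub, inner_trans_left]
  exact L2div.starProjection_inner_eq_zero u _ (trans_mem_L2div hw _)

/-! ### Averages of translates -/

/-- The average `∫ k(y) u(· + y) dy` of the translates of `u`. -/
def avg (k : E3 → ℝ) (u : L2V) : L2V := ∫ y, k y • trans y u

section Avg

variable {k : E3 → ℝ}

theorem integrable_smul_trans (hk : Integrable k) (u : L2V) :
    Integrable fun y => k y • trans y u := by
  refine Integrable.mono' (hk.norm.mul_const ‖u‖)
    (hk.1.smul (continuous_trans u).aestronglyMeasurable) (Eventually.of_forall fun y => ?_)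
  rw [norm_smul, LinearIsometry.norm_map]

theorem inner_avg_right (hk : Integrable k) (v u : L2V) :
    ⟪v, avg k u⟫ = ∫ y, k y * ⟪v, trans y u⟫ := by
  rw [avg, ← integral_inner (integrable_smul_trans hk u)]
  simp only [inner_smul_right]

theorem inner_avg_left_eq_right (hk : Integrable k) (he : ∀ y, k (-y) = k y) (u v : L2V) :
    ⟪avg k u, v⟫ = ⟪u, avg k v⟫ := by
  rw [real_inner_comm, inner_avg_right hk, inner_avg_right hk,
    ← integral_neg_eq_self (fun y => k y * ⟪u, trans y v⟫)]
  refine integral_congr_ae (Eventually.of_forall fun y => ?_)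
  simp only
  rw [he, ← inner_trans_left, real_inner_comm]

theorem norm_avg_le (hk : Integrable k) (h0 : ∀ y, 0 ≤ k y) (u : L2V) :
    ‖avg k u‖ ≤ (∫ y, k y) * ‖u‖ := by
  rw [avg, ← integral_mul_const]
  refine norm_integral_le_of_norm_le (hk.mul_const _) (Eventually.of_forall fun y => ?_)
  rw [norm_smul, LinearIsometry.norm_map, Real.norm_of_nonneg (h0 y)]

/-- The average is a Bochner integral in `L²`, so a bounded operator that commutes with translations
passes through it. -/
theorem M_avg (hk : Integrable k) (u : L2V) : M (avg k u) = avg k (M u) := by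
  rw [avg, ← ContinuousLinearMap.integral_comp_comm _ (integrable_smul_trans hk u), avg]
  simp only [map_smul, trans_M]

/-- Averages with respect to nonnegative kernels of mass one that concentrate at the origin
converge to the identity. -/
theorem tendsto_avg {K : ℝ → E3 → ℝ} (hK : ∀ h, 0 < h → Integrable (K h))
    (h0 : ∀ h y, 0 < h → 0 ≤ K h y) (h1 : ∀ h, 0 < h → ∫ y, K h y = 1)
    (hs : ∀ h y, 0 < h → h ≤ ‖y‖ → K h y = 0) (u : L2V) :
    Tendsto (fun h => avg (K h) u) (𝓝[>] 0) (𝓝 u) := by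
  rw [Metric.tendsto_nhdsWithin_nhds]
  intro ε hε
  have hc := (continuous_trans u).continuousAt (x := 0)
  rw [Metric.continuousAt_iff] at hc
  obtain ⟨δ, hδ, hc⟩ := hc (ε / 2) (by positivity)
  refine ⟨δ, hδ, fun h (hh : 0 < h) hd => ?_⟩
  have hhδ : h < δ := by simpa [abs_of_pos hh] using hd
  have e1 : avg (K h) u - u = ∫ y, K h y • (trans y u - u) := by
    simp only [smul_sub]
    rw [integral_sub (integrable_smul_trans (hK h hh) u) ((hK h hh).smul_const u),
      integral_smul_const, h1 h hh, one_smul, avg]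
  rw [dist_eq_norm, e1]
  refine (norm_integral_le_of_norm_le ((hK h hh).mul_const (ε / 2))
    (Eventually.of_forall fun y => ?_)).trans_lt ?_
  · rw [norm_smul, Real.norm_of_nonneg (h0 h y hh)]
    rcases lt_or_ge ‖y‖ h with hy | hy
    · refine mul_le_mul_of_nonneg_left ?_ (h0 h y hh)
      have := hc (x := y) (by simpa using hy.trans hhδ)
      rw [trans_zero, dist_eq_norm] at this
      exact this.le
    · rw [hs h y hh hy]; simp
  · rw [integral_mul_const, h1 h hh]; linarith

/-- The Fubini hypothesis: Cauchy–Schwarz in `x` gives a bound uniform in `y`, by translation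
invariance of the norm, and `k` is integrable in `y`. -/
theorem integrable_prod_smul_comp_add {φ : E3 → ℝ} (hφ : MemLp φ 2 volume) (hk : Integrable k)
    (u : L2V) : Integrable (fun p : E3 × E3 => (φ p.1 * k p.2) • u (p.1 + p.2))
      ((volume : Measure E3).prod volume) := by
  have hm : AEStronglyMeasurable (fun p : E3 × E3 => (φ p.1 * k p.2) • u (p.1 + p.2))
      ((volume : Measure E3).prod volume) :=
    ((hφ.1.comp_fst).mul (hk.1.comp_snd)).smul
      ((Lp.stronglyMeasurable u).comp_measurable (measurable_fst.add measurable_snd)).aestronglyMeasurable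
  rw [integrable_prod_iff' hm]
  constructor
  · refine Eventually.of_forall fun y => ?_
    have h := (integrable_smul_L2 hφ (trans y u)).smul (k y)
    refine h.congr ?_
    filter_upwards [coeFn_trans y u] with x hx
    simp only [Pi.smul_apply]
    rw [hx, smul_smul, mul_comm]
  · refine Integrable.mono' (g := fun y => |k y| * ((eLpNorm φ 2 volume).toReal * ‖u‖))
      (hk.abs.mul_const _) hm.norm.prod_swap.integral_prod_right' (Eventually.of_forall fun y => ?_)
    rw [Real.norm_of_nonneg (integral_nonneg fun _ => norm_nonneg _)]
    have e : ∀ᵐ x, ‖(φ x * k y) • u (x + y)‖ = |k y| * (‖φ x‖ * ‖trans y u x‖) := by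
      filter_upwards [coeFn_trans y u] with x hx
      rw [hx, norm_smul, norm_mul, Real.norm_eq_abs (k y)]; ring
    rw [integral_congr_ae e, integral_const_mul]
    refine mul_le_mul_of_nonneg_left ?_ (abs_nonneg _)
    have hH := integral_mul_norm_le_Lp_mul_Lq (μ := (volume : Measure E3)) (f := φ)
      (g := fun x => ‖trans y u x‖) (p := 2) (q := 2) Real.HolderConjugate.two_two (by simpa using hφ)
      (by simpa using (Lp.memLp (trans y u)).norm)
    have hn1 : (∫ x, ‖φ x‖ ^ (2 : ℝ)) ^ (1 / (2 : ℝ)) = (eLpNorm φ 2 volume).toReal := by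
      rw [hφ.eLpNorm_eq_integral_rpow_norm (by norm_num) (by norm_num), ENNReal.toReal_ofReal
        (by positivity)]
      norm_num
    have hn2 : (∫ x, ‖trans y u x‖ ^ (2 : ℝ)) ^ (1 / (2 : ℝ)) = ‖u‖ := by
      rw [← LinearIsometry.norm_map (trans y) u, Lp.norm_def,
        (Lp.memLp (trans y u)).eLpNorm_eq_integral_rpow_norm (by norm_num) (by norm_num),
        ENNReal.toReal_ofReal (by positivity)]
      norm_num
    simp only [norm_norm] at hH
    rwa [hn1, hn2] at hH

/-- Both sides are locally integrable, and Fubini shows that they have the same integrals against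
test functions. -/
theorem coeFn_avg (hk : Integrable k) (u : L2V) :
    avg k u =ᵐ[volume] fun x => ∫ y, k y • u (x + y) := by
  have hloc : LocallyIntegrable (fun x => ∫ y, k y • u (x + y)) := by
    rw [locallyIntegrable_iff]
    intro S hS
    have hφ : MemLp (S.indicator fun _ => (1 : ℝ)) 2 (volume : Measure E3) :=
      memLp_indicator_const 2 hS.measurableSet 1 (Or.inr hS.measure_lt_top.ne)
    have h := (integrable_prod_smul_comp_add hφ hk u).integral_prod_left
    rw [← integrable_indicator_iff hS.measurableSet]
    refine h.congr (Eventually.of_forall fun x => ?_)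
    simp only [mul_smul]
    rw [integral_smul]
    by_cases hx : x ∈ S <;> simp [hx]
  refine ae_eq_of_integral_contDiff_smul_eq ((Lp.memLp _).locallyIntegrable (by norm_num)) hloc
    fun φ φ1 φ2 => ?_
  have hφ : MemLp φ 2 (volume : Measure E3) := IsTest.memLp ⟨φ1, φ2⟩ 2
  rw [← pairing_apply hφ, avg,
    ← ContinuousLinearMap.integral_comp_comm _ (integrable_smul_trans hk u)]
  have hi := integrable_prod_smul_comp_add hφ hk u
  have e1 : ∀ x, φ x • ∫ y, k y • u (x + y) = ∫ y, (φ x * k y) • u (x + y) := fun x => by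
    rw [← integral_smul]
    simp only [smul_smul]
  simp only [e1]
  rw [integral_integral_swap (f := fun x y => (φ x * k y) • u (x + y)) hi]
  refine integral_congr_ae (Eventually.of_forall fun y => ?_)
  simp only
  rw [map_smul, pairing_apply hφ, ← integral_smul]
  refine integral_congr_ae ?_
  filter_upwards [coeFn_trans y u] with x hx
  rw [hx, smul_smul, mul_comm]

/-- Averages with respect to a square integrable kernel are continuous. -/
theorem exists_continuous_avg (hk : Integrable k) (hk2 : MemLp k 2 volume) (u : L2V) :
    ∃ f : E3 → E3, Continuous f ∧ avg k u =ᵐ[volume] f := by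
  refine ⟨fun x => pairing k (trans x u), (pairing k).continuous.comp (continuous_trans u), ?_⟩
  filter_upwards [coeFn_avg hk u] with x hx
  rw [hx, pairing_apply hk2]
  refine integral_congr_ae ?_
  filter_upwards [coeFn_trans x u] with y hy
  rw [hy, add_comm]

end Avg

/-! ### Radial kernels -/

/-- The radial field `q(|x|) / (4π|x|)`. -/
def shell {F : Type*} [NormedAddCommGroup F] [NormedSpace ℝ F] (q : ℝ → F) (x : E3) : F :=
  (4 * Real.pi * ‖x‖)⁻¹ • q ‖x‖

section Shell

variable {F : Type*} [NormedAddCommGroup F] [NormedSpace ℝ F] {q : ℝ → F}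

theorem measurable_shell [MeasurableSpace F] [BorelSpace F] [SecondCountableTopology F]
    (hq : Measurable q) : Measurable (shell q) := by
  unfold shell; fun_prop

theorem integrable_shell (hq : IntegrableOn (fun r => r • q r) (Ioi 0)) : Integrable (shell q) := by
  have := (integrable_fun_norm_addHaar (volume : Measure E3)
    (f := fun r : ℝ => (4 * Real.pi * r)⁻¹ • q r)).2 (by
      refine IntegrableOn.congr_fun (hq.smul (4 * Real.pi)⁻¹) ?_ measurableSet_Ioi
      intro r (hr : 0 < r)
      simp only [finrank_euclideanSpace, Fintype.card_fin, smul_smul, Pi.smul_apply]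
      congr 1
      field_simp)
  exact this

theorem integral_shell : ∫ x, shell q x = ∫ r in Ioi (0 : ℝ), r • q r := by
  have h := integral_fun_norm_addHaar (volume : Measure E3)
    (fun r : ℝ => (4 * Real.pi * r)⁻¹ • q r)
  rw [show (fun x => shell q x) = fun x : E3 => (4 * Real.pi * ‖x‖)⁻¹ • q ‖x‖ from rfl, h,
    ← Nat.cast_smul_eq_nsmul ℝ, smul_smul]
  have hs := surf_real_univ
  rw [Measure.toSphere_real_apply_univ] at hs
  rw [hs, ← integral_smul]
  refine setIntegral_congr_fun measurableSet_Ioi fun r (hr : 0 < r) => ?_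
  simp only [finrank_euclideanSpace, Fintype.card_fin, smul_smul]
  congr 1
  field_simp

theorem memLp_shell [MeasurableSpace F] [BorelSpace F] [SecondCountableTopology F]
    (hm : Measurable q) (hq : IntegrableOn (fun r => ‖q r‖ ^ 2) (Ioi 0)) :
    MemLp (shell q) 2 (volume : Measure E3) := by
  have h := (measurable_shell hm).aestronglyMeasurable (μ := (volume : Measure E3))
  rw [← memLp_norm_iff h, memLp_two_iff_integrable_sq h.norm]
  have := (integrable_fun_norm_addHaar (volume : Measure E3)
    (f := fun r : ℝ => ‖(4 * Real.pi * r)⁻¹ • q r‖ ^ 2)).2 (by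
      refine IntegrableOn.congr_fun (hq.mul_const ((4 * Real.pi) ^ 2)⁻¹) ?_ measurableSet_Ioi
      intro r (hr : 0 < r)
      simp only [finrank_euclideanSpace, Fintype.card_fin, norm_smul, smul_eq_mul, norm_inv,
        Real.norm_eq_abs, mul_pow, inv_pow, sq_abs]
      field_simp)
  exact this

theorem integral_shell_smul {q : ℝ → ℝ} {f : E3 → F} (h : Integrable fun x => shell q x • f x) :
    ∫ x, shell q x • f x = ∫ r in Ioi (0 : ℝ), q r • radMean f r := by
  have e := integral_radial_smul_eq_radMean (w := fun r => (4 * Real.pi * r)⁻¹ * q r) (f := f) h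
  refine Eq.trans e ?_
  refine setIntegral_congr_fun measurableSet_Ioi fun r (hr : 0 < r) => ?_
  congr 1
  field_simp

theorem integral_inner_shell {q : ℝ → E3} {f : E3 → E3} (hf : Continuous f)
    (h : Integrable fun x => ⟪f x, shell q x⟫) :
    ∫ x, ⟪f x, shell q x⟫ = ∫ r in Ioi (0 : ℝ), ⟪radMean f r, q r⟫ := by
  rw [integral_polar h, integral_radMeasure]
  refine setIntegral_congr_fun measurableSet_Ioi fun r (hr : 0 < r) => ?_
  have h1 : ∀ z : S2, ‖r • (z : E3)‖ = r := fun z => by simp [norm_smul, abs_of_pos hr]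
  have hc : Continuous fun z : S2 => f (r • (z : E3)) := by fun_prop
  have hi : Integrable (fun z : S2 => f (r • (z : E3))) surf :=
    hc.integrable_of_hasCompactSupport (HasCompactSupport.of_compactSpace _)
  simp only [shell, h1, inner_smul_right, radMean, sphInt, inner_smul_left, smul_eq_mul]
  rw [integral_const_mul, real_inner_comm, ← integral_inner hi]
  simp only [real_inner_comm, conj_trivial]
  field_simp

end Shell

/-- The profile of the kernel that averages the Laplacian. -/
def profN (h r : ℝ) : ℝ := if r < h then 12 / h ^ 2 * (1 - r / h) ^ 2 else 0

/-- The profile of the kernel whose difference to the Dirac measure is the averaged Laplacian. -/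
def profR (h r : ℝ) : ℝ := if r < h then 2 / h ^ 2 else 0

section Kernels

variable {h : ℝ}

theorem integrableOn_ite_lt {F : Type*} [NormedAddCommGroup F] {f : ℝ → F} (hf : Continuous f) :
    IntegrableOn (fun r => if r < h then f r else 0) (Ioi 0) := by
  have : (fun r => if r < h then f r else 0) = (Iio h).indicator f := by
    ext r; simp [indicator]
  rw [this, integrableOn_indicator_iff measurableSet_Iio]
  exact (hf.integrableOn_Icc (a := 0) (b := h)).mono_set fun r hr => ⟨(mem_Ioi.1 hr.2).le, (mem_Iio.1 hr.1).le⟩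

theorem setIntegral_ite_lt {F : Type*} [NormedAddCommGroup F] [NormedSpace ℝ F] {f : ℝ → F}
    (hh : 0 ≤ h) :
    ∫ r in Ioi (0 : ℝ), (if r < h then f r else 0) = ∫ r in (0 : ℝ)..h, f r := by
  have : (fun r => if r < h then f r else 0) = (Iio h).indicator f := by
    ext r; simp [indicator]
  rw [this, setIntegral_indicator measurableSet_Iio, Ioi_inter_Iio,
    intervalIntegral.integral_of_le hh, integral_Ioc_eq_integral_Ioo]

theorem measurable_profN : Measurable (profN h) := by
  unfold profN
  exact Measurable.ite measurableSet_Iio (by fun_prop) measurable_const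

theorem measurable_profR : Measurable (profR h) := by
  unfold profR
  exact Measurable.ite measurableSet_Iio (by fun_prop) measurable_const

theorem integrable_shell_profN : Integrable (shell (profN h)) := by
  refine integrable_shell ((integrableOn_ite_lt (h := h)
    (f := fun r => r * (12 / h ^ 2 * (1 - r / h) ^ 2)) (by fun_prop)).congr_fun ?_ measurableSet_Ioi)
  intro r _
  simp [profN]

theorem integrable_shell_profR : Integrable (shell (profR h)) := by
  refine integrable_shell ((integrableOn_ite_lt (h := h)
    (f := fun r => r * (2 / h ^ 2)) (by fun_prop)).congr_fun ?_ measurableSet_Ioi)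
  intro r _
  simp [profR]

theorem memLp_shell_profN : MemLp (shell (profN h)) 2 volume := by
  refine memLp_shell measurable_profN ((integrableOn_ite_lt (h := h)
    (f := fun r => (12 / h ^ 2 * (1 - r / h) ^ 2) ^ 2) (by fun_prop)).congr_fun ?_ measurableSet_Ioi)
  intro r _
  by_cases hr : r < h <;> simp [profN, hr]

theorem memLp_shell_profR : MemLp (shell (profR h)) 2 volume := by
  refine memLp_shell measurable_profR ((integrableOn_ite_lt (h := h)
    (f := fun r => (2 / h ^ 2) ^ 2) (by fun_prop)).congr_fun ?_ measurableSet_Ioi)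
  intro r _
  by_cases hr : r < h <;> simp [profR, hr]

theorem integral_shell_profN (hh : 0 < h) : ∫ x, shell (profN h) x = 1 := by
  have e : ∀ r : ℝ, r • profN h r = if r < h then r * (12 / h ^ 2 * (1 - r / h) ^ 2) else 0 :=
    fun r => by simp [profN]
  have hd : ∀ r : ℝ, HasDerivAt (fun r => 12 / h ^ 2 * (r ^ 2 / 2 - 2 * r ^ 3 / (3 * h)
      + r ^ 4 / (4 * h ^ 2))) (r * (12 / h ^ 2 * (1 - r / h) ^ 2)) r := fun r => by
    have h2 := (hasDerivAt_pow 2 r).div_const 2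
    have h3 := ((hasDerivAt_pow 3 r).const_mul 2).div_const (3 * h)
    have h4 := (hasDerivAt_pow 4 r).div_const (4 * h ^ 2)
    refine (((h2.sub h3).add h4).const_mul (12 / h ^ 2)).congr_deriv ?_
    norm_num
    field_simp
    ring
  rw [integral_shell]
  simp only [e]
  rw [setIntegral_ite_lt hh.le, intervalIntegral.integral_eq_sub_of_hasDerivAt (fun r _ => hd r)
    (Continuous.intervalIntegrable (by fun_prop) _ _)]
  field_simp
  ring

theorem integral_shell_profR (hh : 0 < h) : ∫ x, shell (profR h) x = 1 := by
  have e : ∀ r : ℝ, r • profR h r = if r < h then r * (2 / h ^ 2) else 0 :=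
    fun r => by simp [profR]
  rw [integral_shell]
  simp only [e]
  rw [setIntegral_ite_lt hh.le, intervalIntegral.integral_mul_const, integral_id]
  field_simp
  norm_num

theorem shell_profN_nonneg (hh : 0 < h) (y : E3) : 0 ≤ shell (profN h) y := by
  unfold shell profN
  split_ifs
  · positivity
  · simp

theorem shell_profR_nonneg (hh : 0 < h) (y : E3) : 0 ≤ shell (profR h) y := by
  unfold shell profR
  split_ifs
  · positivity
  · simp

theorem shell_neg {F : Type*} [NormedAddCommGroup F] [NormedSpace ℝ F] (q : ℝ → F) (y : E3) :
    shell q (-y) = shell q y := by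
  simp [shell]

theorem shell_profN_eq_zero (y : E3) (hy : h ≤ ‖y‖) : shell (profN h) y = 0 := by
  simp [shell, profN, not_lt.2 hy]

theorem IsTest.integrable_smul {F : Type*} [NormedAddCommGroup F] [NormedSpace ℝ F]
    {ψ : E3 → F} (hψ : IsTest ψ) {k : E3 → ℝ} (hk : Integrable k) :
    Integrable fun x => k x • ψ x := by
  obtain ⟨C, hC⟩ := hψ.1.continuous.bounded_above_of_compact_support hψ.2
  refine (hk.norm.mul_const C).mono' (hk.1.smul hψ.1.continuous.aestronglyMeasurable)
    (Eventually.of_forall fun x => ?_)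
  rw [norm_smul]
  exact mul_le_mul_of_nonneg_left (hC x) (norm_nonneg _)

/-- As distributions, the Laplacian of the kernel of `profN h` is `12 / h²` times the kernel of
`profR h` minus the Dirac measure. By Darboux's equation this is a double integration by parts in
the radius: `profN` vanishes to second order at `h`, its value `12 / h²` at the origin multiplies `ψ
0`, and its second derivative is `(12 / h²) (2 / h²)`. -/
theorem integral_profN_smul_laplacian {F : Type*} [NormedAddCommGroup F] [NormedSpace ℝ F]
    [CompleteSpace F] {ψ : E3 → F} (hψ : IsTest ψ) (hh : 0 < h) :
    ∫ y, shell (profN h) y • Laplacian.laplacian ψ y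
      = (12 / h ^ 2) • ((∫ y, shell (profR h) y • ψ y) - ψ 0) := by
  rw [integral_shell_smul (hψ.laplacian.integrable_smul integrable_shell_profN),
    integral_shell_smul (hψ.integrable_smul integrable_shell_profR)]
  have e1 : ∀ r : ℝ, profN h r • radMean (Laplacian.laplacian ψ) r
      = if r < h then (12 / h ^ 2 * (1 - r / h) ^ 2) • radMean (Laplacian.laplacian ψ) r else 0 :=
    fun r => by by_cases hr : r < h <;> simp [profN, hr]
  have e2 : ∀ r : ℝ, profR h r • radMean ψ r = if r < h then (2 / h ^ 2) • radMean ψ r else 0 :=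
    fun r => by by_cases hr : r < h <;> simp [profR, hr]
  simp only [e1, e2]
  rw [setIntegral_ite_lt hh.le, setIntegral_ite_lt hh.le]
  have c1 := continuous_radMean hψ.1.continuous
  have c2 := continuous_radMeanDeriv hψ.1
  have c3 := continuous_radMean hψ.laplacian.1.continuous
  have key := intervalIntegral.integral_eq_sub_of_hasDerivAt_of_le hh.le
    (f := fun r => (1 - r / h) ^ 2 • radMeanDeriv ψ r + (2 / h * (1 - r / h)) • radMean ψ r)
    (f' := fun r => (1 - r / h) ^ 2 • radMean (Laplacian.laplacian ψ) r
      - (2 / h ^ 2) • radMean ψ r) (by fun_prop) (fun r hr => by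
        have d1 : HasDerivAt (fun r => 1 - r / h) (-(1 / h)) r := by
          simpa using ((hasDerivAt_id r).div_const h).const_sub 1
        have d2 := (d1.fun_pow 2).fun_smul (hasDerivAt_radMeanDeriv hψ hr.1)
        have d3 := (d1.const_mul (2 / h)).fun_smul (hasDerivAt_radMean hψ.1 r)
        refine (d2.fun_add d3).congr_deriv ?_
        simp only [Nat.cast_ofNat, Nat.add_one_sub_one, pow_one]
        match_scalars <;> field_simp <;> ring)
      (Continuous.intervalIntegrable (by fun_prop) _ _)
  simp only [div_self hh.ne', sub_self, zero_div, sub_zero, radMean_zero, radMeanDeriv_zero,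
    smul_zero, mul_zero, zero_smul, one_pow, one_smul, add_zero, zero_sub, ne_eq,
    OfNat.ofNat_ne_zero, not_false_eq_true, zero_pow] at key
  rw [intervalIntegral.integral_sub (Continuous.intervalIntegrable (by fun_prop) _ _)
    (Continuous.intervalIntegrable (by fun_prop) _ _), sub_eq_iff_eq_add] at key
  simp only [mul_smul (12 / h ^ 2)]
  rw [intervalIntegral.integral_smul, key]
  congr 1
  abel

end Kernels

/-! ### The weak Laplacian -/

/-- The field `g` is the distributional Laplacian of `u`. -/
def WeakLap (u g : L2V) : Prop :=
  ∀ ψ : E3 → E3, IsTest ψ → ⟪toL2 (Laplacian.laplacian ψ), u⟫ = ⟪toL2 ψ, g⟫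

theorem avg_laplacian {ψ : E3 → E3} (hψ : IsTest ψ) {h : ℝ} (hh : 0 < h) :
    avg (shell (profN h)) (toL2 (Laplacian.laplacian ψ))
      = (12 / h ^ 2) • (avg (shell (profR h)) (toL2 ψ) - toL2 ψ) := by
  have key : ∀ {k : E3 → ℝ} {φ : E3 → E3} (_ : Integrable k) (_ : IsTest φ),
      avg k (toL2 φ) =ᵐ[volume] fun x => ∫ y, k y • φ (x + y) := fun hk hφ => by
    filter_upwards [coeFn_avg hk (toL2 _)] with x hx
    rw [hx]
    refine integral_congr_ae ?_
    filter_upwards [(measurePreserving_add_left volume x).quasiMeasurePreserving.ae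
      (coeFn_toL2 (hφ.memLp 2))] with y hy
    rw [hy]
  refine Lp.ext ?_
  filter_upwards [key (integrable_shell_profN (h := h)) hψ.laplacian,
    key (integrable_shell_profR (h := h)) hψ, coeFn_toL2 (hψ.memLp 2),
    Lp.coeFn_smul (12 / h ^ 2) (avg (shell (profR h)) (toL2 ψ) - toL2 ψ),
    Lp.coeFn_sub (avg (shell (profR h)) (toL2 ψ)) (toL2 ψ)] with x h1 h2 h3 h4 h5
  rw [h1, h4, Pi.smul_apply, h5, Pi.sub_apply, h2, h3]
  have := integral_profN_smul_laplacian (hψ.comp_add_right x) hh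
  simp only [laplacian_comp_add_right hψ] at this
  simp only [add_comm _ x, add_zero] at this
  exact this

/-- The averages are symmetric and commute with the Laplacian, so both can be moved to the test
function, where the identity is classical. -/
theorem WeakLap.avg_eq {u g : L2V} (hu : WeakLap u g) {h : ℝ} (hh : 0 < h) :
    avg (shell (profN h)) g = (12 / h ^ 2) • (avg (shell (profR h)) u - u) := by
  have iN := integrable_shell_profN (h := h)
  have iR := integrable_shell_profR (h := h)
  refine eq_of_forall_inner_test fun ψ hψ => ?_
  have e1 : ⟪toL2 ψ, avg (shell (profN h)) g⟫
      = ⟪avg (shell (profN h)) (toL2 (Laplacian.laplacian ψ)), u⟫ := by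
    rw [← inner_avg_left_eq_right iN (shell_neg _), real_inner_comm, inner_avg_right iN,
      real_inner_comm, inner_avg_right iN]
    refine integral_congr_ae (Eventually.of_forall fun y => ?_)
    simp only
    rw [real_inner_comm, trans_toL2 (hψ.memLp 2), ← hu _ (hψ.comp_add_right y), real_inner_comm,
      trans_toL2 (hψ.laplacian.memLp 2)]
    congr 3
    exact funext fun x => laplacian_comp_add_right hψ y x
  rw [e1, avg_laplacian hψ hh, inner_smul_left, inner_smul_right, inner_sub_left, inner_sub_right,
    inner_avg_left_eq_right iR (shell_neg _)]
  rfl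

theorem tendsto_avg_profN (u : L2V) :
    Tendsto (fun h => avg (shell (profN h)) u) (𝓝[>] 0) (𝓝 u) :=
  tendsto_avg (K := fun h => shell (profN h)) (fun _ _ => integrable_shell_profN)
    (fun _ y hh => shell_profN_nonneg hh y) (fun _ hh => integral_shell_profN hh)
    (fun _ y _ hy => shell_profN_eq_zero y hy) u

/-- The converse: test the identity, move the averages to the test function and let `h` tend to
zero. -/
theorem weakLap_of_avg_eq {u g : L2V}
    (h : ∀ h : ℝ, 0 < h →
      avg (shell (profN h)) g = (12 / h ^ 2) • (avg (shell (profR h)) u - u)) : WeakLap u g := by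
  intro ψ hψ
  have l1 := (tendsto_const_nhds (x := toL2 ψ)).inner (𝕜 := ℝ) (tendsto_avg_profN g)
  have l2 := (tendsto_avg_profN (toL2 (Laplacian.laplacian ψ))).inner (𝕜 := ℝ)
    (tendsto_const_nhds (x := u))
  refine tendsto_nhds_unique (l2.congr' ?_) l1
  filter_upwards [self_mem_nhdsWithin] with ε (hε : 0 < ε)
  rw [h ε hε, avg_laplacian hψ hε, inner_smul_left, inner_smul_right, inner_sub_left,
    inner_sub_right, inner_avg_left_eq_right integrable_shell_profR (shell_neg _)]
  rfl

/-- Before the limit `h → 0` the Laplacian is replaced by the bounded symmetric operator `(12 / h²)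
(R_h - 1)`. -/
theorem WeakLap.symm {u g u' g' : L2V} (hu : WeakLap u g) (hu' : WeakLap u' g') :
    ⟪u, g'⟫ = ⟪g, u'⟫ := by
  have l1 := (tendsto_const_nhds (x := u)).inner (𝕜 := ℝ) (tendsto_avg_profN g')
  have l2 := (tendsto_avg_profN g).inner (𝕜 := ℝ) (tendsto_const_nhds (x := u'))
  refine tendsto_nhds_unique (l1.congr' ?_) l2
  filter_upwards [self_mem_nhdsWithin] with h (hh : 0 < h)
  rw [hu.avg_eq hh, hu'.avg_eq hh, inner_smul_left, inner_smul_right, inner_sub_left,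
    inner_sub_right, inner_avg_left_eq_right integrable_shell_profR (shell_neg _)]
  rfl

/-- The operator `R_h` is a contraction, being an average with respect to a probability density, so
`R_h - 1` is nonpositive. -/
theorem WeakLap.inner_nonpos {u g : L2V} (hu : WeakLap u g) : ⟪g, u⟫ ≤ 0 := by
  have l := (tendsto_avg_profN g).inner (𝕜 := ℝ) (tendsto_const_nhds (x := u))
  refine le_of_tendsto l ?_
  filter_upwards [self_mem_nhdsWithin] with h (hh : 0 < h)
  rw [hu.avg_eq hh, real_inner_smul_left, inner_sub_left, real_inner_self_eq_norm_mul_norm]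
  have h1 := norm_avg_le (integrable_shell_profR (h := h)) (shell_profR_nonneg hh) u
  rw [integral_shell_profR hh, one_mul] at h1
  have h2 := real_inner_le_norm (avg (shell (profR h)) u) u
  have h3 := mul_le_mul_of_nonneg_right h1 (norm_nonneg u)
  exact mul_nonpos_of_nonneg_of_nonpos (by positivity) (by linarith)

theorem WeakLap.map_M {u g : L2V} (hu : WeakLap u g) : WeakLap (M u) (M g) := by
  refine weakLap_of_avg_eq fun h hh => ?_
  rw [← M_avg integrable_shell_profN, ← M_avg integrable_shell_profR, hu.avg_eq hh, map_smul,
    map_sub]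

/-- At `h = 1` the identity writes `u` as a combination of two averages with square integrable
kernels, and those are continuous. This serves as the Sobolev embedding of `H²`. -/
theorem WeakLap.exists_continuous {u g : L2V} (hu : WeakLap u g) :
    ∃ f : E3 → E3, Continuous f ∧ u =ᵐ[volume] f := by
  obtain ⟨f1, c1, h1⟩ := exists_continuous_avg (integrable_shell_profN (h := 1))
    memLp_shell_profN g
  obtain ⟨f2, c2, h2⟩ := exists_continuous_avg (integrable_shell_profR (h := 1))
    memLp_shell_profR u
  have e : u = avg (shell (profR 1)) u - (1 / 12 : ℝ) • avg (shell (profN 1)) g := by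
    rw [hu.avg_eq one_pos, smul_smul]
    norm_num
  refine ⟨fun x => f2 x - (1 / 12 : ℝ) • f1 x, by fun_prop, ?_⟩
  have e' := Lp.coeFn_sub (avg (shell (profR 1)) u) ((1 / 12 : ℝ) • avg (shell (profN 1)) g)
  rw [← e] at e'
  filter_upwards [h1, h2, e', Lp.coeFn_smul (1 / 12 : ℝ) (avg (shell (profN 1)) g)]
    with x x1 x2 x3 x4
  rw [x3, Pi.sub_apply, x4, Pi.smul_apply, x1, x2]

/-! ### Fields in `H²` have a distributional Laplacian. -/

theorem IsWeakDeriv.inner_fderiv {i : Fin 3} {u v : L2V} (h : IsWeakDeriv i u v) {φ : E3 → E3}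
    (hφ : IsTest φ) : ⟪toL2 fun x => fderiv ℝ φ x (stdE i), u⟫ = -⟪toL2 φ, v⟫ := by
  rw [inner_toL2 ((hφ.fderiv_apply _).memLp 2), inner_toL2 (hφ.memLp 2)]
  simpa only [real_inner_comm] using h φ hφ

theorem MemH1.isWeakDeriv {u : L2V} (h : MemH1 u) (i : Fin 3) :
    IsWeakDeriv i u (weakDeriv i u) :=
  Classical.epsilon_spec (h i)

theorem toL2_sum {ι : Type*} (s : Finset ι) {f : ι → E3 → E3}
    (hf : ∀ i ∈ s, MemLp (f i) 2 (volume : Measure E3)) :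
    toL2 (fun x => ∑ i ∈ s, f i x) = ∑ i ∈ s, toL2 (f i) := by
  classical
  induction s using Finset.induction_on with
  | empty =>
    simp only [Finset.sum_empty]
    rw [toL2_eq MemLp.zero']; rfl
  | insert i s hi ih =>
    have h1 := hf i (Finset.mem_insert_self i s)
    have h2 : ∀ j ∈ s, MemLp (f j) 2 (volume : Measure E3) := fun j hj =>
      hf j (Finset.mem_insert_of_mem hj)
    simp only [Finset.sum_insert hi]
    rw [← ih h2, toL2_eq h1, toL2_eq (memLp_finsetSum s h2), ← MemLp.toLp_add, toL2_eq]
    rfl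

theorem MemH2.weakLap {u : L2V} (h : MemH2 u) : WeakLap u (weakLaplacian u) := by
  intro ψ hψ
  have e : Laplacian.laplacian ψ
      = fun x => ∑ i, fderiv ℝ (fun y => fderiv ℝ ψ y (stdE i)) x (stdE i) :=
    funext fun x => laplacian_eq_sum_fderiv hψ.1 x
  rw [e, toL2_sum _ fun i _ => ((hψ.fderiv_apply _).fderiv_apply _).memLp 2, weakLaplacian,
    sum_inner, inner_sum]
  refine Finset.sum_congr rfl fun i _ => ?_
  rw [(h.1.isWeakDeriv i).inner_fderiv (hψ.fderiv_apply _),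
    ((h.2 i).isWeakDeriv i).inner_fderiv hψ, neg_neg]

/-! ### Uniqueness of the free wave -/

section Primitive

variable {F : Type*} [NormedAddCommGroup F] [NormedSpace ℝ F] [CompleteSpace F]

/-- The primitive of `f` that vanishes at `0`. -/
def prim (f : ℝ → F) (t : ℝ) : F := ∫ s in (0 : ℝ)..t, f s

omit [CompleteSpace F] in
theorem prim_zero (f : ℝ → F) : prim f 0 = 0 := by simp [prim]

theorem hasDerivAt_prim {f : ℝ → F} (hf : Continuous f) (t : ℝ) : HasDerivAt (prim f) (f t) t :=
  intervalIntegral.integral_hasDerivAt_right (hf.intervalIntegrable _ _)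
    (hf.stronglyMeasurableAtFilter _ _) hf.continuousAt

theorem continuous_prim {f : ℝ → F} (hf : Continuous f) : Continuous (prim f) :=
  continuous_iff_continuousAt.2 fun t => (hasDerivAt_prim hf t).continuousAt

theorem map_prim {G : Type*} [NormedAddCommGroup G] [NormedSpace ℝ G] [CompleteSpace G]
    (L : F →L[ℝ] G) {f : ℝ → F} (hf : Continuous f) (t : ℝ) :
    L (prim f t) = prim (fun s => L (f s)) t :=
  (L.intervalIntegral_comp_comm (hf.intervalIntegrable _ _)).symm

omit [CompleteSpace F] in
theorem prim_congr {f g : ℝ → F} {T t : ℝ} (ht : t ∈ Icc 0 T) (h : ∀ s ∈ Icc 0 T, f s = g s) :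
    prim f t = prim g t := by
  refine intervalIntegral.integral_congr fun s hs => ?_
  rw [uIcc_of_le ht.1] at hs
  exact h s ⟨hs.1, hs.2.trans ht.2⟩

theorem eq_add_prim_of_hasDerivWithinAt {f f' : ℝ → F} {T t : ℝ} (ht : t ∈ Icc 0 T)
    (hc : ContinuousOn f' (Icc 0 T))
    (h : ∀ s ∈ Icc 0 T, HasDerivWithinAt f (f' s) (Icc 0 T) s) : f t = f 0 + prim f' t := by
  have hsub : Icc 0 t ⊆ Icc 0 T := Icc_subset_Icc_right ht.2
  have := intervalIntegral.integral_eq_sub_of_hasDerivAt_of_le ht.1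
    (fun s hs => ((h s (hsub hs)).continuousWithinAt.mono hsub))
    (fun s hs => (h s (hsub (Ioo_subset_Icc_self hs))).hasDerivAt
      (Icc_mem_nhds hs.1 (hs.2.trans_le ht.2)))
    ((hc.mono hsub).intervalIntegrable_of_Icc ht.1)
  rw [prim, this]
  abel

/-- The constant extension of a curve on `[0,T]` to the whole line. -/
def extendIcc {X : Type*} {T : ℝ} (hT : 0 < T) (f : ℝ → X) (t : ℝ) : X := f (projIcc 0 T hT.le t)

theorem continuous_extendIcc {X : Type*} [TopologicalSpace X] {T : ℝ} (hT : 0 < T) {f : ℝ → X}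
    (hf : ContinuousOn f (Icc 0 T)) : Continuous (extendIcc hT f) :=
  hf.comp_continuous (continuous_subtype_val.comp continuous_projIcc) fun t => (projIcc 0 T _ t).2

theorem extendIcc_of_mem {X : Type*} {T : ℝ} (hT : 0 < T) (f : ℝ → X) {t : ℝ}
    (ht : t ∈ Icc 0 T) : extendIcc hT f t = f t := by
  rw [extendIcc, projIcc_of_mem _ ht]

end Primitive

/-- The energy method for the wave equation: a curve `w` such that `w` is the Laplacian of a
positive multiple of its second primitive vanishes. -/
theorem eq_zero_of_weakLap_prim {b T : ℝ} (hb : 0 < b) (hT : 0 < T) {w : ℝ → L2V}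
    (hw : Continuous w) (h : ∀ t ∈ Icc 0 T, WeakLap (b • prim (prim w) t) (w t)) {t : ℝ}
    (ht : t ∈ Icc 0 T) : w t = 0 := by
  set W₁ := prim w with hW₁
  set W₂ := prim W₁ with hW₂
  have d1 : ∀ t, HasDerivAt W₁ (w t) t := hasDerivAt_prim hw
  have d2 : ∀ t, HasDerivAt W₂ (W₁ t) t := hasDerivAt_prim (continuous_prim hw)
  have hsym : ∀ s ∈ Icc 0 T, ∀ t ∈ Icc 0 T, ⟪W₂ s, w t⟫ = ⟪w s, W₂ t⟫ := fun s hs t ht => by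
    have := (h s hs).symm (h t ht)
    rw [inner_smul_left, inner_smul_right] at this
    exact mul_left_cancel₀ hb.ne' this
  -- The curve `w` is only continuous. By `hsym` the cross terms cancel and the increment of `⟪w,
  -- W₂⟫` is `⟪w s + w t, W₂ s - W₂ t⟫`, whose quotient by `s - t` converges because `W₂` is
  -- differentiable.
  have dφ : ∀ t ∈ Icc 0 T,
      HasDerivWithinAt (fun s => ⟪w s, W₂ s⟫) (⟪w t + w t, W₁ t⟫) (Icc 0 T) t := fun t ht => by
    rw [hasDerivWithinAt_iff_tendsto_slope]
    have l1 : Tendsto (slope W₂ t) (𝓝[Icc 0 T \ {t}] t) (𝓝 (W₁ t)) :=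
      hasDerivWithinAt_iff_tendsto_slope.1 (d2 t).hasDerivWithinAt
    have l2 : Tendsto (fun s => w s + w t) (𝓝[Icc 0 T \ {t}] t) (𝓝 (w t + w t)) :=
      ((hw.add continuous_const).tendsto t).mono_left nhdsWithin_le_nhds
    refine (l2.inner l1).congr' ?_
    filter_upwards [self_mem_nhdsWithin] with s hs
    rw [slope_def_module, slope_def_module, inner_smul_right, smul_eq_mul, inner_sub_right,
      inner_add_left, inner_add_left, real_inner_comm (W₂ s) (w t), hsym s hs.1 t ht]
    ring
  have dN : ∀ t ∈ Icc 0 T,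
      HasDerivWithinAt (fun s => ⟪W₁ s, W₁ s⟫ - ⟪w s, W₂ s⟫) 0 (Icc 0 T) t := fun t ht => by
    refine (((d1 t).hasDerivWithinAt.inner ℝ (d1 t).hasDerivWithinAt).sub (dφ t ht)).congr_deriv ?_
    rw [inner_add_left, real_inner_comm (w t) (W₁ t)]
    ring
  -- The conserved energy `‖W₁‖² - ⟪w, W₂⟫` is zero at time zero, and both of its summands are
  -- nonnegative.
  have hW : ∀ t ∈ Icc 0 T, W₁ t = 0 := fun t ht => by
    have hc := constant_of_derivWithin_zero (fun t ht => (dN t ht).differentiableWithinAt)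
      (fun t ht => (dN t (Ico_subset_Icc_self ht)).derivWithin
        (uniqueDiffOn_Icc hT t (Ico_subset_Icc_self ht))) t ht
    simp only [hW₁, hW₂, prim_zero, inner_zero_right, sub_zero, sub_eq_zero] at hc
    have h0 := (h t ht).inner_nonpos
    rw [inner_smul_right] at h0
    have h1 : ⟪w t, W₂ t⟫ ≤ 0 := nonpos_of_mul_nonpos_right h0 hb
    have h2 : ⟪W₁ t, W₁ t⟫ ≤ 0 := hc.trans_le h1
    exact inner_self_eq_zero.1 (le_antisymm h2 real_inner_self_nonneg)
  have e1 : HasDerivWithinAt W₁ 0 (Icc 0 T) t :=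
    (hasDerivWithinAt_const t (Icc 0 T) (0 : L2V)).congr hW (hW t ht)
  exact (uniqueDiffOn_Icc hT t ht).eq_deriv _ (d1 t).hasDerivWithinAt e1

theorem IsFreeWave.unique {c T : ℝ} (hc : 0 < c) (hT : 0 < T) {u₀ u₁ : L2V} {u v : ℝ → L2V}
    (hu : IsFreeWave c T u₀ u₁ u) (hv : IsFreeWave c T u₀ u₁ v) {t : ℝ} (ht : t ∈ Icc 0 T) :
    u t = v t := by
  have h0 : (0 : ℝ) ∈ Icc 0 T := ⟨le_rfl, hT.le⟩
  set w := extendIcc hT fun t => u t - v t with hwdef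
  have hw : Continuous w := continuous_extendIcc hT (hu.cont.sub hv.cont)
  have hwt : ∀ t ∈ Icc 0 T, w t = u t - v t := fun t ht => extendIcc_of_mem hT _ ht
  have hw0 : w 0 = 0 := by rw [hwt 0 h0, hu.init, hv.init, sub_self]
  suffices w t = 0 from sub_eq_zero.1 ((hwt t ht).symm.trans this)
  -- The difference has zero initial data, so two integrations in time of the weak equation leave no
  -- boundary terms.
  refine eq_zero_of_weakLap_prim (b := c ^ 2) (by positivity) hT hw (fun t ht ψ hψ => ?_) ht
  obtain ⟨h, h1, h2⟩ := hu.wave ψ hψ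
  obtain ⟨k, k1, k2⟩ := hv.wave ψ hψ
  have i1 : ∀ x, ∫ y, ⟪ψ y, x y⟫ = ⟪toL2 ψ, x⟫ := fun x : L2V => (inner_toL2 (hψ.memLp 2) x).symm
  have i2 : ∀ x, ∫ y, ⟪Laplacian.laplacian ψ y, x y⟫ = ⟪toL2 (Laplacian.laplacian ψ), x⟫ :=
    fun x : L2V => (inner_toL2 (hψ.laplacian.memLp 2) x).symm
  simp only [i1, i2] at h1 h2 k1 k2
  have a1 : ∀ t ∈ Icc 0 T, HasDerivWithinAt (fun s => ⟪toL2 ψ, w s⟫) (h t - k t) (Icc 0 T) t :=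
    fun t ht => ((h2 t ht).1.sub (k2 t ht).1).congr
      (fun s hs => by rw [hwt s hs, inner_sub_right]; rfl) (by rw [hwt t ht, inner_sub_right]; rfl)
  have a2 : ∀ t ∈ Icc 0 T, HasDerivWithinAt (fun s => h s - k s)
      (c ^ 2 * ⟪toL2 (Laplacian.laplacian ψ), w t⟫) (Icc 0 T) t :=
    fun t ht => ((h2 t ht).2.sub (k2 t ht).2).congr_deriv (by
      rw [hwt t ht, inner_sub_right, mul_sub])
  have c2 : Continuous fun t => c ^ 2 * ⟪toL2 (Laplacian.laplacian ψ), w t⟫ := by fun_prop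
  have b2 : ∀ t ∈ Icc 0 T, h t - k t = c ^ 2 * ⟪toL2 (Laplacian.laplacian ψ), prim w t⟫ :=
    fun t ht => by
      rw [eq_add_prim_of_hasDerivWithinAt ht c2.continuousOn a2, h1, k1, sub_self, zero_add]
      have := map_prim ((c ^ 2) • innerSL ℝ (toL2 (Laplacian.laplacian ψ))) hw t
      simpa using this.symm
  have c1 : ContinuousOn (fun s => h s - k s) (Icc 0 T) := fun t ht =>
    (a2 t ht).continuousWithinAt
  have b1 := eq_add_prim_of_hasDerivWithinAt ht c1 a1
  simp only [hw0, inner_zero_right, zero_add] at b1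
  rw [b1, prim_congr ht b2, inner_smul_right]
  have := map_prim ((c ^ 2) • innerSL ℝ (toL2 (Laplacian.laplacian ψ))) (continuous_prim hw) t
  simpa using this

/-! ### The retarded potential -/

/-- The class of the retarded potential. -/
def retarded (c : ℝ) (Q : ℝ → E3) (t : ℝ) : L2V := toL2 (retardedPotential c Q t)

/-- The profile of the retarded potential. -/
def profD (c : ℝ) (Q : ℝ → E3) (t r : ℝ) : E3 :=
  open Classical in if r ≤ c * t then Q (t - r / c) else 0

theorem retardedPotential_eq_shell (c : ℝ) (Q : ℝ → E3) (t : ℝ) :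
    retardedPotential c Q t = shell (profD c Q t) := by
  ext1 x
  simp only [retardedPotential, shell, profD]
  split_ifs <;> simp

section Retarded

variable {c : ℝ} {Q : ℝ → E3}

theorem measurable_profD (hQ : Continuous Q) (t : ℝ) : Measurable (profD c Q t) := by
  unfold profD
  exact Measurable.ite measurableSet_Iic (by fun_prop) measurable_const

theorem norm_profD_le (hc : 0 < c) {B t t₁ r : ℝ} (hB : ∀ s ∈ Icc 0 t₁, ‖Q s‖ ≤ B) (hB0 : 0 ≤ B)
    (ht : t ≤ t₁) (hr : 0 < r) : ‖profD c Q t r‖ ≤ (Ioc 0 (c * t₁)).indicator (fun _ => B) r := by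
  unfold profD
  split_ifs with h
  · rw [indicator_of_mem (show r ∈ Ioc 0 (c * t₁) from
      ⟨hr, h.trans (mul_le_mul_of_nonneg_left ht hc.le)⟩)]
    refine hB _ ⟨?_, ?_⟩
    · rw [sub_nonneg, div_le_iff₀ hc]; linarith
    · have := div_nonneg hr.le hc.le; linarith
  · rw [norm_zero]
    exact indicator_nonneg (fun _ _ => hB0) r

theorem exists_bound_Icc (hQ : Continuous Q) (t : ℝ) :
    ∃ B, 0 ≤ B ∧ ∀ s ∈ Icc 0 t, ‖Q s‖ ≤ B := by
  obtain ⟨B, hB⟩ := isCompact_Icc.exists_bound_of_continuousOn (s := Icc 0 t) hQ.continuousOn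
  exact ⟨max B 0, le_max_right _ _, fun s hs => (hB s hs).trans (le_max_left _ _)⟩

theorem integrableOn_indicator_const (a B : ℝ) :
    IntegrableOn ((Ioc 0 a).indicator fun _ => B) (Ioi (0 : ℝ)) :=
  ((integrable_indicator_iff measurableSet_Ioc).2
    (integrableOn_const (by simp))).integrableOn

theorem integrableOn_norm_profD_sq (hc : 0 < c) (hQ : Continuous Q) (t : ℝ) :
    IntegrableOn (fun r => ‖profD c Q t r‖ ^ 2) (Ioi 0) := by
  obtain ⟨B, hB0, hB⟩ := exists_bound_Icc hQ t
  refine Integrable.mono' (integrableOn_indicator_const (c * t) (B ^ 2))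
    ((measurable_profD hQ t).norm.pow_const 2).aestronglyMeasurable ?_
  refine (ae_restrict_iff' measurableSet_Ioi).2 (Eventually.of_forall fun r hr => ?_)
  have h := norm_profD_le hc hB hB0 le_rfl hr
  rw [Real.norm_of_nonneg (by positivity)]
  refine (pow_le_pow_left₀ (norm_nonneg _) h 2).trans (le_of_eq ?_)
  by_cases hm : r ∈ Ioc 0 (c * t) <;> simp [hm]

theorem memLp_retardedPotential (hc : 0 < c) (hQ : Continuous Q) (t : ℝ) :
    MemLp (retardedPotential c Q t) 2 (volume : Measure E3) := by
  rw [retardedPotential_eq_shell]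
  exact memLp_shell (measurable_profD hQ t) (integrableOn_norm_profD_sq hc hQ t)

/-- The factor `(4πr)⁻²` cancels the Jacobian `r²`, so continuity in `L²` becomes a question about
profiles on the half-line. -/
theorem norm_toL2_shell_sq {q : ℝ → E3} (hm : MemLp (shell q) 2 (volume : Measure E3)) :
    ‖toL2 (shell q)‖ ^ 2 = (4 * Real.pi)⁻¹ * ∫ r in Ioi (0 : ℝ), ‖q r‖ ^ 2 := by
  rw [← real_inner_self_eq_norm_sq, inner_toL2 hm]
  have e : ∫ x, ⟪shell q x, toL2 (shell q) x⟫ = ∫ x, shell (fun r => (4 * Real.pi * r)⁻¹ * ‖q r‖ ^ 2) x := by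
    refine integral_congr_ae ?_
    filter_upwards [coeFn_toL2 hm] with x hx
    rw [hx, real_inner_self_eq_norm_sq, shell, norm_smul, mul_pow, Real.norm_eq_abs, sq_abs, shell,
      smul_eq_mul]
    ring
  rw [e, integral_shell, ← integral_const_mul]
  refine setIntegral_congr_fun measurableSet_Ioi fun r (hr : 0 < r) => ?_
  simp only [smul_eq_mul]
  field_simp

theorem toL2_sub {f g : E3 → E3} (hf : MemLp f 2 (volume : Measure E3))
    (hg : MemLp g 2 (volume : Measure E3)) : toL2 f - toL2 g = toL2 fun x => f x - g x := by
  rw [toL2_eq hf, toL2_eq hg, ← MemLp.toLp_sub]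
  exact (toL2_eq (hf.sub hg)).symm

theorem shell_sub (q q' : ℝ → E3) (x : E3) :
    shell q x - shell q' x = shell (fun r => q r - q' r) x := by
  simp only [shell, smul_sub]

theorem continuous_retarded (hc : 0 < c) (hQ : Continuous Q) : Continuous (retarded c Q) := by
  refine continuous_iff_continuousAt.2 fun t => ?_
  have hm : ∀ s, MemLp (shell (profD c Q s)) 2 (volume : Measure E3) := fun s =>
    retardedPotential_eq_shell c Q s ▸ memLp_retardedPotential hc hQ s
  have hd : ∀ s, ‖retarded c Q s - retarded c Q t‖ ^ 2
      = (4 * Real.pi)⁻¹ * ∫ r in Ioi (0 : ℝ), ‖profD c Q s r - profD c Q t r‖ ^ 2 := fun s => by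
    have hm' := (hm s).sub (hm t)
    have e : (shell (profD c Q s) - shell (profD c Q t))
        = shell (fun r => profD c Q s r - profD c Q t r) := funext fun x => shell_sub _ _ x
    rw [e] at hm'
    rw [retarded, retarded, retardedPotential_eq_shell, retardedPotential_eq_shell,
      toL2_sub (hm s) (hm t), ← norm_toL2_shell_sq hm']
    simp only [shell_sub]
  obtain ⟨B, hB0, hB⟩ := exists_bound_Icc hQ (t + 1)
  have key : Tendsto (fun s => ∫ r in Ioi (0 : ℝ), ‖profD c Q s r - profD c Q t r‖ ^ 2) (𝓝 t)
      (𝓝 (∫ _ in Ioi (0 : ℝ), (0 : ℝ))) := by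
    refine tendsto_integral_filter_of_dominated_convergence
      ((Ioc 0 (c * (t + 1))).indicator fun _ => (2 * B) ^ 2) ?_ ?_
      (integrableOn_indicator_const _ _) ?_
    · exact Eventually.of_forall fun s =>
        (((measurable_profD hQ s).sub (measurable_profD hQ t)).norm.pow_const 2).aestronglyMeasurable
    · filter_upwards [Iio_mem_nhds (lt_add_one t)] with s (hs : s < t + 1)
      refine (ae_restrict_iff' measurableSet_Ioi).2 (Eventually.of_forall fun r hr => ?_)
      have h1 := norm_profD_le hc hB hB0 hs.le hr
      have h2 := norm_profD_le hc hB hB0 (lt_add_one t).le hr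
      rw [Real.norm_of_nonneg (by positivity)]
      refine (pow_le_pow_left₀ (norm_nonneg _) ((norm_sub_le _ _).trans (add_le_add h1 h2)) 2).trans
        (le_of_eq ?_)
      by_cases hm : r ∈ Ioc 0 (c * (t + 1)) <;> simp [hm, two_mul]
    -- The profile is continuous in time except when the wave front passes, which at time `t`
    -- concerns the single radius `r = c t`.
    · have hne : ∀ᵐ r : ℝ ∂volume.restrict (Ioi 0), r ≠ c * t :=
        ae_restrict_of_ae (Measure.ae_ne volume _)
      filter_upwards [hne] with r hr
      have hcont : ContinuousAt (fun s => profD c Q s r) t := by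
        rcases lt_or_gt_of_ne hr with h | h
        · have : (fun s => profD c Q s r) =ᶠ[𝓝 t] fun s => Q (s - r / c) := by
            have hl : ∀ᶠ s in 𝓝 t, r < c * s :=
              (continuous_const.mul continuous_id).continuousAt.eventually (lt_mem_nhds h)
            filter_upwards [hl] with s hs
            simp [profD, hs.le]
          exact (by fun_prop : ContinuousAt (fun s => Q (s - r / c)) t).congr this.symm
        · have : (fun s => profD c Q s r) =ᶠ[𝓝 t] fun _ => 0 := by
            have hl : ∀ᶠ s in 𝓝 t, c * s < r :=
              (continuous_const.mul continuous_id).continuousAt.eventually (gt_mem_nhds h)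
            filter_upwards [hl] with s hs
            simp [profD, not_le.2 hs]
          exact continuousAt_const.congr this.symm
      have := ((hcont.tendsto.sub_const (profD c Q t r)).norm).pow 2
      simpa using this
  rw [integral_zero] at key
  rw [ContinuousAt, tendsto_iff_norm_sub_tendsto_zero]
  have h2 := (key.const_mul (4 * Real.pi)⁻¹).sqrt
  rw [mul_zero, Real.sqrt_zero] at h2
  refine h2.congr fun s => ?_
  rw [← hd s, Real.sqrt_sq (norm_nonneg _)]

/-- The convolution in time of the source with a function of the radius. -/
def timeConv (c : ℝ) (Q m : ℝ → E3) (t : ℝ) : ℝ := ∫ s in (0 : ℝ)..t, ⟪m (c * (t - s)), Q s⟫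

/-- Polar coordinates followed by the substitution `r = c (t - s)`, where `s` is the retarded time.
-/
theorem inner_toL2_retarded (hc : 0 < c) (hQ : Continuous Q) {ψ : E3 → E3} (hψ : IsTest ψ) {t : ℝ}
    (ht : 0 ≤ t) : ⟪toL2 ψ, retarded c Q t⟫ = c * timeConv c Q (radMean ψ) t := by
  have hm := memLp_retardedPotential hc hQ t
  have hi : Integrable fun x => ⟪ψ x, shell (profD c Q t) x⟫ := by
    rw [← retardedPotential_eq_shell]
    have := integrable_inner_of_memLp hm (toL2 ψ)
    refine this.congr ?_
    filter_upwards [coeFn_toL2 (hψ.memLp 2)] with x hx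
    rw [hx, real_inner_comm]
  have e1 : ⟪toL2 ψ, retarded c Q t⟫ = ∫ x, ⟪ψ x, shell (profD c Q t) x⟫ := by
    rw [inner_toL2 (hψ.memLp 2), retarded, ← retardedPotential_eq_shell]
    refine integral_congr_ae ?_
    filter_upwards [coeFn_toL2 hm] with x hx
    rw [hx]
  have e2 : ∀ r, ⟪radMean ψ r, profD c Q t r⟫
      = (Iic (c * t)).indicator (fun r => ⟪radMean ψ r, Q (t - r / c)⟫) r := fun r => by
    simp only [profD, indicator, mem_Iic]
    split_ifs <;> simp
  rw [e1, integral_inner_shell hψ.1.continuous hi]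
  simp only [e2]
  rw [setIntegral_indicator measurableSet_Iic, Ioi_inter_Iic,
    ← intervalIntegral.integral_of_le (by positivity), timeConv]
  have e3 := intervalIntegral.integral_comp_sub_mul
    (fun r => ⟪radMean ψ r, Q (t - r / c)⟫) hc.ne' (c * t) (a := 0) (b := t)
  simp only [mul_zero, sub_zero, sub_self, smul_eq_mul] at e3
  rw [eq_inv_mul_iff_mul_eq₀ hc.ne'] at e3
  rw [← e3]
  congr 1
  refine intervalIntegral.integral_congr fun s _ => ?_
  rw [mul_sub]
  congr 2
  field_simp
  ring

theorem integral_integral_triangle {f : ℝ → ℝ → ℝ} (hf : Continuous f.uncurry) {t : ℝ}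
    (ht : 0 ≤ t) :
    ∫ τ in (0 : ℝ)..t, ∫ s in (0 : ℝ)..τ, f τ s = ∫ s in (0 : ℝ)..t, ∫ τ in s..t, f τ s := by
  set D : Set (ℝ × ℝ) := {p | p.2 ≤ p.1} with hD
  have hDm : MeasurableSet D := (isClosed_le continuous_snd continuous_fst).measurableSet
  have hint : Integrable (D.indicator f.uncurry)
      ((volume.restrict (Ioc 0 t)).prod (volume.restrict (Ioc 0 t))) := by
    refine Integrable.indicator ?_ hDm
    rw [Measure.prod_restrict]
    exact (hf.continuousOn.integrableOn_compact (isCompact_Icc.prod isCompact_Icc)).mono_set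
      (prod_mono Ioc_subset_Icc_self Ioc_subset_Icc_self)
  have h := integral_integral_swap (f := fun τ s => D.indicator f.uncurry (τ, s)) hint
  rw [intervalIntegral.integral_of_le ht, intervalIntegral.integral_of_le ht]
  refine Eq.trans ?_ (h.trans ?_)
  · refine setIntegral_congr_fun measurableSet_Ioc fun τ hτ => ?_
    have e : ∀ s, D.indicator f.uncurry (τ, s) = (Iic τ).indicator (fun s => f τ s) s := fun s => by
      simp [indicator, hD]
    simp only [e]
    rw [setIntegral_indicator measurableSet_Iic, intervalIntegral.integral_of_le hτ.1.le,
      Ioc_inter_Iic, min_eq_right hτ.2]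
  · refine setIntegral_congr_fun measurableSet_Ioc fun s hs => ?_
    have e : ∀ τ, D.indicator f.uncurry (τ, s) = (Ici s).indicator (fun τ => f τ s) τ := fun τ => by
      simp [indicator, hD]
    simp only [e]
    rw [setIntegral_indicator measurableSet_Ici, intervalIntegral.integral_of_le hs.2,
      ← integral_Icc_eq_integral_Ioc]
    congr 2
    ext τ
    simp only [mem_inter_iff, mem_Ioc, mem_Ici, mem_Icc]
    exact ⟨fun h => ⟨h.2, h.1.2⟩, fun h => ⟨⟨hs.1.trans_le h.1, h.2⟩, h.1⟩⟩

/-- The time derivative of the convolution is `⟪m 0, Q t⟫ + c * timeConv c Q dm t`. The integrated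
form follows from Fubini on the triangle `s ≤ τ` and needs the derivative of `m` at positive radii
only, as in Darboux's equation. -/
theorem timeConv_eq_prim (hQ : Continuous Q) (hc : 0 < c) {m dm : ℝ → E3} (hm : Continuous m)
    (hdm : Continuous dm) (hd : ∀ r, 0 < r → HasDerivAt m (dm r) r) {t : ℝ} (ht : 0 ≤ t) :
    timeConv c Q m t = prim (fun τ => ⟪m 0, Q τ⟫ + c * timeConv c Q dm τ) t := by
  have hcont : Continuous (Function.uncurry fun τ s : ℝ => ⟪dm (c * (τ - s)), Q s⟫) := by
    simp only [Function.uncurry_def]; fun_prop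
  have hcF : Continuous (timeConv c Q dm) :=
    intervalIntegral.continuous_parametric_intervalIntegral_of_continuous hcont continuous_id
  have e1 : prim (timeConv c Q dm) t
      = ∫ s in (0 : ℝ)..t, c⁻¹ * (⟪m (c * (t - s)), Q s⟫ - ⟪m 0, Q s⟫) := by
    refine (integral_integral_triangle hcont ht).trans ?_
    refine intervalIntegral.integral_congr fun s hs => ?_
    rw [uIcc_of_le ht] at hs
    have := intervalIntegral.integral_eq_sub_of_hasDerivAt_of_le hs.2
      (f := fun τ => c⁻¹ * ⟪m (c * (τ - s)), Q s⟫) (f' := fun τ => ⟪dm (c * (τ - s)), Q s⟫)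
      (by fun_prop) (fun τ hτ => by
        have h1 : HasDerivAt (fun τ => c * (τ - s)) c τ := by
          simpa using ((hasDerivAt_id τ).sub_const s).const_mul c
        have h2 := (hd (c * (τ - s)) (mul_pos hc (sub_pos.2 hτ.1))).scomp τ h1
        have h3 := ((h2.inner ℝ (hasDerivAt_const τ (Q s))).const_mul c⁻¹)
        refine h3.congr_deriv ?_
        simp only [inner_zero_right, zero_add, inner_smul_left, conj_trivial]
        field_simp) (Continuous.intervalIntegrable (by fun_prop) _ _)
    rw [this, sub_self, mul_zero]
    ring
  have e2 : prim (fun τ => ⟪m 0, Q τ⟫ + c * timeConv c Q dm τ) t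
      = (∫ τ in (0 : ℝ)..t, ⟪m 0, Q τ⟫) + c * prim (timeConv c Q dm) t := by
    rw [prim, intervalIntegral.integral_add (Continuous.intervalIntegrable (by fun_prop) _ _)
      ((hcF.const_mul c).intervalIntegrable _ _), intervalIntegral.integral_const_mul]
    rfl
  rw [e2, e1, intervalIntegral.integral_const_mul, mul_inv_cancel_left₀ hc.ne',
    intervalIntegral.integral_sub (Continuous.intervalIntegrable (by fun_prop) _ _)
      (Continuous.intervalIntegrable (by fun_prop) _ _)]
  rw [timeConv]
  ring

theorem toL2_add {f g : E3 → E3} (hf : MemLp f 2 (volume : Measure E3))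
    (hg : MemLp g 2 (volume : Measure E3)) : toL2 f + toL2 g = toL2 fun x => f x + g x := by
  rw [toL2_eq hf, toL2_eq hg, ← MemLp.toLp_add]
  exact (toL2_eq (hf.add hg)).symm

theorem toL2_smul {f : E3 → E3} (hf : MemLp f 2 (volume : Measure E3)) (a : ℝ) :
    a • toL2 f = toL2 fun x => a • f x := by
  rw [toL2_eq hf, ← MemLp.toLp_const_smul]
  exact (toL2_eq (hf.const_smul a)).symm

/-- The field `Q G_λ` as a function of `Q`. -/
def yukawaField {lam : ℝ} (hlam : 0 < lam) : E3 →L[ℝ] L2V :=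
  LinearMap.toContinuousLinearMap
    { toFun := fun Q => toL2 fun x => yukawa lam x • Q
      map_add' := fun P Q => by
        rw [toL2_add (memLp_yukawa_smul hlam P) (memLp_yukawa_smul hlam Q)]
        simp only [smul_add]
      map_smul' := fun a Q => by
        rw [RingHom.id_apply, toL2_smul (memLp_yukawa_smul hlam Q)]
        simp only [smul_comm a] }

theorem yukawaField_apply {lam : ℝ} (hlam : 0 < lam) (Q : E3) :
    yukawaField hlam Q = toL2 fun x => yukawa lam x • Q := rfl

theorem yukawa_smul_eq_shell (lam : ℝ) (Q : E3) :
    (fun x => yukawa lam x • Q) = shell fun r => Real.exp (-(√lam * r)) • Q := by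
  ext1 x
  rw [yukawa, shell, smul_smul, div_eq_inv_mul]

theorem exists_radMean_eq_zero {ψ : E3 → E3} (hψ : HasCompactSupport ψ) :
    ∃ R, 0 < R ∧ ∀ r, R ≤ r → radMean ψ r = 0 ∧ radMeanDeriv ψ r = 0 := by
  obtain ⟨R, hR⟩ := hψ.isCompact.isBounded.subset_ball 0
  refine ⟨max R 1, by positivity, fun r hr => ?_⟩
  have hr0 : 0 < r := lt_of_lt_of_le (by positivity) hr
  have hn : ∀ z : S2, r • (z : E3) ∉ tsupport ψ := fun z hz => by
    have h1 := hR hz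
    simp only [Metric.mem_ball, dist_zero_right, norm_smul, Real.norm_eq_abs, abs_of_pos hr0,
      norm_eq_of_mem_sphere, mul_one] at h1
    exact absurd ((le_max_left R 1).trans hr) (not_le.2 h1)
  have h1 : sphInt ψ r = 0 := by
    simp [sphInt, fun z : S2 => image_eq_zero_of_notMem_tsupport (hn z)]
  have h2 : sphDeriv ψ r = 0 := by
    have : ∀ z : S2, fderiv ℝ ψ (r • (z : E3)) = 0 := fun z =>
      image_eq_zero_of_notMem_tsupport fun h => hn z (tsupport_fderiv_subset ℝ h)
    simp [sphDeriv, this]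
  simp [radMean, radMeanDeriv, h1, h2]

/-- The resolvent equation of the Yukawa potential. -/
theorem inner_yukawaField {lam : ℝ} (hlam : 0 < lam) (Q : E3) {ψ : E3 → E3} (hψ : IsTest ψ) :
    lam * ⟪toL2 ψ, yukawaField hlam Q⟫ - ⟪toL2 (Laplacian.laplacian ψ), yukawaField hlam Q⟫
      = ⟪ψ 0, Q⟫ := by
  have hm := memLp_yukawa_smul hlam Q
  have key : ∀ {φ : E3 → E3}, IsTest φ → ⟪toL2 φ, yukawaField hlam Q⟫
      = ∫ r in Ioi (0 : ℝ), ⟪radMean φ r, Real.exp (-(√lam * r)) • Q⟫ := fun {φ} hφ => by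
    have e1 : (fun x => ⟪φ x, yukawaField hlam Q x⟫)
        =ᵐ[volume] fun x => ⟪φ x, shell (fun r => Real.exp (-(√lam * r)) • Q) x⟫ := by
      rw [← yukawa_smul_eq_shell]
      filter_upwards [coeFn_toL2 hm] with x hx
      rw [yukawaField_apply, hx]
    rw [inner_toL2 (hφ.memLp 2), integral_congr_ae e1,
      integral_inner_shell hφ.1.continuous ((integrable_inner_of_memLp (hφ.memLp 2) _).congr e1)]
  have ci : ∀ {φ : E3 → E3}, IsTest φ → IntegrableOn
      (fun r => ⟪radMean φ r, Real.exp (-(√lam * r)) • Q⟫) (Ioi 0) := fun {φ} hφ => by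
    obtain ⟨R, hR, hz⟩ := exists_radMean_eq_zero hφ.2
    have hc : Continuous fun r => ⟪radMean φ r, Real.exp (-(√lam * r)) • Q⟫ := by
      have := continuous_radMean hφ.1.continuous
      fun_prop
    have := (hc.integrableOn_Icc (a := 0) (b := R) (μ := volume))
    refine this.of_forall_sdiff_eq_zero measurableSet_Ioi fun r hr => ?_
    have : R ≤ r := by
      by_contra h
      exact hr.2 ⟨le_of_lt hr.1, (not_le.1 h).le⟩
    rw [(hz r this).1, inner_zero_left]
  rw [key hψ, key hψ.laplacian, ← integral_const_mul,
    ← integral_sub ((ci hψ).const_mul lam) (ci hψ.laplacian)]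
  obtain ⟨R, hR, hz⟩ := exists_radMean_eq_zero hψ.2
  have c1 := continuous_radMean hψ.1.continuous
  have c2 := continuous_radMeanDeriv hψ.1
  -- By Darboux's equation the integrand has the primitive `-e^(-√λ r) ⟪√λ m + m', Q⟫` with `m =
  -- radMean ψ`. It vanishes for large `r`, and at the origin `m = 0` and `m' = ψ 0`.
  have hd := integral_Ioi_of_hasDerivAt_of_tendsto (a := (0 : ℝ)) (m := (0 : ℝ))
    (f := fun r => -(Real.exp (-(√lam * r)) * ⟪√lam • radMean ψ r + radMeanDeriv ψ r, Q⟫))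
    (f' := fun r => lam * ⟪radMean ψ r, Real.exp (-(√lam * r)) • Q⟫
      - ⟪radMean (Laplacian.laplacian ψ) r, Real.exp (-(√lam * r)) • Q⟫)
    (by fun_prop) (fun r (hr : 0 < r) => by
      have h1 : HasDerivAt (fun r => Real.exp (-(√lam * r))) (Real.exp (-(√lam * r)) * -√lam) r := by
        have := ((hasDerivAt_id r).const_mul √lam).neg.exp
        simpa using this
      have h2 := ((hasDerivAt_radMean hψ.1 r).fun_const_smul √lam).fun_add
        (hasDerivAt_radMeanDeriv hψ hr)
      have h3 := h2.inner ℝ (hasDerivAt_const r Q)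
      refine (h1.fun_mul h3).neg.congr_deriv ?_
      simp only [inner_add_left, inner_smul_left, inner_smul_right, inner_zero_right, conj_trivial,
        zero_add]
      have hs : √lam * √lam = lam := Real.mul_self_sqrt hlam.le
      linear_combination (Real.exp (-(√lam * r)) * ⟪radMean ψ r, Q⟫) * hs)
    (((ci hψ).const_mul lam).sub (ci hψ.laplacian))
    (tendsto_const_nhds.congr' (by
      filter_upwards [eventually_ge_atTop R] with r hr
      simp [hz r hr]))
  rw [hd]
  simp [radMean_zero, radMeanDeriv_zero]

/-- The wave equation with source of the retarded potential, in integrated form. -/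
theorem weakLap_retarded (hc : 0 < c) (hQ : Continuous Q) {lam : ℝ} (hlam : 0 < lam) {t : ℝ}
    (ht : 0 ≤ t) :
    WeakLap (c ^ 2 • prim (prim fun s => retarded c Q s - yukawaField hlam (Q s)) t)
      (retarded c Q t - (c ^ 2 * lam) • prim (prim fun s => yukawaField hlam (Q s)) t) := by
  intro ψ hψ
  have cR := continuous_retarded hc hQ
  have cY : Continuous fun s => yukawaField hlam (Q s) := by fun_prop
  have pp : ∀ (v : L2V) {f : ℝ → L2V}, Continuous f →
      ⟪v, prim (prim f) t⟫ = prim (prim fun s => ⟪v, f s⟫) t := fun v f hf => by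
    have h1 := map_prim (innerSL ℝ v) (continuous_prim hf) t
    have h2 : ∀ s, innerSL ℝ v (prim f s) = prim (fun s => innerSL ℝ v (f s)) s :=
      map_prim (innerSL ℝ v) hf
    simp only [h2] at h1
    exact h1
  have ps : ∀ {f g : ℝ → ℝ}, Continuous f → Continuous g → ∀ a b : ℝ,
      prim (fun s => a * f s + b * g s) = fun t => a * prim f t + b * prim g t :=
    fun {f g} hf hg a b => funext fun t => by
      rw [prim, intervalIntegral.integral_add ((hf.const_mul a).intervalIntegrable _ _)
        ((hg.const_mul b).intervalIntegrable _ _), intervalIntegral.integral_const_mul,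
        intervalIntegral.integral_const_mul]
      rfl
  -- The wave equation with the source `Q δ₀`, integrated twice: `timeConv_eq_prim` is used for
  -- `radMean ψ`, which vanishes at zero, and then for `radMeanDeriv ψ`, whose value `ψ 0` at zero
  -- is the source.
  have key : ⟪toL2 ψ, retarded c Q t⟫ = prim (prim fun s => c ^ 2 *
      (⟪ψ 0, Q s⟫ + ⟪toL2 (Laplacian.laplacian ψ), retarded c Q s⟫)) t := by
    have e1 := timeConv_eq_prim hQ hc (continuous_radMean hψ.1.continuous)
      (continuous_radMeanDeriv hψ.1) (fun r _ => hasDerivAt_radMean hψ.1 r) ht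
    rw [inner_toL2_retarded hc hQ hψ ht, e1, prim, ← intervalIntegral.integral_const_mul]
    refine prim_congr ⟨ht, le_rfl⟩ fun s hs => ?_
    have e2 := timeConv_eq_prim hQ hc (continuous_radMeanDeriv hψ.1)
      (continuous_radMean hψ.laplacian.1.continuous) (fun r hr => hasDerivAt_radMeanDeriv hψ hr)
      hs.1
    rw [e2, radMean_zero, inner_zero_left, zero_add, prim, ← mul_assoc,
      ← intervalIntegral.integral_const_mul]
    refine prim_congr ⟨hs.1, le_rfl⟩ fun r hr => ?_
    rw [radMeanDeriv_zero, ← inner_toL2_retarded hc hQ hψ.laplacian hr.1, sq]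
  have c1 : ∀ v : L2V, Continuous fun s => ⟪v, retarded c Q s⟫ := fun v => by fun_prop
  have c2 : ∀ v : L2V, Continuous fun s => ⟪v, yukawaField hlam (Q s)⟫ := fun v => by fun_prop
  rw [inner_smul_right, inner_sub_right, inner_smul_right, pp _ (cR.fun_sub cY), pp _ cY, key]
  -- The source is now traded for `(λ - Δ) Q G_λ`, so that only pairings with square integrable
  -- fields remain.
  simp only [← inner_yukawaField hlam _ hψ, inner_sub_right]
  set a := fun s => ⟪toL2 ψ, yukawaField hlam (Q s)⟫ with ha
  set b := fun s => ⟪toL2 (Laplacian.laplacian ψ), yukawaField hlam (Q s)⟫ with hb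
  set d := fun s => ⟪toL2 (Laplacian.laplacian ψ), retarded c Q s⟫ with hd
  have ca : Continuous a := c2 _
  have cb : Continuous b := c2 _
  have cd : Continuous d := c1 _
  have r1 : (fun s => d s - b s) = fun s => 1 * d s + (-1) * b s := by ext s; ring
  have r2 : (fun s => c ^ 2 * (lam * a s - b s + d s))
      = fun s => (c ^ 2 * lam) * a s + c ^ 2 * (1 * d s + (-1) * b s) := by ext s; ring
  change c ^ 2 * prim (prim fun s => d s - b s) t
    = prim (prim fun s => c ^ 2 * (lam * a s - b s + d s)) t - c ^ 2 * lam * prim (prim a) t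
  have cdb : Continuous fun s => 1 * d s + (-1) * b s := by fun_prop
  rw [r1, r2, ps ca cdb, ps (continuous_prim ca) (continuous_prim cdb)]
  ring

end Retarded

/-! ### Radial profiles and their ball means -/

/-- Profiles `w` with `w(r) = O(1/r)` at the origin and enough decay at infinity. -/
structure RadialDecay {F : Type*} [NormedAddCommGroup F] [NormedSpace ℝ F] [MeasurableSpace F]
    (w : ℝ → F) : Prop where
  meas : Measurable w
  bound : ∃ C, 0 ≤ C ∧ ∀ r, 0 < r → ‖w r‖ ≤ C / r
  int : IntegrableOn (fun r => r ^ 2 • w r) (Ioi 0)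

/-- A third of the mean of the radial field `w(|x|)` over the ball of radius `r`. -/
def ballMean {F : Type*} [NormedAddCommGroup F] [NormedSpace ℝ F] (w : ℝ → F) (r : ℝ) : F :=
  (r ^ 3)⁻¹ • ∫ s in (0 : ℝ)..r, s ^ 2 • w s

section RadialDecay

variable {F : Type*} [NormedAddCommGroup F] [NormedSpace ℝ F] [MeasurableSpace F] [BorelSpace F]
  [SecondCountableTopology F] {w : ℝ → F}

theorem integrable_norm_of_integrableOn {f : ℝ → ℝ} (hm : Measurable f)
    (h : IntegrableOn (fun r => r ^ 2 * f r ^ 2) (Ioi 0)) :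
    MemLp (fun x : E3 => f ‖x‖) 2 volume := by
  have hm' : AEStronglyMeasurable (fun x : E3 => f ‖x‖) volume :=
    (hm.comp measurable_norm).aestronglyMeasurable
  rw [memLp_two_iff_integrable_sq hm']
  exact (integrable_fun_norm_addHaar (volume : Measure E3) (f := fun r : ℝ => f r ^ 2)).2
    (by simpa using h)

omit [SecondCountableTopology F] in
theorem RadialDecay.memLp_norm (h : RadialDecay w) :
    MemLp (fun x : E3 => ‖w ‖x‖‖) 2 volume := by
  obtain ⟨C, hC0, hC⟩ := h.bound
  refine integrable_norm_of_integrableOn h.meas.norm ?_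
  refine Integrable.mono' (g := fun r => (Ioc 0 1).indicator (fun _ => C ^ 2) r
      + C * ‖r ^ 2 • w r‖) ?_ ?_ ?_
  · exact (integrableOn_indicator_const 1 (C ^ 2)).add (h.int.norm.const_mul C)
  · have := h.meas.norm
    exact (by fun_prop : Measurable fun r => r ^ 2 * ‖w r‖ ^ 2).aestronglyMeasurable
  · refine (ae_restrict_iff' measurableSet_Ioi).2 (Eventually.of_forall fun r (hr : 0 < r) => ?_)
    have h1 : r * ‖w r‖ ≤ C := by
      have := hC r hr
      rw [le_div_iff₀ hr] at this
      linarith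
    have h2 : 0 ≤ r * ‖w r‖ := by positivity
    have e1 : r ^ 2 * ‖w r‖ ^ 2 = (r * ‖w r‖) ^ 2 := by ring
    rw [Real.norm_of_nonneg (by positivity), norm_smul, Real.norm_of_nonneg (by positivity), e1]
    rcases le_or_gt r 1 with hr1 | hr1
    · rw [indicator_of_mem (show r ∈ Ioc (0 : ℝ) 1 from ⟨hr, hr1⟩)]
      have : 0 ≤ C * (r ^ 2 * ‖w r‖) := by positivity
      nlinarith
    · rw [indicator_of_notMem (fun h : r ∈ Ioc (0 : ℝ) 1 => absurd h.2 (not_le.2 hr1)), zero_add]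
      have h3 : r * ‖w r‖ ≤ r ^ 2 * ‖w r‖ := by
        refine mul_le_mul_of_nonneg_right ?_ (norm_nonneg _)
        nlinarith
      calc (r * ‖w r‖) ^ 2 = (r * ‖w r‖) * (r * ‖w r‖) := by ring
        _ ≤ C * (r ^ 2 * ‖w r‖) := mul_le_mul h1 h3 h2 hC0

theorem RadialDecay.memLp (h : RadialDecay w) : MemLp (fun x : E3 => w ‖x‖) 2 volume :=
  (memLp_norm_iff (h.meas.comp measurable_norm).aestronglyMeasurable).1 h.memLp_norm

omit [BorelSpace F] [SecondCountableTopology F] in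
theorem RadialDecay.intervalIntegrable (h : RadialDecay w) {r : ℝ} (hr : 0 ≤ r) :
    IntervalIntegrable (fun s => s ^ 2 • w s) volume 0 r :=
  (intervalIntegrable_iff_integrableOn_Ioc_of_le hr).2 (h.int.mono_set Ioc_subset_Ioi_self)

/-- The mean of the norm of a radial field over balls. -/
def ballMeanNorm (w : ℝ → F) (r : ℝ) : ℝ := (r ^ 3)⁻¹ * ∫ s in Ioi (0 : ℝ), (Iic r).indicator (fun s => ‖s ^ 2 • w s‖) s

omit [MeasurableSpace F] [BorelSpace F] [SecondCountableTopology F] in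
theorem ballMeanNorm_nonneg {r : ℝ} (hr : 0 ≤ r) : 0 ≤ ballMeanNorm w r :=
  mul_nonneg (by positivity) (integral_nonneg fun s => indicator_nonneg (fun _ _ => norm_nonneg _) s)

theorem measurable_ballMeanNorm (h : Measurable w) : Measurable (ballMeanNorm w) := by
  unfold ballMeanNorm
  have hm : Measurable (fun p : ℝ × ℝ => {q : ℝ × ℝ | q.2 ≤ q.1}.indicator
      (fun q => ‖q.2 ^ 2 • w q.2‖) p) := by
    refine Measurable.indicator ?_ (isClosed_le continuous_snd continuous_fst).measurableSet
    have : Measurable fun p : ℝ × ℝ => w p.2 := h.comp measurable_snd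
    fun_prop
  have := (hm.stronglyMeasurable.integral_prod_right (ν := volume.restrict (Ioi (0 : ℝ)))
    (f := fun r s => {q : ℝ × ℝ | q.2 ≤ q.1}.indicator (fun q => ‖q.2 ^ 2 • w q.2‖) (r, s))).measurable
  exact (by fun_prop : Measurable fun r : ℝ => (r ^ 3)⁻¹).mul this

omit [MeasurableSpace F] [BorelSpace F] [SecondCountableTopology F] in
theorem norm_ballMean_le {r : ℝ} (hr : 0 ≤ r) :
    ‖ballMean w r‖ ≤ ballMeanNorm w r := by
  rw [ballMean, ballMeanNorm, norm_smul, Real.norm_of_nonneg (by positivity),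
    setIntegral_indicator measurableSet_Iic, Ioi_inter_Iic,
    ← intervalIntegral.integral_of_le hr]
  exact mul_le_mul_of_nonneg_left (intervalIntegral.norm_integral_le_integral_norm hr)
    (by positivity)

/-- The ball mean inherits the bound `C / r` near the origin and is at most `D / r³` at infinity,
where `D` is the total radial integral. Together these give `r² b² ≤ 2 (C + D)² / (1 + r²)`. -/
theorem RadialDecay.memLp_ballMeanNorm (h : RadialDecay w) :
    MemLp (fun x : E3 => ballMeanNorm w ‖x‖) 2 volume := by
  obtain ⟨C, hC0, hC⟩ := h.bound
  set D := ∫ s in Ioi (0 : ℝ), ‖s ^ 2 • w s‖ with hD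
  have hD0 : 0 ≤ D := integral_nonneg fun _ => norm_nonneg _
  refine integrable_norm_of_integrableOn (measurable_ballMeanNorm h.meas) ?_
  refine Integrable.mono' (g := fun r => (2 * (C + D) ^ 2) * (1 + r ^ 2)⁻¹)
    (integrable_inv_one_add_sq.const_mul _).integrableOn ?_ ?_
  · have := measurable_ballMeanNorm h.meas
    exact (by fun_prop : Measurable fun r => r ^ 2 * ballMeanNorm w r ^ 2).aestronglyMeasurable
  · refine (ae_restrict_iff' measurableSet_Ioi).2 (Eventually.of_forall fun r (hr : 0 < r) => ?_)
    have i1 : Integrable (fun s => (Iic r).indicator (fun s => ‖s ^ 2 • w s‖) s)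
        (volume.restrict (Ioi 0)) := Integrable.indicator h.int.norm measurableSet_Iic
    have b1 : ballMeanNorm w r ≤ (r ^ 3)⁻¹ * D := by
      refine mul_le_mul_of_nonneg_left (integral_mono i1 h.int.norm fun s => ?_) (by positivity)
      exact indicator_le_self' (fun _ _ => norm_nonneg _) s
    have b2 : ballMeanNorm w r ≤ (r ^ 3)⁻¹ * (C * r * r) := by
      refine mul_le_mul_of_nonneg_left ?_ (by positivity)
      rw [setIntegral_indicator measurableSet_Iic, Ioi_inter_Iic]
      have : ∫ s in Ioc 0 r, ‖s ^ 2 • w s‖ ≤ ∫ s in Ioc 0 r, C * r := by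
        refine setIntegral_mono_on (IntegrableOn.mono_set (f := fun s => ‖s ^ 2 • w s‖) h.int.norm Ioc_subset_Ioi_self)
          (integrableOn_const (by simp)) measurableSet_Ioc fun s hs => ?_
        have h1 := hC s hs.1
        rw [le_div_iff₀ hs.1] at h1
        rw [norm_smul, Real.norm_of_nonneg (by positivity)]
        calc s ^ 2 * ‖w s‖ = (‖w s‖ * s) * s := by ring
          _ ≤ C * r := mul_le_mul h1 hs.2 hs.1.le hC0
      refine this.trans (le_of_eq ?_)
      simp [hr.le, mul_comm]
    have b0 := ballMeanNorm_nonneg (w := w) hr.le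
    rw [Real.norm_of_nonneg (by positivity), ← div_eq_mul_inv, le_div_iff₀ (by positivity)]
    have e : (r ^ 2 * ballMeanNorm w r ^ 2) = (r * ballMeanNorm w r) ^ 2 := by ring
    rw [e]
    rcases le_or_gt r 1 with hr1 | hr1
    · have h1 : r * ballMeanNorm w r ≤ C + D := by
        have : r * ballMeanNorm w r ≤ r * ((r ^ 3)⁻¹ * (C * r * r)) :=
          mul_le_mul_of_nonneg_left b2 hr.le
        have e2 : r * ((r ^ 3)⁻¹ * (C * r * r)) = C := by field_simp
        linarith
      have h2 := pow_le_pow_left₀ (by positivity) h1 2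
      have h3 : 1 + r ^ 2 ≤ 2 := by nlinarith
      calc _ ≤ (C + D) ^ 2 * 2 := mul_le_mul h2 h3 (by positivity) (by positivity)
        _ = _ := by ring
    · have h1 : r ^ 2 * ballMeanNorm w r ≤ (C + D) * r⁻¹ := by
        have : r ^ 2 * ballMeanNorm w r ≤ r ^ 2 * ((r ^ 3)⁻¹ * D) :=
          mul_le_mul_of_nonneg_left b1 (by positivity)
        have e2 : r ^ 2 * ((r ^ 3)⁻¹ * D) = D * r⁻¹ := by field_simp
        have : D * r⁻¹ ≤ (C + D) * r⁻¹ := by gcongr; linarith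
        linarith
      have h2 : r ^ 2 * ballMeanNorm w r ≤ C + D := by
        refine h1.trans ?_
        have : r⁻¹ ≤ 1 := inv_le_one_of_one_le₀ hr1.le
        nlinarith
      have h3 := pow_le_pow_left₀ (by positivity) h2 2
      calc (r * ballMeanNorm w r) ^ 2 * (1 + r ^ 2)
          ≤ (r * ballMeanNorm w r) ^ 2 * (2 * r ^ 2) := by gcongr; nlinarith
        _ = 2 * (r ^ 2 * ballMeanNorm w r) ^ 2 := by ring
        _ ≤ _ := by linarith

theorem RadialDecay.measurable_ballMean [CompleteSpace F] (h : RadialDecay w) :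
    Measurable fun x : E3 => ballMean w ‖x‖ := by
  have hi : Integrable ((Ioi (0 : ℝ)).indicator fun s => s ^ 2 • w s) :=
    (integrable_indicator_iff measurableSet_Ioi).2 h.int
  have hc : Continuous fun r => ∫ s in (0 : ℝ)..r, (Ioi (0 : ℝ)).indicator (fun s => s ^ 2 • w s) s :=
    intervalIntegral.continuous_primitive (fun _ _ => hi.intervalIntegrable) 0
  have he : (fun x : E3 => ballMean w ‖x‖) = fun x => (‖x‖ ^ 3)⁻¹ • ∫ s in (0 : ℝ)..‖x‖,
      (Ioi (0 : ℝ)).indicator (fun s => s ^ 2 • w s) s := by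
    funext x
    rw [ballMean, intervalIntegral.integral_of_le (norm_nonneg x),
      intervalIntegral.integral_of_le (norm_nonneg x)]
    congr 1
    refine setIntegral_congr_fun measurableSet_Ioc fun s hs => ?_
    rw [indicator_of_mem (show s ∈ Ioi (0 : ℝ) from hs.1)]
  rw [he]
  exact (by fun_prop : Measurable fun x : E3 => (‖x‖ ^ 3)⁻¹).smul (hc.comp continuous_norm).measurable

theorem RadialDecay.memLp_ballMean [CompleteSpace F] (h : RadialDecay w) :
    MemLp (fun x : E3 => ballMean w ‖x‖) 2 volume :=
  h.memLp_ballMeanNorm.mono h.measurable_ballMean.aestronglyMeasurable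
    (Eventually.of_forall fun x => (norm_ballMean_le (norm_nonneg x)).trans (le_abs_self _))

end RadialDecay

/-! ### A functional on radial profiles -/

section Functional

variable {u₁ u₂ : E3 → E3}

/-- The density that represents the functional
`w ↦ ∫ w(|x|) u₁(x) dx + ∫ W(|x|) u₂(x) dx`, where `W` is the ball mean of `w`. -/
def radDensity (u₁ u₂ : E3 → E3) (s : ℝ) : E3 :=
  sphInt u₁ s + ∫ x, (Ici s).indicator (fun r : ℝ => (r ^ 3)⁻¹) ‖x‖ • u₂ x

theorem memLp_smul_integrable {f : E3 → ℝ} (hf : MemLp f 2 volume) {u : E3 → E3}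
    (hu : MemLp u 2 volume) : Integrable fun x => f x • u x :=
  memLp_one_iff_integrable.1 (hu.smul hf)

/-- The first term is polar integration. In the second, Fubini exchanges the field point `x` with
the radius `s ≤ ‖x‖` of the ball mean; absolute convergence is the square integrability of
`ballMeanNorm w`. -/
theorem integral_radDensity (h₁ : MemLp u₁ 2 volume) (h₂ : MemLp u₂ 2 volume) {w : ℝ → ℝ}
    (hw : RadialDecay w) :
    IntegrableOn (fun s => (s ^ 2 * w s) • radDensity u₁ u₂ s) (Ioi 0) ∧
    (∫ x, w ‖x‖ • u₁ x) + ∫ x, ballMean w ‖x‖ • u₂ x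
      = ∫ s in Ioi (0 : ℝ), (s ^ 2 * w s) • radDensity u₁ u₂ s := by
  have i1 : Integrable fun x => w ‖x‖ • u₁ x := memLp_smul_integrable hw.memLp h₁
  set D : Set (E3 × ℝ) := {q : E3 × ℝ | q.2 ≤ ‖q.1‖} with hD
  have hDm : MeasurableSet D :=
    (isClosed_le continuous_snd (continuous_norm.comp continuous_fst)).measurableSet
  set Φ : E3 × ℝ → E3 := fun p => (D.indicator (fun q => (‖q.1‖ ^ 3)⁻¹ * (q.2 ^ 2 * w q.2)) p) • u₂ p.1
    with hΦ
  have hΦm : AEStronglyMeasurable Φ ((volume : Measure E3).prod (volume.restrict (Ioi (0 : ℝ)))) := by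
    have hu : AEStronglyMeasurable (fun p : E3 × ℝ => u₂ p.1)
        ((volume : Measure E3).prod (volume.restrict (Ioi (0 : ℝ)))) := h₂.1.comp_fst
    refine AEStronglyMeasurable.smul (𝕜 := ℝ) ?_ hu
    refine (Measurable.indicator ?_ hDm).aestronglyMeasurable
    have : Measurable fun p : E3 × ℝ => w p.2 := hw.meas.comp measurable_snd
    exact ((measurable_fst.norm.pow_const 3).inv).mul ((measurable_snd.pow_const 2).mul this)
  have hΦe : ∀ x s, Φ (x, s) = ((‖x‖ ^ 3)⁻¹ * (Iic ‖x‖).indicator (fun s => s ^ 2 * w s) s) • u₂ x :=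
    fun x s => by
      simp only [hΦ, hD, indicator, mem_Iic, mem_ofPred_eq]
      split_ifs <;> simp
  have hΦe' : ∀ x s, Φ (x, s) = (s ^ 2 * w s) • ((Ici s).indicator (fun r : ℝ => (r ^ 3)⁻¹) ‖x‖ • u₂ x) :=
    fun x s => by
      simp only [hΦ, hD, indicator, mem_Ici, mem_ofPred_eq]
      split_ifs
      · rw [smul_smul, mul_comm]
      · simp
  have hwi : ∀ r : ℝ, Integrable ((Iic r).indicator fun s => s ^ 2 * w s) (volume.restrict (Ioi (0 : ℝ))) :=
    fun r => Integrable.indicator (by have := hw.int; simp only [smul_eq_mul] at this; exact this)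
      measurableSet_Iic
  have hΦi : Integrable Φ ((volume : Measure E3).prod (volume.restrict (Ioi (0 : ℝ)))) := by
    rw [integrable_prod_iff hΦm]
    constructor
    · refine Eventually.of_forall fun x => ?_
      simp only [hΦe]
      exact ((hwi ‖x‖).const_mul _).smul_const _
    · have := (memLp_smul_integrable hw.memLp_ballMeanNorm h₂).norm
      refine this.congr (Eventually.of_forall fun x => ?_)
      simp only [hΦe, norm_smul, norm_mul]
      rw [integral_mul_const, integral_const_mul, Real.norm_of_nonneg (ballMeanNorm_nonneg (norm_nonneg x)),
        ballMeanNorm, Real.norm_of_nonneg (by positivity)]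
      simp only [norm_indicator_eq_indicator_norm, norm_smul, norm_mul]
  have e1 := integral_radial_smul i1
  have j1 : IntegrableOn (fun s => (s ^ 2 * w s) • sphInt u₁ s) (Ioi 0) := by
    have := (integrable_polar i1).integral_prod_right
    rw [integrable_radMeasure] at this
    refine this.congr_fun (fun r (hr : 0 < r) => ?_) measurableSet_Ioi
    have hn : ∀ z : S2, ‖r • (z : E3)‖ = r := fun z => by simp [norm_smul, abs_of_pos hr]
    simp only [hn]
    rw [integral_smul, smul_smul, sphInt]
  have e2 : ∫ x, ballMean w ‖x‖ • u₂ x = ∫ s in Ioi (0 : ℝ), (s ^ 2 * w s) •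
      ∫ x, (Ici s).indicator (fun r : ℝ => (r ^ 3)⁻¹) ‖x‖ • u₂ x := by
    have := integral_integral_swap (f := fun x s => Φ (x, s)) hΦi
    simp only [← integral_smul, ← hΦe']
    rw [← this]
    refine integral_congr_ae (Eventually.of_forall fun x => ?_)
    simp only [hΦe]
    rw [integral_smul_const, integral_const_mul, setIntegral_indicator measurableSet_Iic,
      Ioi_inter_Iic, ← intervalIntegral.integral_of_le (norm_nonneg x)]
    rfl
  have j2 : IntegrableOn (fun s => (s ^ 2 * w s) •
      ∫ x, (Ici s).indicator (fun r : ℝ => (r ^ 3)⁻¹) ‖x‖ • u₂ x) (Ioi 0) := by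
    have := hΦi.integral_prod_right
    simp only [← integral_smul, ← hΦe']
    exact this
  simp only [radDensity, smul_add]
  exact ⟨j1.add j2, by rw [integral_add j1 j2, e1, e2]; rfl⟩

end Functional

/-! ### Vanishing of the functional -/

section Vanishing

theorem radialDecay_of_continuous {f : ℝ → ℝ} (h1 : Continuous f) (h2 : HasCompactSupport f) :
    RadialDecay f := by
  refine ⟨h1.measurable, ?_, ?_⟩
  · obtain ⟨C, hC⟩ := (h2.mul_left (f := fun r : ℝ => r)).exists_bound_of_continuous
      (continuous_id.mul h1)
    refine ⟨C, (norm_nonneg _).trans (hC 0), fun r hr => ?_⟩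
    have := hC r
    simp only [Pi.mul_apply, norm_mul, Real.norm_of_nonneg hr.le] at this
    rw [le_div_iff₀ hr]
    linarith
  · exact ((continuous_pow 2).smul h1 |>.integrable_of_hasCompactSupport
      (h2.smul_left (f := fun r : ℝ => r ^ 2))).integrableOn

theorem radialDecay_indicator {a b : ℝ} (ha : 0 < a) :
    RadialDecay ((Icc a b).indicator fun s : ℝ => (s ^ 2)⁻¹) := by
  refine ⟨(by fun_prop : Measurable fun s : ℝ => (s ^ 2)⁻¹).indicator measurableSet_Icc,
    ⟨a⁻¹, by positivity, fun r hr => ?_⟩, ?_⟩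
  · by_cases h : r ∈ Icc a b
    · rw [indicator_of_mem h, Real.norm_of_nonneg (by positivity), div_eq_mul_inv, ← mul_inv]
      refine inv_anti₀ (by positivity) ?_
      have := h.1
      nlinarith
    · rw [indicator_of_notMem h, norm_zero]
      positivity
  · have h : Integrable ((Icc a b).indicator fun _ : ℝ => (1 : ℝ)) :=
      (integrable_indicator_iff measurableSet_Icc).2 (integrableOn_const (by simp))
    refine h.integrableOn.congr_fun (fun r (hr : 0 < r) => ?_) measurableSet_Ioi
    by_cases h : r ∈ Icc a b
    · simp only [indicator_of_mem h, smul_eq_mul]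
      field_simp
    · simp only [indicator_of_notMem h, smul_zero]

theorem sq_mul_indicator {a b s : ℝ} (hs : 0 < s) :
    s ^ 2 * (Icc a b).indicator (fun s : ℝ => (s ^ 2)⁻¹) s
      = (Icc a b).indicator (fun _ => 1) s := by
  by_cases h : s ∈ Icc a b
  · simp only [indicator_of_mem h]
    field_simp
  · simp only [indicator_of_notMem h, mul_zero]

variable {u₁ u₂ : E3 → E3}

/-- On `[a, b]` with `a > 0` this is the integrability just shown, for the profile `s⁻²` cut off to
`[a, b]`. -/
theorem locallyIntegrableOn_radDensity (h₁ : MemLp u₁ 2 volume) (h₂ : MemLp u₂ 2 volume) :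
    LocallyIntegrableOn (radDensity u₁ u₂) (Ioi 0) := by
  refine (locallyIntegrableOn_iff isOpen_Ioi.isLocallyClosed).2 fun k hk hkc => ?_
  rcases k.eq_empty_or_nonempty with rfl | hne
  · simp
  obtain ⟨a, ha, hmin⟩ := hkc.exists_isLeast hne
  obtain ⟨b, hb, hmax⟩ := hkc.exists_isGreatest hne
  have ha0 : 0 < a := hk ha
  have h := (integral_radDensity h₁ h₂ (radialDecay_indicator (b := b) ha0)).1
  have h' := h.mono_set (fun s (hs : s ∈ Icc a b) => lt_of_lt_of_le ha0 hs.1)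
  have h'' : IntegrableOn (radDensity u₁ u₂) (Icc a b) := by
    refine h'.congr_fun (fun s hs => ?_) measurableSet_Icc
    beta_reduce
    rw [sq_mul_indicator (lt_of_lt_of_le ha0 hs.1), indicator_of_mem hs, one_smul]
  exact h''.mono_set fun s hs => ⟨hmin hs, hmax hs⟩

theorem div_pow_three {G : ℝ → ℝ} (h1 : ContDiff ℝ ∞ G) (h3 : tsupport G ⊆ Ioi 0) :
    ContDiff ℝ ∞ (fun r => G r / r ^ 3) := by
  refine contDiff_iff_contDiffAt.2 fun r => ?_
  rcases eq_or_ne r 0 with rfl | hr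
  · have h0 : G =ᶠ[𝓝 0] 0 := notMem_tsupport_iff_eventuallyEq.1 fun h => lt_irrefl (0 : ℝ) (h3 h)
    refine (contDiffAt_const (c := (0 : ℝ))).congr_of_eventuallyEq ?_
    filter_upwards [h0] with s hs
    simp [hs]
  · exact h1.contDiffAt.div (contDiffAt_id.pow 3) (pow_ne_zero 3 hr)

/-- Smooth profiles `3 g + r g'` satisfy `r² (3 g + r g') = (r³ g)'` and have ball mean `g`, so the
hypothesis annihilates the density against every derivative. The density is then a constant, and
square integrability at infinity makes it zero. -/
theorem integral_eq_zero_of_test (h₁ : MemLp u₁ 2 volume) (h₂ : MemLp u₂ 2 volume)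
    (h : ∀ g : ℝ → ℝ, ContDiff ℝ ∞ g → HasCompactSupport g → tsupport g ⊆ Ioi 0 →
      (∫ x, (3 * g ‖x‖ + ‖x‖ * deriv g ‖x‖) • u₁ x) + ∫ x, g ‖x‖ • u₂ x = 0)
    {w : ℝ → ℝ} (hw : RadialDecay w) :
    (∫ x, w ‖x‖ • u₁ x) + ∫ x, ballMean w ‖x‖ • u₂ x = 0 := by
  obtain ⟨C, hC⟩ := ae_eq_const_of_integral_deriv_smul_eq_zero
    -- With `g = G / r³` the weight `r² (3 g + r g')` is exactly `G'`.
    (locallyIntegrableOn_radDensity h₁ h₂) (fun G G1 G2 G3 => by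
    have g1 := div_pow_three G1 G3
    have gs : tsupport (fun r => G r / r ^ 3) ⊆ tsupport G := by
      refine closure_mono fun r hr hG => hr ?_
      simp [hG]
    have g2 : HasCompactSupport (fun r => G r / r ^ 3) :=
      G2.of_isClosed_subset (isClosed_tsupport _) gs
    have hG0 : G 0 = 0 := image_eq_zero_of_notMem_tsupport fun h => lt_irrefl (0 : ℝ) (G3 h)
    have hd : ∀ r : ℝ, r ≠ 0 → r ^ 2 * (3 * (G r / r ^ 3) + r * deriv (fun r => G r / r ^ 3) r)
        = deriv G r := fun r hr => by
      have := ((G1.differentiable (by simp)) r).hasDerivAt.div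
        ((hasDerivAt_id r).pow 3) (by simpa using hr)
      have e : deriv (fun r => G r / r ^ 3) r = _ := this.deriv
      rw [e]
      simp only [id, Pi.pow_apply]
      field_simp
      push_cast
      ring
    have hwr : RadialDecay fun r => 3 * (G r / r ^ 3) + r * deriv (fun r => G r / r ^ 3) r :=
      radialDecay_of_continuous
        ((continuous_const.mul g1.continuous).add (continuous_id.mul (g1.continuous_deriv (by simp))))
        (HasCompactSupport.add (g2.mul_left (f := fun _ : ℝ => (3 : ℝ)))
          (g2.deriv.mul_left (f := fun r : ℝ => r)))
    have hb : ∀ r : ℝ, 0 ≤ r →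
        ballMean (fun r => 3 * (G r / r ^ 3) + r * deriv (fun r => G r / r ^ 3) r) r
          = G r / r ^ 3 := fun r hr => by
      rw [ballMean, intervalIntegral.integral_of_le hr]
      have : ∫ s in Ioc 0 r, s ^ 2 • (3 * (G s / s ^ 3) + s * deriv (fun r => G r / r ^ 3) s)
          = ∫ s in Ioc 0 r, deriv G s :=
        setIntegral_congr_fun measurableSet_Ioc fun s hs => hd s hs.1.ne'
      rw [this, ← intervalIntegral.integral_of_le hr,
        intervalIntegral.integral_deriv_eq_sub (fun x _ => (G1.differentiable (by simp)) x)
        ((G1.continuous_deriv (by simp)).intervalIntegrable _ _), hG0, sub_zero, smul_eq_mul,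
        div_eq_inv_mul]
    have key := (integral_radDensity h₁ h₂ hwr).2
    simp only [hb _ (norm_nonneg _)] at key
    rw [h _ g1 g2 (gs.trans G3)] at key
    have e2 : ∫ s in Ioi (0 : ℝ), deriv G s • radDensity u₁ u₂ s = 0 := by
      rw [key]
      refine setIntegral_congr_fun measurableSet_Ioi fun s (hs : 0 < s) => ?_
      simp only [hd s hs.ne']
    rw [← e2]
    symm
    refine setIntegral_eq_integral_of_forall_compl_eq_zero fun s hs => ?_
    have : deriv G s = 0 := by
      have h0 : s ∉ tsupport G := fun h => hs (G3 h)
      by_contra hne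
      exact h0 (support_deriv_subset hne)
    rw [this, zero_smul])
  have hC0 : C = 0 := by
    -- A common majorant: in dimension three `r⁻²` is square integrable at infinity.
    have hb : MemLp (fun x : E3 => (Ici 1).indicator (fun r : ℝ => (r ^ 2)⁻¹) ‖x‖) 2 volume := by
      refine integrable_norm_of_integrableOn
        ((by fun_prop : Measurable fun r : ℝ => (r ^ 2)⁻¹).indicator measurableSet_Ici) ?_
      refine Integrable.mono' (g := fun r : ℝ => 2 * (1 + r ^ 2)⁻¹)
        (integrable_inv_one_add_sq.const_mul _).integrableOn ?_ ?_
      · have : Measurable ((Ici 1).indicator (fun r : ℝ => (r ^ 2)⁻¹)) :=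
          (by fun_prop : Measurable fun r : ℝ => (r ^ 2)⁻¹).indicator measurableSet_Ici
        exact (by fun_prop : Measurable fun r : ℝ =>
          r ^ 2 * (Ici 1).indicator (fun r : ℝ => (r ^ 2)⁻¹) r ^ 2).aestronglyMeasurable
      · refine (ae_restrict_iff' measurableSet_Ioi).2
          (Eventually.of_forall fun r (hr : 0 < r) => ?_)
        by_cases h1 : r ∈ Ici (1 : ℝ)
        · have h1' : 1 ≤ r := h1
          rw [indicator_of_mem h1, Real.norm_of_nonneg (by positivity), ← div_eq_mul_inv,
            le_div_iff₀ (by positivity)]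
          have : r ^ 2 * (r ^ 2)⁻¹ ^ 2 * (1 + r ^ 2) = (r ^ 2)⁻¹ + 1 := by field_simp
          rw [this]
          have : (r ^ 2)⁻¹ ≤ 1 := inv_le_one_of_one_le₀ (by nlinarith)
          linarith
        · rw [indicator_of_notMem h1]
          simp
          positivity
    -- With `R = n + 1`, the profile `R⁻¹ s⁻²` on `[R, 2R]` has radial integral one, so the
    -- functional takes the value `C` on it however large `R` is.
    have hRC : ∀ n : ℕ, C = (∫ x : E3, ((n + 1 : ℝ)⁻¹ * (Icc (n + 1 : ℝ) (2 * (n + 1))).indicator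
          (fun s : ℝ => (s ^ 2)⁻¹) ‖x‖) • u₁ x)
        + ∫ x : E3, ((n + 1 : ℝ)⁻¹ * ballMean ((Icc (n + 1 : ℝ) (2 * (n + 1))).indicator
          (fun s : ℝ => (s ^ 2)⁻¹)) ‖x‖) • u₂ x := fun n => by
      have hR : (0 : ℝ) < n + 1 := by positivity
      have key := (integral_radDensity h₁ h₂
        (radialDecay_indicator (a := n + 1) (b := 2 * (n + 1)) hR)).2
      have e : ∫ s in Ioi (0 : ℝ), (s ^ 2 * (Icc (n + 1 : ℝ) (2 * (n + 1))).indicator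
          (fun s : ℝ => (s ^ 2)⁻¹) s) • radDensity u₁ u₂ s = (n + 1 : ℝ) • C := by
        have : ∀ᵐ s ∂(volume.restrict (Ioi (0 : ℝ))),
            (s ^ 2 * (Icc (n + 1 : ℝ) (2 * (n + 1))).indicator
          (fun s : ℝ => (s ^ 2)⁻¹) s) • radDensity u₁ u₂ s
            = (Icc (n + 1 : ℝ) (2 * (n + 1))).indicator (fun _ => C) s := by
          rw [ae_restrict_iff' measurableSet_Ioi]
          filter_upwards [hC] with s hs h0
          rw [sq_mul_indicator h0, hs h0]
          by_cases h : s ∈ Icc (n + 1 : ℝ) (2 * (n + 1))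
          · simp [indicator_of_mem h]
          · simp [indicator_of_notMem h]
        rw [integral_congr_ae this, setIntegral_indicator measurableSet_Icc,
          inter_eq_right.2 (show Icc (n + 1 : ℝ) (2 * (n + 1)) ⊆ Ioi 0 from fun s hs =>
            lt_of_lt_of_le hR hs.1)]
        rw [setIntegral_const, Real.volume_real_Icc_of_le (by linarith)]
        congr 1
        ring
      rw [e] at key
      simp only [mul_smul]
      rw [integral_smul, integral_smul, ← smul_add, key, smul_smul, inv_mul_cancel₀ hR.ne', one_smul]
    -- This profile and its ball mean vanish for `r < R` and are at most `r⁻²` beyond, so both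
    -- integrals tend to zero.
    have hpt : ∀ n : ℕ, ∀ r : ℝ, 0 ≤ r →
        (‖(n + 1 : ℝ)⁻¹ * (Icc (n + 1 : ℝ) (2 * (n + 1))).indicator (fun s : ℝ => (s ^ 2)⁻¹) r‖
          ≤ (Ici (n + 1 : ℝ)).indicator (fun r : ℝ => (r ^ 2)⁻¹) r) ∧
        ‖(n + 1 : ℝ)⁻¹ * ballMean ((Icc (n + 1 : ℝ) (2 * (n + 1))).indicator
          (fun s : ℝ => (s ^ 2)⁻¹)) r‖
          ≤ (Ici (n + 1 : ℝ)).indicator (fun r : ℝ => (r ^ 2)⁻¹) r := fun n r hr => by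
      have hR : (1 : ℝ) ≤ n + 1 := by simp
      have hR0 : (0 : ℝ) < n + 1 := by positivity
      have hRi : (n + 1 : ℝ)⁻¹ ≤ 1 := inv_le_one_of_one_le₀ hR
      have hbm : ballMean ((Icc (n + 1 : ℝ) (2 * (n + 1))).indicator (fun s : ℝ => (s ^ 2)⁻¹)) r
          = (r ^ 3)⁻¹ * volume.real (Ioc 0 r ∩ Icc (n + 1 : ℝ) (2 * (n + 1))) := by
        rw [ballMean, intervalIntegral.integral_of_le hr, smul_eq_mul]
        congr 1
        rw [setIntegral_congr_fun measurableSet_Ioc (g := (Icc (n + 1 : ℝ) (2 * (n + 1))).indicator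
          (fun _ => (1 : ℝ))) fun s hs => by
            simp only [smul_eq_mul]
            exact sq_mul_indicator hs.1, setIntegral_indicator measurableSet_Icc]
        simp
      by_cases h : r ∈ Ici (n + 1 : ℝ)
      · have hr1 : (n + 1 : ℝ) ≤ r := h
        have hr0 : 0 < r := by linarith
        rw [indicator_of_mem h]
        constructor
        · rw [norm_mul, Real.norm_of_nonneg (by positivity)]
          have : ‖(Icc (n + 1 : ℝ) (2 * (n + 1))).indicator (fun s : ℝ => (s ^ 2)⁻¹) r‖
              ≤ (r ^ 2)⁻¹ := by
            refine (norm_indicator_le_norm_self _ _).trans ?_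
            rw [Real.norm_of_nonneg (by positivity)]
          calc _ ≤ 1 * (r ^ 2)⁻¹ := mul_le_mul hRi this (norm_nonneg _) zero_le_one
            _ = _ := one_mul _
        · rw [hbm, Real.norm_of_nonneg (by positivity)]
          have hv : volume.real (Ioc 0 r ∩ Icc (n + 1 : ℝ) (2 * (n + 1))) ≤ n + 1 := by
            refine (measureReal_mono inter_subset_right (by simp)).trans ?_
            rw [Real.volume_real_Icc_of_le (by linarith)]
            linarith
          calc _ ≤ (n + 1 : ℝ)⁻¹ * ((r ^ 3)⁻¹ * (n + 1)) := by gcongr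
            _ = (r ^ 3)⁻¹ := by field_simp
            _ ≤ _ := inv_anti₀ (by positivity) (pow_le_pow_right₀ (by linarith) (by norm_num))
      · have h' : r < n + 1 := not_le.1 h
        rw [indicator_of_notMem h, indicator_of_notMem (fun hh => h hh.1), hbm]
        have : Ioc 0 r ∩ Icc (n + 1 : ℝ) (2 * (n + 1)) = ∅ := by
          ext s
          simp only [mem_inter_iff, mem_Ioc, mem_Icc, mem_empty_iff_false, iff_false]
          rintro ⟨⟨_, h2⟩, h3, _⟩
          linarith
        rw [this]
        simp
    have hlim : ∀ (k : ℕ → E3 → ℝ) (u : E3 → E3), MemLp u 2 volume →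
        (∀ n, AEStronglyMeasurable (k n) volume) →
        (∀ (n : ℕ) x, ‖k n x‖ ≤ (Ici (n + 1 : ℝ)).indicator (fun r : ℝ => (r ^ 2)⁻¹) ‖x‖) →
        Tendsto (fun n => ∫ x, k n x • u x) atTop (𝓝 0) := fun k u hu hkm hk => by
      have : (0 : E3) = ∫ x : E3, (0 : E3) := by simp
      rw [this]
      refine tendsto_integral_of_dominated_convergence
        (fun x => ‖(Ici 1).indicator (fun r : ℝ => (r ^ 2)⁻¹) ‖x‖ • u x‖)
        (fun n => (hkm n).smul hu.1) (memLp_smul_integrable hb hu).norm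
        (fun n => Eventually.of_forall fun x => ?_) (Eventually.of_forall fun x => ?_)
      · rw [norm_smul, norm_smul]
        refine mul_le_mul_of_nonneg_right ((hk n x).trans (le_trans ?_ (le_abs_self _)))
          (norm_nonneg _)
        exact indicator_le_indicator_of_subset (Ici_subset_Ici.2 (by simp))
          (fun r => by positivity) _
      · refine tendsto_const_nhds.congr' ?_
        obtain ⟨N, hN⟩ := exists_nat_gt ‖x‖
        filter_upwards [eventually_ge_atTop N] with n hn
        have h1 := hk n x
        have h2 : (N : ℝ) ≤ n := by exact_mod_cast hn
        rw [indicator_of_notMem (fun h : ‖x‖ ∈ Ici (n + 1 : ℝ) => by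
          have : (n + 1 : ℝ) ≤ ‖x‖ := h
          linarith)] at h1
        rw [norm_le_zero_iff.1 h1, zero_smul]
    have l1 := hlim (fun n x => (n + 1 : ℝ)⁻¹ * (Icc (n + 1 : ℝ) (2 * (n + 1))).indicator
          (fun s : ℝ => (s ^ 2)⁻¹) ‖x‖) u₁ h₁ (fun n => by
        have h0 := (radialDecay_indicator (a := n + 1) (b := 2 * (n + 1)) (by positivity)).memLp.1
        exact h0.const_mul _) (fun n x => (hpt n _ (norm_nonneg x)).1)
    have l2 := hlim (fun n x => (n + 1 : ℝ)⁻¹ * ballMean ((Icc (n + 1 : ℝ) (2 * (n + 1))).indicator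
          (fun s : ℝ => (s ^ 2)⁻¹)) ‖x‖) u₂ h₂ (fun n => by
        have h0 := (radialDecay_indicator (a := n + 1) (b := 2 * (n + 1))
          (by positivity)).memLp_ballMean.1
        exact h0.const_mul _) (fun n x => (hpt n _ (norm_nonneg x)).2)
    have l3 := l1.add l2
    simp only [← hRC, add_zero] at l3
    exact tendsto_nhds_unique tendsto_const_nhds l3
  rw [(integral_radDensity h₁ h₂ hw).2]
  refine setIntegral_eq_zero_of_ae_eq_zero ?_
  filter_upwards [hC] with s hs h0
  rw [hs h0, hC0, smul_zero]

end Vanishing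

/-! ### The transverse part of a radial field -/

section Transverse

/-- The projection of `v` onto the direction of `x`. -/
def proj (x v : E3) : E3 := (⟪x, v⟫ / ‖x‖ ^ 2) • x

theorem inner_proj_left (x a b : E3) : ⟪proj x a, b⟫ = ⟪a, proj x b⟫ := by
  simp only [proj, inner_smul_left, inner_smul_right, real_inner_comm a x]
  simp
  ring

theorem proj_add (x a b : E3) : proj x (a + b) = proj x a + proj x b := by
  simp only [proj, inner_add_right, add_div, add_smul]

theorem proj_smul (x : E3) (c : ℝ) (a : E3) : proj x (c • a) = c • proj x a := by
  simp only [proj, inner_smul_right, mul_div_assoc, mul_smul]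

theorem norm_proj_le (x v : E3) : ‖proj x v‖ ≤ ‖v‖ := by
  rcases eq_or_ne x 0 with rfl | hx
  · simp [proj]
  · have h0 : 0 < ‖x‖ := norm_pos_iff.2 hx
    rw [proj, norm_smul, norm_div, norm_pow, norm_norm, div_mul_eq_mul_div, div_le_iff₀ (by positivity)]
    have := norm_inner_le_norm (𝕜 := ℝ) x v
    nlinarith

theorem memLp_proj {v : E3 → E3} (hv : MemLp v 2 volume) :
    MemLp (fun x => proj x (v x)) 2 volume := by
  refine hv.mono ?_ (Eventually.of_forall fun x => norm_proj_le _ _)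
  unfold proj
  have h1 : AEStronglyMeasurable (fun x : E3 => ⟪x, v x⟫) volume :=
    aestronglyMeasurable_id.inner hv.1
  have h2 : AEStronglyMeasurable (fun x : E3 => (‖x‖ ^ 2)⁻¹) volume :=
    (by fun_prop : Measurable fun x : E3 => (‖x‖ ^ 2)⁻¹).aestronglyMeasurable
  simp only [div_eq_mul_inv]
  exact (h1.mul h2).smul aestronglyMeasurable_id

/-- The longitudinal part of the radial field `w(|x|)`. -/
def gradField (w : ℝ → E3) (x : E3) : E3 :=
  ballMean w ‖x‖ + proj x (w ‖x‖ - (3 : ℝ) • ballMean w ‖x‖)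

/-- The transverse part of the radial field `w(|x|)`. -/
def transField (w : ℝ → E3) (x : E3) : E3 := w ‖x‖ - gradField w x

theorem RadialDecay.memLp_gradField {w : ℝ → E3} (hw : RadialDecay w) :
    MemLp (gradField w) 2 volume :=
  hw.memLp_ballMean.add (memLp_proj (hw.memLp.sub (hw.memLp_ballMean.const_smul (3 : ℝ))))

theorem RadialDecay.memLp_transField {w : ℝ → E3} (hw : RadialDecay w) :
    MemLp (transField w) 2 volume :=
  hw.memLp.sub hw.memLp_gradField

theorem RadialDecay.component {w : ℝ → E3} (hw : RadialDecay w) (i : Fin 3) :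
    RadialDecay fun r => w r i := by
  obtain ⟨C, hC0, hC⟩ := hw.bound
  refine ⟨?_, ⟨C, hC0, fun r hr => (PiLp.norm_apply_le (w r) i).trans (hC r hr)⟩, ?_⟩
  · exact (EuclideanSpace.proj (𝕜 := ℝ) i).continuous.measurable.comp hw.meas
  · exact (EuclideanSpace.proj (𝕜 := ℝ) i).integrable_comp hw.int

theorem RadialDecay.ballMean_component {w : ℝ → E3} (hw : RadialDecay w) (i : Fin 3) {r : ℝ}
    (hr : 0 ≤ r) : (ballMean w r) i = ballMean (fun r => w r i) r := by
  have := (EuclideanSpace.proj (𝕜 := ℝ) i).intervalIntegral_comp_comm (hw.intervalIntegrable hr)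
  simp only [ballMean, PiLp.smul_apply]
  congr 1
  exact this.symm

theorem inner_eq_sum (a b : E3) : ⟪a, b⟫ = ∑ i, b i * a i := by
  simp [PiLp.inner_apply]

/-- Both orthogonality relations of the decomposition in one statement: `θ = 0` tests the
longitudinal part against divergence-free fields, and `θ = 1` tests the transverse part, up to sign,
against gradients. -/
theorem integral_inner_gradField_eq_zero {v : E3 → E3} (hv : MemLp v 2 volume) (θ : ℝ)
    (h : ∀ (g : ℝ → ℝ) (Q : E3), ContDiff ℝ ∞ g → HasCompactSupport g → tsupport g ⊆ Ioi 0 →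
      ∫ x, ⟪v x, g ‖x‖ • Q + (‖x‖ * deriv g ‖x‖) • proj x Q
        - (θ * (3 * g ‖x‖ + ‖x‖ * deriv g ‖x‖)) • Q⟫ = 0)
    {w : ℝ → E3} (hw : RadialDecay w) :
    ∫ x, ⟪v x, gradField w x - θ • w ‖x‖⟫ = 0 := by
  -- Since `proj x` is symmetric, the integrand is `⟪u₁, w⟫ + ⟪u₂, ballMean w⟫`. This is the
  -- functional of the previous part, applied to each component of `w`.
  set u₁ : E3 → E3 := fun x => proj x (v x) - θ • v x with hu₁
  set u₂ : E3 → E3 := fun x => v x - (3 : ℝ) • proj x (v x) with hu₂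
  have h₁ : MemLp u₁ 2 volume := (memLp_proj hv).sub (hv.const_smul θ)
  have h₂ : MemLp u₂ 2 volume := hv.sub ((memLp_proj hv).const_smul (3 : ℝ))
  have hz : ∀ i, (∫ x, (w ‖x‖ i) • u₁ x) + ∫ x, ballMean (fun r => w r i) ‖x‖ • u₂ x = 0 :=
    fun i => by
    refine integral_eq_zero_of_test h₁ h₂ (fun g g1 g2 g3 => ?_) (hw.component i)
    have d1 : RadialDecay fun r => 3 * g r + r * deriv g r := radialDecay_of_continuous
        ((continuous_const.mul g1.continuous).add (continuous_id.mul (g1.continuous_deriv (by simp))))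
        (HasCompactSupport.add (g2.mul_left (f := fun _ : ℝ => (3 : ℝ)))
          (g2.deriv.mul_left (f := fun r : ℝ => r)))
    have i1 := memLp_smul_integrable d1.memLp h₁
    have i2 := memLp_smul_integrable (radialDecay_of_continuous g1.continuous g2).memLp h₂
    refine ext_inner_right ℝ fun Q => ?_
    have i12 : Integrable fun x => (3 * g ‖x‖ + ‖x‖ * deriv g ‖x‖) • u₁ x + g ‖x‖ • u₂ x :=
      i1.add i2
    rw [← integral_add i1 i2, inner_zero_left, real_inner_comm, ← integral_inner i12,
      ← h g Q g1 g2 g3]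
    refine integral_congr_ae (Eventually.of_forall fun x => ?_)
    simp only [hu₁, hu₂, inner_add_right, inner_sub_right, inner_smul_right,
      real_inner_comm _ Q, inner_proj_left, inner_add_left, inner_sub_left, inner_smul_left]
    simp [real_inner_comm]
    ring
  have i1 : ∀ i, Integrable fun x => (w ‖x‖ i) • u₁ x := fun i =>
    memLp_smul_integrable (hw.component i).memLp h₁
  have i2 : ∀ i, Integrable fun x => ballMean (fun r => w r i) ‖x‖ • u₂ x := fun i =>
    memLp_smul_integrable (hw.component i).memLp_ballMean h₂
  have i12 : ∀ i, Integrable fun x =>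
      (w ‖x‖ i) • u₁ x + ballMean (fun r => w r i) ‖x‖ • u₂ x := fun i => (i1 i).add (i2 i)
  have hc : ∀ i (k : E3 → E3), Integrable k → Integrable (fun x => k x i) ∧
      ∫ x, k x i = (∫ x, k x) i := fun i k hk =>
    ⟨(EuclideanSpace.proj (𝕜 := ℝ) i).integrable_comp hk,
      (EuclideanSpace.proj (𝕜 := ℝ) i).integral_comp_comm hk⟩
  have hpt : ∀ x, ⟪v x, gradField w x - θ • w ‖x‖⟫
      = ∑ i, (((w ‖x‖ i) • u₁ x + ballMean (fun r => w r i) ‖x‖ • u₂ x) : E3) i := fun x => by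
    have e1 : ⟪v x, gradField w x - θ • w ‖x‖⟫ = ⟪u₁ x, w ‖x‖⟫ + ⟪u₂ x, ballMean w ‖x‖⟫ := by
      simp only [hu₁, hu₂, gradField, sub_eq_add_neg, proj_add]
      rw [← neg_one_smul ℝ ((3 : ℝ) • ballMean w ‖x‖), proj_smul, proj_smul]
      simp [inner_add_right, inner_smul_right, inner_proj_left, inner_neg_right, inner_add_left,
        inner_smul_left]
      ring
    rw [e1, inner_eq_sum, inner_eq_sum, ← Finset.sum_add_distrib]
    refine Finset.sum_congr rfl fun i _ => ?_
    rw [hw.ballMean_component i (norm_nonneg x)]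
    simp
  simp only [hpt]
  rw [integral_finsetSum _ fun i _ => (hc i _ (i12 i)).1]
  refine Finset.sum_eq_zero fun i _ => ?_
  rw [(hc i _ (i12 i)).2, integral_add (i1 i) (i2 i), hz i]
  simp

theorem IsTest.integral_fderiv {φ : E3 → ℝ} (hφ : IsTest φ) (v : E3) :
    ∫ x, fderiv ℝ φ x v = 0 := by
  have := integral_mul_fderiv_eq_neg_fderiv_mul_of_integrable (μ := (volume : Measure E3))
    (f := fun _ : E3 => (1 : ℝ)) (g := φ) (v := v) (by simp)
    (by simpa using (hφ.fderiv_apply v).integrable)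
    (by simpa using hφ.integrable) (fun x _ => by fun_prop) fun x _ => hφ.differentiable x
  simpa using this

theorem IsTest.integral_div {φ : E3 → ℝ} (hφ : IsTest φ) :
    ∫ x, (fderiv ℝ φ x x + 3 * φ x) = 0 := by
  have ht : ∀ i, IsTest fun x : E3 => φ x * x i := fun i =>
    hφ.smul (φ := fun x : E3 => x i) (EuclideanSpace.proj (𝕜 := ℝ) i).contDiff
  have hd : ∀ (i : Fin 3) (x : E3), fderiv ℝ (fun x : E3 => φ x * x i) x (stdE i)
      = x i * fderiv ℝ φ x (stdE i) + φ x := fun i x => by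
    have h2 : HasFDerivAt (fun x : E3 => x i) (EuclideanSpace.proj (𝕜 := ℝ) i) x :=
      (EuclideanSpace.proj (𝕜 := ℝ) i).hasFDerivAt
    have h3 : fderiv ℝ (fun x : E3 => φ x * x i) x = _ :=
      ((hφ.differentiable x).hasFDerivAt.mul h2).fderiv
    rw [h3]
    simp
    ring
  have he : ∀ x : E3, fderiv ℝ φ x x + 3 * φ x
      = ∑ i, fderiv ℝ (fun x : E3 => φ x * x i) x (stdE i) := fun x => by
    simp only [hd, Finset.sum_add_distrib]
    have : x = ∑ i, x i • stdE i := by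
      ext j
      simp [Finset.sum_apply, Pi.single_apply]
    conv_lhs => enter [1, 2]; rw [this]
    simp
  simp only [he]
  rw [integral_finsetSum _ fun i _ => ((ht i).fderiv_apply _).integrable]
  exact Finset.sum_eq_zero fun i _ => (ht i).integral_fderiv _

/-- The field `(Q·∇G) x - (2G + x·∇G) Q` is divergence-free. -/
theorem integral_skew {G ψ : E3 → ℝ} (hG : IsTest G) (hψ : IsTest ψ) (Q : E3) :
    ∫ x, (fderiv ℝ G x Q * fderiv ℝ ψ x x - (2 * G x + fderiv ℝ G x x) * fderiv ℝ ψ x Q) = 0 := by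
  have hdψ : ContDiff ℝ ∞ (fderiv ℝ ψ) := hψ.1.fderiv_right (by simp)
  have t1 : IsTest fun x => G x * fderiv ℝ ψ x x :=
    hG.smul (φ := fun x => fderiv ℝ ψ x x) (hdψ.clm_apply contDiff_id)
  have t2 : IsTest fun x => G x * fderiv ℝ ψ x Q :=
    hG.smul (φ := fun x => fderiv ℝ ψ x Q) (hdψ.clm_apply contDiff_const)
  have hi2 : Integrable fun x => fderiv ℝ (fun x => G x * fderiv ℝ ψ x Q) x x
      + 3 * (G x * fderiv ℝ ψ x Q) := by
    refine Integrable.add ?_ (t2.integrable.const_mul 3)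
    refine Continuous.integrable_of_hasCompactSupport ?_ ?_
    · exact (t2.1.continuous_fderiv (by simp)).clm_apply continuous_id
    · exact (t2.2.fderiv ℝ).mono' fun x hx => subset_tsupport _ fun h0 => hx (by simp [h0])
  -- Both integrals vanish: that of the derivative along `Q` of `G (x·∇ψ)` and that of the
  -- divergence of `G (Q·∇ψ) x`. In their difference the second derivatives of `ψ` cancel by
  -- symmetry, and the constants `1 - 3` leave the factor `-2`.
  have e := sub_eq_zero.2 ((t1.integral_fderiv Q).trans t2.integral_div.symm)
  rw [← integral_sub (t1.fderiv_apply Q).integrable hi2] at e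
  rw [← e]
  refine integral_congr_ae (Eventually.of_forall fun x => ?_)
  have hD : HasFDerivAt (fderiv ℝ ψ) (fderiv ℝ (fderiv ℝ ψ) x) x :=
    (hdψ.differentiable (by simp) x).hasFDerivAt
  have a1 := (hG.differentiable x).hasFDerivAt.mul (hD.clm_apply (hasFDerivAt_id x))
  have a2 := (hG.differentiable x).hasFDerivAt.mul (hD.clm_apply (hasFDerivAt_const Q x))
  have hs : fderiv ℝ (fderiv ℝ ψ) x Q x = fderiv ℝ (fderiv ℝ ψ) x x Q :=
    (hψ.1.contDiffAt.isSymmSndFDerivAt (by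
      simpa using (by exact_mod_cast le_top : ((2 : ℕ∞) : WithTop ℕ∞) ≤ ∞))) Q x
  have b1 : fderiv ℝ (fun x => G x * fderiv ℝ ψ x x) x = _ := a1.fderiv
  have b2 : fderiv ℝ (fun x => G x * fderiv ℝ ψ x Q) x = _ := a2.fderiv
  simp only [b1, b2]
  simp [hs]
  ring

theorem inner_gradient (φ : E3 → ℝ) (x v : E3) : ⟪∇ φ x, v⟫ = fderiv ℝ φ x v :=
  InnerProductSpace.toDual_symm_apply

variable {g : ℝ → ℝ}

theorem gradient_radial_mul_inner (g1 : ContDiff ℝ ∞ g) (g2 : HasCompactSupport g)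
    (g3 : tsupport g ⊆ Ioi 0) (Q x : E3) :
    ∇ (fun x : E3 => g ‖x‖ * ⟪Q, x⟫) x = g ‖x‖ • Q + (‖x‖ * deriv g ‖x‖) • proj x Q := by
  refine ext_inner_right ℝ fun v => ?_
  have h1 := ((isTest_radial g1 g2 g3).differentiable x).hasFDerivAt
  have h2 : HasFDerivAt (fun x : E3 => ⟪Q, x⟫) (innerSL ℝ Q) x := (innerSL ℝ Q).hasFDerivAt
  have h3 : fderiv ℝ (fun x : E3 => g ‖x‖ * ⟪Q, x⟫) x = _ := (h1.mul h2).fderiv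
  rw [inner_gradient, h3]
  simp only [_root_.add_apply, _root_.smul_apply, innerSL_apply_apply,
    fderiv_radial g1 g3, proj, inner_add_left, inner_smul_left, smul_eq_mul, real_inner_comm Q x]
  simp
  rcases eq_or_ne x 0 with rfl | hx
  · simp
  · have h0 : ‖x‖ ≠ 0 := norm_ne_zero_iff.2 hx
    field_simp

/-- For a smooth profile supported off the origin the longitudinal part is the gradient of the test
function `g ‖x‖ * ⟪Q, x⟫`, and `u` is orthogonal to it by definition. -/
theorem RadialDecay.toL2_gradField_mem {w : ℝ → E3} (hw : RadialDecay w) {u : L2V}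
    (hu : u ∈ L2div) : ⟪u, toL2 (gradField w)⟫ = 0 := by
  have := integral_inner_gradField_eq_zero (v := u) (Lp.memLp u) 0 (fun g Q g1 g2 g3 => by
    have ht : IsTest fun x : E3 => g ‖x‖ * ⟪Q, x⟫ :=
      (isTest_radial g1 g2 g3).smul (φ := fun x : E3 => ⟪Q, x⟫) (innerSL ℝ Q).contDiff
    refine Eq.trans ?_ (mem_L2div_iff.1 hu _ ht)
    rw [inner_toL2 ((isTest_gradient ht).memLp 2)]
    refine integral_congr_ae (Eventually.of_forall fun x => ?_)
    simp only [gradient_radial_mul_inner g1 g2 g3, zero_mul, zero_smul, sub_zero]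
    exact real_inner_comm _ _) hw
  rw [real_inner_comm, inner_toL2 hw.memLp_gradField, ← this]
  refine integral_congr_ae (Eventually.of_forall fun x => ?_)
  simp only [zero_smul, sub_zero]
  exact real_inner_comm _ _

/-- For a smooth profile minus the transverse part is `(Q·∇G) x - (2 G + x·∇G) Q` with `G = g ‖x‖`,
the divergence-free field of `integral_skew`. -/
theorem RadialDecay.toL2_transField_mem {w : ℝ → E3} (hw : RadialDecay w) :
    toL2 (transField w) ∈ L2div := by
  refine mem_L2div_iff.2 fun ψ hψ => ?_
  have := integral_inner_gradField_eq_zero ((isTest_gradient hψ).memLp 2) 1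
    (fun g Q g1 g2 g3 => by
    rw [← integral_skew (isTest_radial g1 g2 g3) hψ Q]
    refine integral_congr_ae (Eventually.of_forall fun x => ?_)
    simp only [fderiv_radial g1 g3, inner_sub_right, inner_add_right, inner_smul_right, proj,
      inner_gradient]
    rcases eq_or_ne x 0 with rfl | hx
    · simp
      ring
    · have h0 : ‖x‖ ≠ 0 := norm_ne_zero_iff.2 hx
      rw [real_inner_self_eq_norm_sq]
      field_simp
      ring) hw
  rw [inner_toL2 ((isTest_gradient hψ).memLp 2), ← neg_eq_zero, ← this, ← integral_neg]
  refine integral_congr_ae ?_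
  filter_upwards [coeFn_toL2 hw.memLp_transField] with x hx
  rw [hx, transField, one_smul, ← inner_neg_right, neg_sub]

theorem RadialDecay.M_eq {w : ℝ → E3} (hw : RadialDecay w) :
    M (toL2 fun x => w ‖x‖) = toL2 (transField w) := by
  refine Submodule.eq_starProjection_of_mem_of_inner_eq_zero hw.toL2_transField_mem fun u hu => ?_
  rw [toL2_sub hw.memLp hw.memLp_transField, real_inner_comm, ← hw.toL2_gradField_mem hu]
  congr 2
  funext x
  rw [transField, sub_sub_cancel]

end Transverse

/-! ### Values at the origin -/

section Values

theorem radialDecay_shell {q : ℝ → E3} (hm : Measurable q) {B : ℝ} (hB0 : 0 ≤ B)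
    (hB : ∀ r, 0 < r → ‖q r‖ ≤ B) (hi : IntegrableOn (fun r => r • q r) (Ioi 0)) :
    RadialDecay fun r => (4 * Real.pi * r)⁻¹ • q r := by
  refine ⟨(by fun_prop : Measurable fun r : ℝ => (4 * Real.pi * r)⁻¹).smul hm,
    ⟨(4 * Real.pi)⁻¹ * B, by positivity, fun r hr => ?_⟩, ?_⟩
  · rw [norm_smul, Real.norm_of_nonneg (by positivity), mul_inv, div_eq_mul_inv]
    calc (4 * Real.pi)⁻¹ * r⁻¹ * ‖q r‖ ≤ (4 * Real.pi)⁻¹ * r⁻¹ * B := by gcongr; exact hB r hr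
      _ = _ := by ring
  · refine IntegrableOn.congr_fun (hi.smul (4 * Real.pi)⁻¹) (fun r (hr : 0 < r) => ?_)
      measurableSet_Ioi
    simp only [Pi.smul_apply, smul_smul]
    congr 1
    field_simp

theorem radialDecay_yukawa {lam : ℝ} (hlam : 0 < lam) (Q : E3) :
    RadialDecay fun r => (4 * Real.pi * r)⁻¹ • Real.exp (-(√lam * r)) • Q := by
  have hs : 0 < √lam := Real.sqrt_pos.2 hlam
  refine radialDecay_shell (by fun_prop) (norm_nonneg Q) (fun r hr => ?_) ?_
  · rw [norm_smul, Real.norm_of_nonneg (Real.exp_pos _).le]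
    refine mul_le_of_le_one_left (norm_nonneg _) (Real.exp_le_one_iff.2 ?_)
    simp only [Left.neg_nonpos_iff]
    positivity
  · have h1 : IntegrableOn (fun r => 2 / √lam * Real.exp (-(√lam / 2) * r) * ‖Q‖) (Ioi 0) :=
      ((integrableOn_exp_mul_Ioi (a := -(√lam / 2)) (by linarith) 0).const_mul _).mul_const _
    refine Integrable.mono' h1
      (by fun_prop : Continuous fun r : ℝ => r • Real.exp (-(√lam * r)) • Q).aestronglyMeasurable ?_
    refine (ae_restrict_iff' measurableSet_Ioi).2 (Eventually.of_forall fun r (hr : 0 < r) => ?_)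
    rw [smul_smul, norm_smul, Real.norm_of_nonneg (by positivity)]
    refine mul_le_mul_of_nonneg_right ?_ (norm_nonneg _)
    have h2 : √lam / 2 * r ≤ Real.exp (√lam / 2 * r) := by
      linarith [Real.add_one_le_exp (√lam / 2 * r)]
    have h3 : Real.exp (-(√lam * r)) = Real.exp (-(√lam / 2) * r) * Real.exp (-(√lam / 2 * r)) := by
      rw [← Real.exp_add]; ring_nf
    have h4 : √lam / 2 * r * Real.exp (-(√lam / 2 * r)) ≤ 1 := by
      rw [Real.exp_neg, ← div_eq_mul_inv, div_le_one (Real.exp_pos _)]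
      exact h2
    have h5 : r * Real.exp (-(√lam * r)) = 2 / √lam * Real.exp (-(√lam / 2) * r)
        * (√lam / 2 * r * Real.exp (-(√lam / 2 * r))) := by
      rw [h3]; field_simp
    rw [h5]
    exact mul_le_of_le_one_right (by positivity) h4

theorem radialDecay_retarded {c : ℝ} (hc : 0 < c) {Q : ℝ → E3} (hQ : Continuous Q) (t : ℝ) :
    RadialDecay fun r => (4 * Real.pi * r)⁻¹ • profD c Q t r := by
  obtain ⟨B, hB0, hB⟩ := exists_bound_Icc hQ t
  have h0 : ∀ r, 0 < r → ‖profD c Q t r‖ ≤ (Ioc 0 (c * t)).indicator (fun _ => B) r :=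
    fun r hr => norm_profD_le hc hB hB0 le_rfl hr
  refine radialDecay_shell (measurable_profD hQ t) hB0 (fun r hr => (h0 r hr).trans
    (indicator_le_self' (fun _ _ => hB0) r)) ?_
  refine Integrable.mono' (integrableOn_indicator_const (c * t) (c * t * B))
    (measurable_id.smul (measurable_profD hQ t)).aestronglyMeasurable ?_
  refine (ae_restrict_iff' measurableSet_Ioi).2 (Eventually.of_forall fun r (hr : 0 < r) => ?_)
  have h1 := h0 r hr
  rw [norm_smul, Real.norm_of_nonneg hr.le]
  by_cases h : r ∈ Ioc 0 (c * t)
  · rw [indicator_of_mem h] at h1 ⊢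
    exact mul_le_mul h.2 h1 (norm_nonneg _) (hr.le.trans h.2)
  · rw [indicator_of_notMem h] at h1 ⊢
    rw [norm_le_zero_iff.1 h1, norm_zero, mul_zero]

theorem RadialDecay.sub {w w' : ℝ → E3} (hw : RadialDecay w) (hw' : RadialDecay w') :
    RadialDecay fun r => w r - w' r := by
  obtain ⟨C, hC0, hC⟩ := hw.bound
  obtain ⟨C', hC0', hC'⟩ := hw'.bound
  refine ⟨hw.meas.sub hw'.meas, ⟨C + C', by positivity, fun r hr => ?_⟩, ?_⟩
  · rw [add_div]
    exact (norm_sub_le _ _).trans (add_le_add (hC r hr) (hC' r hr))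
  · have := hw.int.sub hw'.int
    refine this.congr (Eventually.of_forall fun r => ?_)
    simp [smul_sub]

theorem transField_sub {w w' : ℝ → E3} (hw : RadialDecay w) (hw' : RadialDecay w') (x : E3) :
    transField (fun r => w r - w' r) x = transField w x - transField w' x := by
  have hb : ballMean (fun r => w r - w' r) ‖x‖ = ballMean w ‖x‖ - ballMean w' ‖x‖ := by
    simp only [ballMean, smul_sub]
    rw [intervalIntegral.integral_sub (hw.intervalIntegrable (norm_nonneg x))
      (hw'.intervalIntegrable (norm_nonneg x)), smul_sub]
  have hp : ∀ a b : E3, proj x (a - b) = proj x a - proj x b := fun a b => by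
    simp only [proj, inner_sub_right, sub_div, sub_smul]
  simp only [transField, gradField, hb, hp, smul_sub]
  abel

variable {w : ℝ → E3}

theorem RadialDecay.continuousOn_ballMean (hw : RadialDecay w) :
    ContinuousOn (ballMean w) (Ioi 0) := by
  have hi : Integrable ((Ioi (0 : ℝ)).indicator fun s => s ^ 2 • w s) :=
    (integrable_indicator_iff measurableSet_Ioi).2 hw.int
  have hc : Continuous fun r => ∫ s in (0 : ℝ)..r, (Ioi (0 : ℝ)).indicator (fun s => s ^ 2 • w s) s :=
    intervalIntegral.continuous_primitive (fun _ _ => hi.intervalIntegrable) 0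
  have h2 : ContinuousOn (fun r : ℝ => (r ^ 3)⁻¹) (Ioi 0) :=
    (continuousOn_pow 3).inv₀ fun r (hr : 0 < r) => pow_ne_zero 3 hr.ne'
  refine (h2.smul hc.continuousOn).congr fun r (hr : 0 < r) => ?_
  rw [ballMean, intervalIntegral.integral_of_le hr.le, Pi.smul_apply',
    intervalIntegral.integral_of_le hr.le]
  congr 1
  refine setIntegral_congr_fun measurableSet_Ioc fun s hs => ?_
  rw [indicator_of_mem (show s ∈ Ioi (0 : ℝ) from hs.1)]

theorem RadialDecay.tendsto_ballMean (hw : RadialDecay w) {b : E3}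
    (hl : Tendsto w (𝓝[>] 0) (𝓝 b)) : Tendsto (ballMean w) (𝓝[>] 0) (𝓝 ((3 : ℝ)⁻¹ • b)) := by
  rw [Metric.tendsto_nhdsWithin_nhds] at hl ⊢
  intro ε hε
  obtain ⟨δ, hδ, h⟩ := hl (ε / 2) (by positivity)
  refine ⟨δ, hδ, fun r (hr : 0 < r) hrδ => ?_⟩
  have hr' : r < δ := by simpa [Real.dist_eq, abs_of_pos hr] using hrδ
  have e : ballMean w r - (3 : ℝ)⁻¹ • b
      = (r ^ 3)⁻¹ • ∫ s in (0 : ℝ)..r, s ^ 2 • (w s - b) := by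
    have hb : ∫ s in (0 : ℝ)..r, s ^ 2 • b = (r ^ 3 / 3) • b := by
      rw [intervalIntegral.integral_smul_const, integral_pow]
      norm_num
    simp only [smul_sub]
    rw [intervalIntegral.integral_sub (hw.intervalIntegrable hr.le)
      ((by fun_prop : Continuous fun s : ℝ => s ^ 2 • b).intervalIntegrable _ _), hb, smul_sub,
      ballMean, smul_smul]
    congr 2
    field_simp
  have hn : ‖∫ s in (0 : ℝ)..r, s ^ 2 • (w s - b)‖ ≤ r ^ 2 * (ε / 2) * |r - 0| := by
    refine intervalIntegral.norm_integral_le_of_norm_le_const fun s hs => ?_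
    rw [uIoc_of_le hr.le] at hs
    have h1 := h (x := s) hs.1 (by simpa [Real.dist_eq, abs_of_pos hs.1] using hs.2.trans_lt hr')
    rw [dist_eq_norm] at h1
    rw [norm_smul, Real.norm_of_nonneg (by positivity)]
    exact mul_le_mul (pow_le_pow_left₀ hs.1.le hs.2 2) h1.le (norm_nonneg _) (by positivity)
  rw [dist_eq_norm, e, norm_smul, Real.norm_of_nonneg (by positivity)]
  rw [sub_zero, abs_of_pos hr] at hn
  calc (r ^ 3)⁻¹ * ‖∫ s in (0 : ℝ)..r, s ^ 2 • (w s - b)‖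
      ≤ (r ^ 3)⁻¹ * (r ^ 2 * (ε / 2) * r) := by gcongr
    _ = ε / 2 := by field_simp
    _ < ε := by linarith

theorem continuousAt_proj {v : E3 → E3} {x : E3} (hx : x ≠ 0) (hv : ContinuousAt v x) :
    ContinuousAt (fun x => proj x (v x)) x := by
  unfold proj
  refine ContinuousAt.smul (ContinuousAt.div (ContinuousAt.inner (𝕜 := ℝ) continuousAt_id hv)
    (continuous_norm.continuousAt.pow 2) ?_) continuousAt_id
  exact pow_ne_zero 2 (norm_ne_zero_iff.2 hx)

/-- The ball mean tends to `b / 3`. The argument `w - 3 ballMean w` of the discontinuous `proj x`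
therefore tends to zero, and `b - b / 3` remains. -/
theorem RadialDecay.continuousOn_transField (hw : RadialDecay w) {δ : ℝ}
    (hc : ContinuousOn w (Ioo 0 δ)) {b : E3} (hl : Tendsto w (𝓝[>] 0) (𝓝 b)) :
    ContinuousOn (Function.update (transField w) 0 ((2 / 3 : ℝ) • b)) (Metric.ball 0 δ) := by
  intro x hx
  refine ContinuousAt.continuousWithinAt ?_
  rcases eq_or_ne x 0 with rfl | hx0
  · rw [continuousAt_update_same]
    have hn : Tendsto (fun x : E3 => ‖x‖) (𝓝[≠] 0) (𝓝[>] 0) := tendsto_norm_nhdsNE_zero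
    have t1 := hl.comp hn
    have t2 := (hw.tendsto_ballMean hl).comp hn
    have t3 : Tendsto (fun x : E3 => proj x (w ‖x‖ - (3 : ℝ) • ballMean w ‖x‖)) (𝓝[≠] 0) (𝓝 0) := by
      have := (t1.sub (t2.const_smul (3 : ℝ))).norm
      rw [smul_smul] at this
      norm_num at this
      exact squeeze_zero_norm (fun x => norm_proj_le _ _) this
    have t4 := t1.sub (t2.add t3)
    have e : b - ((3 : ℝ)⁻¹ • b + 0) = (2 / 3 : ℝ) • b := by module
    rw [e] at t4
    exact t4
  · have hpos : 0 < ‖x‖ := norm_pos_iff.2 hx0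
    have hx' : ‖x‖ < δ := by simpa using hx
    have c1 : ContinuousAt (fun x : E3 => w ‖x‖) x :=
      ContinuousAt.comp (f := fun x : E3 => ‖x‖) (hc.continuousAt (Ioo_mem_nhds hpos hx'))
        continuous_norm.continuousAt
    have c2 : ContinuousAt (fun x : E3 => ballMean w ‖x‖) x :=
      ContinuousAt.comp (f := fun x : E3 => ‖x‖)
        (hw.continuousOn_ballMean.continuousAt (Ioi_mem_nhds hpos)) continuous_norm.continuousAt
    refine ContinuousAt.congr (c1.sub (c2.add (continuousAt_proj hx0
      (c1.sub (c2.const_smul (3 : ℝ)))))) ?_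
    filter_upwards [isOpen_ne.mem_nhds hx0] with y hy
    rw [Function.update_of_ne hy]
    rfl

/-- The spherical means of a field that agrees almost everywhere near the origin with a continuous
field tend to the value of the latter. -/
theorem sphereMeanTendsto_of_ae {g f : E3 → E3} {U : Set E3} (hU : U ∈ 𝓝 (0 : E3))
    (hf : ContinuousOn f U) (h : ∀ᵐ x, x ∈ U → g x = f x) : SphereMeanTendsto g (f 0) := by
  rw [SphereMeanTendsto, Metric.tendsto_nhds]
  intro ε hε
  obtain ⟨δ, hδ, hball⟩ := Metric.mem_nhds_iff.1 (inter_mem hU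
    ((hf.continuousAt hU).preimage_mem_nhds (Metric.closedBall_mem_nhds (f 0) (half_pos hε))))
  have h1 : ∀ᶠ r in 𝓝[>] (0 : ℝ) ⊓ ae volume, 0 < r ∧ r < δ := by
    have : ∀ᶠ r in 𝓝[>] (0 : ℝ), 0 < r ∧ r < δ := Ioo_mem_nhdsGT hδ
    exact this.filter_mono inf_le_left
  have h2 : ∀ᶠ r in 𝓝[>] (0 : ℝ) ⊓ ae volume, 0 < r → ∀ᵐ z : S2 ∂surf,
      r • (z : E3) ∈ U → g (r • (z : E3)) = f (r • (z : E3)) :=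
    (ae_radMeasure.1 (ae_polar h)).filter_mono inf_le_right
  filter_upwards [h1, h2] with r hr hr2
  have hin : ∀ z : S2, r • (z : E3) ∈ Metric.ball (0 : E3) δ := fun z => by
    simpa [norm_smul, abs_of_pos hr.1] using hr.2
  have hcf : Continuous fun z : S2 => f (r • (z : E3)) :=
    (hf.mono fun x hx => (hball hx).1).comp_continuous (by fun_prop) hin
  have hae : (fun z : S2 => f (r • (z : E3))) =ᵐ[surf] fun z => g (r • (z : E3)) := by
    filter_upwards [hr2 hr.1] with z hz
    exact (hz (hball (hin z)).1).symm
  have hint : Integrable (fun z : S2 => g (r • (z : E3))) surf :=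
    (hcf.integrable_of_hasCompactSupport (HasCompactSupport.of_compactSpace _)).congr hae
  have : NeZero surf := ⟨fun h0 => by
    have := surf_real_univ
    rw [h0] at this
    simp at this⟩
  have hmem : sphereMean g r ∈ Metric.closedBall (f 0) (ε / 2) := by
    change (⨍ z : S2, g (r • (z : E3)) ∂surf) ∈ _
    refine (convex_closedBall (f 0) (ε / 2)).average_mem Metric.isClosed_closedBall ?_ hint
    filter_upwards [hae] with z hz
    rw [← hz]
    exact (hball (hin z)).2
  exact (Metric.mem_closedBall.1 hmem).trans_lt (half_lt_self hε)

/-- A set of full measure meets every interval `(0, ε)`. This makes limits of spherical means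
unique. -/
instance neBot_nhdsGT_inf_ae : (𝓝[>] (0 : ℝ) ⊓ ae (volume : Measure ℝ)).NeBot := by
  refine inf_neBot_iff.2 fun {s} hs {t} ht => ?_
  obtain ⟨ε, hε, hs'⟩ := mem_nhdsGT_iff_exists_Ioo_subset.1 hs
  by_contra hne
  rw [not_nonempty_iff_eq_empty] at hne
  have hsub : Ioo 0 ε ⊆ tᶜ := fun x hx hxt => by
    have : x ∈ s ∩ t := ⟨hs' hx, hxt⟩
    rw [hne] at this
    exact this
  have h0 := measure_mono_null hsub (mem_ae_iff.1 ht)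
  rw [Real.volume_Ioo, ENNReal.ofReal_eq_zero] at h0
  have : (0 : ℝ) < ε := hε
  linarith

theorem SphereMeanTendsto.unique {g : E3 → E3} {a b : E3} (ha : SphereMeanTendsto g a)
    (hb : SphereMeanTendsto g b) : a = b :=
  tendsto_nhds_unique ha hb

/-- The cut-off at radius one makes the Coulomb profile integrable at infinity. It does not change
the transverse part inside the unit ball, because the ball mean at `r` involves smaller radii only.
-/
theorem radialDecay_coulomb (Q : E3) :
    RadialDecay fun r => (4 * Real.pi * r)⁻¹ • (Ioc 0 1).indicator (fun _ => Q) r := by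
  refine radialDecay_shell (measurable_const.indicator measurableSet_Ioc) (norm_nonneg Q)
    (fun r _ => norm_indicator_le_norm_self _ _) ?_
  refine Integrable.mono' (integrableOn_indicator_const 1 ‖Q‖)
    (measurable_id.smul (measurable_const.indicator measurableSet_Ioc)).aestronglyMeasurable ?_
  refine Eventually.of_forall fun r => ?_
  by_cases h : r ∈ Ioc (0 : ℝ) 1
  · simp only [indicator_of_mem h, norm_smul, Real.norm_of_nonneg h.1.le]
    exact mul_le_of_le_one_left (norm_nonneg _) h.2
  · simp only [indicator_of_notMem h, smul_zero, norm_zero, le_refl]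

/-- Near the origin `M Q G₀` is the transverse part of the truncated field `Q G₀`. -/
theorem transField_coulomb (Q : E3) {x : E3} (hx0 : x ≠ 0) (hx : ‖x‖ ≤ 1) :
    transField (fun r => (4 * Real.pi * r)⁻¹ • (Ioc 0 1).indicator (fun _ => Q) r) x
      = coulombField Q x := by
  have hpos : 0 < ‖x‖ := norm_pos_iff.2 hx0
  have hb : ballMean (fun r => (4 * Real.pi * r)⁻¹ • (Ioc 0 1).indicator (fun _ => Q) r) ‖x‖
      = (8 * Real.pi * ‖x‖)⁻¹ • Q := by
    have : ∫ s in (0 : ℝ)..‖x‖, s ^ 2 • (4 * Real.pi * s)⁻¹ • (Ioc 0 1).indicator (fun _ => Q) s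
        = ∫ s in (0 : ℝ)..‖x‖, (s / (4 * Real.pi)) • Q := by
      rw [intervalIntegral.integral_of_le hpos.le, intervalIntegral.integral_of_le hpos.le]
      refine setIntegral_congr_fun measurableSet_Ioc fun s hs => ?_
      have hs0 : s ≠ 0 := hs.1.ne'
      simp only [indicator_of_mem (show s ∈ Ioc (0 : ℝ) 1 from ⟨hs.1, hs.2.trans hx⟩), smul_smul]
      congr 1
      field_simp
    rw [ballMean, this, intervalIntegral.integral_smul_const, intervalIntegral.integral_div,
      integral_id, smul_smul]
    congr 1
    field_simp
    ring
  rw [transField, gradField, hb, coulombField,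
    indicator_of_mem (show ‖x‖ ∈ Ioc (0 : ℝ) 1 from ⟨hpos, hx⟩)]
  have e1 : (4 * Real.pi * ‖x‖)⁻¹ • Q - (3 : ℝ) • (8 * Real.pi * ‖x‖)⁻¹ • Q
      = -(8 * Real.pi * ‖x‖)⁻¹ • Q := by
    rw [smul_smul, ← sub_smul]
    congr 1
    field_simp
    norm_num
  have e2 : (4 * Real.pi * ‖x‖)⁻¹ • Q = (2 * (8 * Real.pi * ‖x‖)⁻¹) • Q := by
    congr 1
    field_simp
    norm_num
  rw [e1, e2, proj_smul, proj]
  module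

end Values

/-! ### The regular part and the free wave at the origin -/

section Origin

theorem tendsto_inv_smul {F : ℝ → E3} {F' : E3} (h0 : F 0 = 0)
    (hF : HasDerivWithinAt F F' (Ioi 0) 0) :
    Tendsto (fun r => (4 * Real.pi * r)⁻¹ • F r) (𝓝[>] 0) (𝓝 ((4 * Real.pi)⁻¹ • F')) := by
  have := (hasDerivWithinAt_iff_tendsto_slope' (by simp)).1 hF
  refine (this.const_smul (4 * Real.pi)⁻¹).congr fun r => ?_
  rw [slope_def_module, h0, sub_zero, sub_zero, smul_smul, ← mul_inv]

theorem hasDerivAt_exp_smul (lam : ℝ) (Q : E3) :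
    HasDerivAt (fun r : ℝ => Real.exp (-(√lam * r)) • Q) (-√lam • Q) 0 := by
  have := (((hasDerivAt_id (0 : ℝ)).const_mul √lam).neg.exp).smul_const Q
  simpa using this

/-- The profile of `Q G_λ` minus the retarded potential. -/
def waveProfile (lam c : ℝ) (Q : ℝ → E3) (t r : ℝ) : E3 :=
  (4 * Real.pi * r)⁻¹ • Real.exp (-(√lam * r)) • Q t - (4 * Real.pi * r)⁻¹ • profD c Q t r

theorem waveProfile_eq (lam c : ℝ) (Q : ℝ → E3) {t r : ℝ} (hr : r ≤ c * t) :
    waveProfile lam c Q t r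
      = (4 * Real.pi * r)⁻¹ • (Real.exp (-(√lam * r)) • Q t - Q (t - r / c)) := by
  rw [waveProfile, profD, if_pos hr, smul_sub]

/-- The limit is a difference quotient in `r`, as both numerators equal `Q t` at `r = 0`. The
retarded term looks only into the past, so a left derivative of `Q` suffices; `t > 0` keeps small
radii inside the light cone. -/
theorem tendsto_waveProfile (lam : ℝ) {c : ℝ} (hc : 0 < c) {Q : ℝ → E3} {Q' : E3} {t : ℝ}
    (ht : 0 < t) (hQ : HasDerivWithinAt Q Q' (Iic t) t) :
    Tendsto (waveProfile lam c Q t) (𝓝[>] 0)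
      (𝓝 ((4 * Real.pi)⁻¹ • (-√lam • Q t + c⁻¹ • Q'))) := by
  have h1 : HasDerivWithinAt (fun r : ℝ => t - r / c) (-c⁻¹) (Ioi 0) 0 := by
    have := ((hasDerivAt_id (0 : ℝ)).div_const c).const_sub t
    simpa [div_eq_mul_inv] using this.hasDerivWithinAt
  have hQ0 : HasDerivWithinAt Q Q' (Iic t) ((fun r : ℝ => t - r / c) 0) := by simpa using hQ
  have h2 : HasDerivWithinAt (fun r : ℝ => Q (t - r / c)) (-c⁻¹ • Q') (Ioi 0) 0 :=
    HasDerivWithinAt.scomp (0 : ℝ) hQ0 h1 fun r (hr : 0 < r) => by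
      have : 0 < r / c := by positivity
      exact (by linarith : t - r / c ≤ t)
  have h3 := (hasDerivAt_exp_smul lam (Q t)).hasDerivWithinAt.sub h2
  have e : (-√lam • Q t - -c⁻¹ • Q') = -√lam • Q t + c⁻¹ • Q' := by module
  rw [e] at h3
  refine (tendsto_inv_smul (by simp) h3).congr' ?_
  filter_upwards [Ioo_mem_nhdsGT (show 0 < c * t by positivity)] with r hr
  rw [waveProfile_eq lam c Q hr.2.le]
  rfl

theorem continuousOn_waveProfile (lam : ℝ) {c : ℝ} {Q : ℝ → E3} (hQ : Continuous Q) (t : ℝ) :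
    ContinuousOn (waveProfile lam c Q t) (Ioo 0 (c * t)) := by
  have h1 : ContinuousOn (fun r : ℝ => (4 * Real.pi * r)⁻¹) (Ioo 0 (c * t)) :=
    (by fun_prop : Continuous fun r : ℝ => 4 * Real.pi * r).continuousOn.inv₀ fun r hr =>
      mul_ne_zero (by positivity) hr.1.ne'
  have h2 : Continuous fun r : ℝ => Real.exp (-(√lam * r)) • Q t - Q (t - r / c) := by fun_prop
  exact (h1.smul h2.continuousOn).congr fun r hr => waveProfile_eq lam c Q hr.2.le

theorem singularField_eq {lam : ℝ} (hlam : 0 < lam) (Q : E3) : singularField lam Q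
    = toL2 (transField fun r => (4 * Real.pi * r)⁻¹ • Real.exp (-(√lam * r)) • Q) := by
  rw [singularField, yukawa_smul_eq_shell, ← (radialDecay_yukawa hlam Q).M_eq]
  rfl

theorem M_retarded {c : ℝ} (hc : 0 < c) {Q : ℝ → E3} (hQ : Continuous Q) (t : ℝ) :
    M (retarded c Q t) = toL2 (transField fun r => (4 * Real.pi * r)⁻¹ • profD c Q t r) := by
  rw [retarded, retardedPotential_eq_shell, ← (radialDecay_retarded hc hQ t).M_eq]
  rfl

theorem regPart_add (K : Constants) (lam : ℝ) (A : L2V) :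
    A = regPart K lam A + K.kappa • singularField lam (charge K lam A) :=
  (sub_add_cancel _ _).symm

/-- Near the origin `A - κ M Q G₀` is `A_λ` plus `κ` times the transverse part of `Q (G_λ - G₀)`,
whose profile tends to `-(4π)⁻¹ √λ Q`. The field is continuous there, so the limit of its spherical
means is its value. -/
theorem MemOpDomain.value_regPart {K : Constants} {lam : ℝ} (hlam : 0 < lam) {p : E3} {A : L2V}
    (h : MemOpDomain K lam p A) {f : E3 → E3} (hf : Continuous f)
    (hA : regPart K lam A =ᵐ[volume] f) :
    f 0 + (K.kappa * (2 / 3)) • (4 * Real.pi)⁻¹ • -√lam • charge K lam A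
      = -(K.m * K.c / K.e) • charge K lam A + (K.c / K.e) • p := by
  set Q := charge K lam A with hQ
  have d1 := radialDecay_yukawa hlam Q
  have d2 := radialDecay_coulomb Q
  have d := d1.sub d2
  set w : ℝ → E3 := fun r => (4 * Real.pi * r)⁻¹ • Real.exp (-(√lam * r)) • Q
    - (4 * Real.pi * r)⁻¹ • (Ioc 0 1).indicator (fun _ => Q) r with hw
  have we : ∀ r ∈ Ioo (0 : ℝ) 1,
      w r = (4 * Real.pi * r)⁻¹ • (Real.exp (-(√lam * r)) • Q - Q) := fun r hr => by
    simp only [hw, indicator_of_mem (Ioo_subset_Ioc_self hr), smul_sub]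
  have hl : Tendsto w (𝓝[>] 0) (𝓝 ((4 * Real.pi)⁻¹ • -√lam • Q)) := by
    refine (tendsto_inv_smul (F := fun r => Real.exp (-(√lam * r)) • Q - Q) (by simp)
      ((hasDerivAt_exp_smul lam Q).sub_const Q).hasDerivWithinAt).congr' ?_
    filter_upwards [Ioo_mem_nhdsGT one_pos] with r hr
    exact (we r hr).symm
  have hcw : ContinuousOn w (Ioo 0 1) := by
    have h1 : ContinuousOn (fun r : ℝ => (4 * Real.pi * r)⁻¹) (Ioo 0 1) :=
      (by fun_prop : Continuous fun r : ℝ => 4 * Real.pi * r).continuousOn.inv₀ fun r hr =>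
        mul_ne_zero (by positivity) hr.1.ne'
    have h2 : Continuous fun r : ℝ => Real.exp (-(√lam * r)) • Q - Q := by fun_prop
    exact (h1.smul h2.continuousOn).congr we
  have hreg := hf.continuousOn.add ((d.continuousOn_transField hcw hl).const_smul K.kappa)
  have key : SphereMeanTendsto (fun x => A x - K.kappa • coulombField Q x) _ :=
    sphereMeanTendsto_of_ae (Metric.ball_mem_nhds 0 one_pos) hreg (by
      have hsum := Lp.coeFn_add (regPart K lam A) (K.kappa • singularField lam Q)
      rw [← regPart_add K lam A, singularField_eq hlam Q] at hsum
      have hz : ∀ᵐ x : E3, x ≠ 0 := by simp [ae_iff]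
      filter_upwards [hA, hsum, Lp.coeFn_smul K.kappa (toL2 (transField fun r =>
        (4 * Real.pi * r)⁻¹ • Real.exp (-(√lam * r)) • Q)), coeFn_toL2 d1.memLp_transField, hz]
        with x h1 h2 h3 h4 h5 h6
      have h7 : ‖x‖ ≤ 1 := by
        have : ‖x‖ < 1 := by simpa using h6
        exact this.le
      rw [h2, Pi.add_apply, h1, h3, Pi.smul_apply, h4, Pi.add_apply, Pi.smul_apply,
        Function.update_of_ne h5, transField_sub d1 d2, transField_coulomb Q h5 h7, smul_sub]
      abel)
  have := key.unique h.2.2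
  rw [← this]
  simp only [Pi.add_apply, Pi.smul_apply, Function.update_self, mul_smul]

/-- The field is `A_λ` plus `κ` times the transverse part of `waveProfile`. Inserting the value of
`A_λ` from the domain condition removes the terms with `√λ`. -/
theorem hasValueAtZero_sub_retarded {K : Constants} {lam : ℝ} (hlam : 0 < lam) {p : E3} {A : L2V}
    (h : MemOpDomain K lam p A) {Q : ℝ → E3} (hQ : Continuous Q) {t : ℝ} (ht : 0 < t)
    (hQA : Q t = charge K lam A) {Q' : E3} (hQ' : HasDerivWithinAt Q Q' (Iic t) t) :
    HasValueAtZero (A - K.kappa • M (retarded K.c Q t))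
      ((2 * K.e / (3 * K.c ^ 2)) • Q' - (K.m * K.c / K.e) • charge K lam A + (K.c / K.e) • p) := by
  obtain ⟨f, hf, hA⟩ := h.2.1.weakLap.exists_continuous
  have hc := K.c_pos
  have d1 := radialDecay_yukawa hlam (Q t)
  have d2 := radialDecay_retarded hc hQ t
  have d : RadialDecay (waveProfile lam K.c Q t) := d1.sub d2
  have hreg := hf.continuousOn.add ((d.continuousOn_transField (continuousOn_waveProfile lam hQ t)
    (tendsto_waveProfile lam hc ht hQ')).const_smul K.kappa)
  refine ⟨_, Metric.ball_mem_nhds 0 (show 0 < K.c * t by positivity), _, hreg, ?_, ?_⟩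
  · have e : A - K.kappa • M (retarded K.c Q t)
        = regPart K lam A + K.kappa • toL2 (transField (waveProfile lam K.c Q t)) := by
      have e1 : toL2 (transField (waveProfile lam K.c Q t))
          = singularField lam (charge K lam A) - M (retarded K.c Q t) := by
        rw [← hQA, singularField_eq hlam, M_retarded hc hQ,
          toL2_sub d1.memLp_transField d2.memLp_transField]
        congr 1
        funext x
        exact transField_sub d1 d2 x
      rw [e1, regPart, smul_sub]
      abel
    rw [e]
    have hz : ∀ᵐ x : E3, x ≠ 0 := by simp [ae_iff]
    filter_upwards [hA, Lp.coeFn_add (regPart K lam A)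
      (K.kappa • toL2 (transField (waveProfile lam K.c Q t))),
      Lp.coeFn_smul K.kappa (toL2 (transField (waveProfile lam K.c Q t))),
      coeFn_toL2 d.memLp_transField, hz] with x h1 h2 h3 h4 h5 _
    rw [h2, Pi.add_apply, h1, h3, Pi.smul_apply, h4, Pi.add_apply, Pi.smul_apply,
      Function.update_of_ne h5]
  · have hv := h.value_regPart hlam hf hA
    simp only [Pi.add_apply, Pi.smul_apply, Function.update_self, hQA]
    have e2 : (2 * K.e / (3 * K.c ^ 2)) = K.kappa * (2 / 3) * (4 * Real.pi)⁻¹ * K.c⁻¹ := by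
      rw [Constants.kappa]
      field_simp
    rw [e2, eq_sub_of_add_eq hv]
    module

end Origin

/-! ### The splitting of the field -/

section Splitting

theorem retardedPotential_congr {c : ℝ} (hc : 0 < c) {Q Q' : ℝ → E3} {T t : ℝ} (ht : t ≤ T)
    (h : ∀ s ∈ Icc 0 T, Q s = Q' s) : retardedPotential c Q t = retardedPotential c Q' t := by
  funext x
  simp only [retardedPotential]
  split_ifs with hx
  · rw [h]
    have h1 : 0 ≤ ‖x‖ / c := by positivity
    have h2 : ‖x‖ / c ≤ t := by rwa [div_le_iff₀ hc, mul_comm]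
    exact ⟨by linarith, by linarith⟩
  · rfl

/-- At time zero the light cone has shrunk to the origin, a null set. -/
theorem retarded_zero (c : ℝ) (Q : ℝ → E3) : retarded c Q 0 = 0 := by
  have h : retardedPotential c Q 0 =ᵐ[volume] fun _ => (0 : E3) := by
    have hz : ∀ᵐ x : E3, x ≠ 0 := by simp [ae_iff]
    filter_upwards [hz] with x hx
    simp [retardedPotential, hx]
  have h0 : MemLp (fun _ : E3 => (0 : E3)) 2 volume := MemLp.zero
  rw [retarded, ← toL2_congr h0 h.symm]
  refine Lp.ext ?_
  filter_upwards [coeFn_toL2 h0, Lp.coeFn_zero E3 2 (volume : Measure E3)] with x h1 h2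
  rw [h1, h2]
  rfl

/-- The projected retarded potential solves the wave equation with the source `M Q δ₀`. -/
theorem inner_M_retarded {c : ℝ} (hc : 0 < c) {Q : ℝ → E3} (hQ : Continuous Q) {lam : ℝ}
    (hlam : 0 < lam) {ψ : E3 → E3} (hψ : IsTest ψ) {t : ℝ} (ht : 0 ≤ t) :
    ⟪toL2 ψ, M (retarded c Q t)⟫ = prim (prim fun s =>
      c ^ 2 * (⟪toL2 (Laplacian.laplacian ψ), M (retarded c Q s)⟫
        - ⟪toL2 (Laplacian.laplacian ψ), M (yukawaField hlam (Q s))⟫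
        + lam * ⟪toL2 ψ, M (yukawaField hlam (Q s))⟫)) t := by
  have cR := continuous_retarded hc hQ
  have cY : Continuous fun s => yukawaField hlam (Q s) := (yukawaField hlam).continuous.comp hQ
  have h := (weakLap_retarded hc hQ hlam ht).map_M ψ hψ
  have hp : ∀ (L : L2V →L[ℝ] ℝ) {f : ℝ → L2V} (_ : Continuous f),
      L (prim (prim f) t) = prim (prim fun s => L (f s)) t := fun L f hf => by
    rw [map_prim L (continuous_prim hf)]
    congr 1
    funext s
    exact map_prim L hf s
  have h1 := hp ((innerSL ℝ (toL2 (Laplacian.laplacian ψ))).comp M)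
    (f := fun s => retarded c Q s - yukawaField hlam (Q s)) (cR.sub cY)
  have h2 := hp ((innerSL ℝ (toL2 ψ)).comp M) cY
  simp only [ContinuousLinearMap.comp_apply, innerSL_apply_apply] at h1 h2
  rw [map_smul, map_sub, map_smul, inner_smul_right, inner_sub_right, inner_smul_right, h1, h2] at h
  have c1 : Continuous fun s => ⟪toL2 (Laplacian.laplacian ψ), M (retarded c Q s)⟫ := by fun_prop
  have c2 : Continuous fun s => ⟪toL2 (Laplacian.laplacian ψ), M (yukawaField hlam (Q s))⟫ := by
    fun_prop
  have c3 : Continuous fun s => ⟪toL2 ψ, M (yukawaField hlam (Q s))⟫ := by fun_prop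
  have lin : ∀ {f g : ℝ → ℝ} (_ : Continuous f) (_ : Continuous g) (a b s : ℝ),
      prim (fun s => a * f s + b * g s) s = a * prim f s + b * prim g s := fun {f g} hf hg a b s => by
    simp only [prim]
    rw [intervalIntegral.integral_add ((hf.const_mul a).intervalIntegrable _ _)
      ((hg.const_mul b).intervalIntegrable _ _), intervalIntegral.integral_const_mul,
      intervalIntegral.integral_const_mul]
  have c4 : Continuous fun s => ⟪toL2 (Laplacian.laplacian ψ),
      M (retarded c Q s - yukawaField hlam (Q s))⟫ := by fun_prop
  have e : (fun s => c ^ 2 * (⟪toL2 (Laplacian.laplacian ψ), M (retarded c Q s)⟫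
        - ⟪toL2 (Laplacian.laplacian ψ), M (yukawaField hlam (Q s))⟫
        + lam * ⟪toL2 ψ, M (yukawaField hlam (Q s))⟫))
      = fun s => c ^ 2 * ⟪toL2 (Laplacian.laplacian ψ),
          M (retarded c Q s - yukawaField hlam (Q s))⟫
        + (c ^ 2 * lam) * ⟪toL2 ψ, M (yukawaField hlam (Q s))⟫ := by
    funext s
    rw [map_sub, inner_sub_right]
    ring
  rw [e, funext (lin c4 c3 (c ^ 2) (c ^ 2 * lam)), lin (continuous_prim c4) (continuous_prim c3)]
  linarith

/-- The second derivative of `A` is `c² (Δ A_λ + λκ M Q G_λ)` and that of `κ M D` is `κ c² (Δ M (D -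
Q G_λ) + λ M Q G_λ)`. Their difference is `c² Δ (A - κ M D)`. -/
theorem IsStrictSolution.isFreeWave {K : Constants} {lam : ℝ} (hlam : 0 < lam) {V : E3 → ℝ} {T : ℝ}
    {A₀ E₀ : L2V} {q₀ p₀ : E3} {A E : ℝ → L2V} {q p : ℝ → E3}
    (hsol : IsStrictSolution K lam V T A₀ E₀ q₀ p₀ A E q p) {Q : ℝ → E3} (hQ : Continuous Q)
    (hQA : ∀ t ∈ Icc 0 T, Q t = charge K lam (A t)) :
    IsFreeWave K.c T A₀ ((4 * Real.pi * K.c ^ 2) • E₀)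
      fun t => A t - K.kappa • M (retarded K.c Q t) := by
  have hc := K.c_pos
  have cR := continuous_retarded hc hQ
  have cY : Continuous fun s => yukawaField hlam (Q s) := (yukawaField hlam).continuous.comp hQ
  refine ⟨?_, ?_, fun ψ hψ => ?_⟩
  · have h1 : ContinuousOn A (Icc 0 T) := fun t ht => (hsol.A_eq t ht).continuousWithinAt
    have h2 : Continuous fun t => K.kappa • M (retarded K.c Q t) := by fun_prop
    exact h1.sub h2.continuousOn
  · simp only [retarded_zero, map_zero, smul_zero, sub_zero, hsol.A_init]
  set F : ℝ → ℝ := fun s => K.c ^ 2 * (⟪toL2 (Laplacian.laplacian ψ), M (retarded K.c Q s)⟫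
        - ⟪toL2 (Laplacian.laplacian ψ), M (yukawaField hlam (Q s))⟫
        + lam * ⟪toL2 ψ, M (yukawaField hlam (Q s))⟫) with hF
  have cF : Continuous F := by simp only [hF]; fun_prop
  have hL : ∀ φ : E3 → E3, IsTest φ → ∀ u : L2V, ∫ x, ⟪φ x, u x⟫ = ⟪toL2 φ, u⟫ := fun φ hφ u =>
    (inner_toL2 (hφ.memLp 2) u).symm
  -- The weak velocity: `4πc² E` for `A`, minus `κ` times a primitive of the weak acceleration `F`
  -- of the projected retarded potential, which starts from rest.
  refine ⟨fun t => 4 * Real.pi * K.c ^ 2 * ⟪toL2 ψ, E t⟫ - K.kappa * prim F t, ?_, fun t ht => ⟨?_, ?_⟩⟩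
  · beta_reduce
    rw [hL ψ hψ, hsol.E_init, prim_zero, inner_smul_right, mul_zero, sub_zero]
  · simp only [hL ψ hψ]
    have h1 := (innerSL ℝ (toL2 ψ)).hasFDerivAt.comp_hasDerivWithinAt t (hsol.A_eq t ht)
    have h2 := ((hasDerivAt_prim (continuous_prim cF) t).const_mul K.kappa).hasDerivWithinAt
      (s := Icc 0 T)
    refine ((h1.sub h2).congr (fun s hs => ?_) ?_).congr_deriv ?_
    · simp only [Function.comp_apply, innerSL_apply_apply, inner_sub_right, inner_smul_right,
        Pi.sub_apply]
      rw [inner_M_retarded hc hQ hlam hψ hs.1]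
    · simp only [Function.comp_apply, innerSL_apply_apply, inner_sub_right, inner_smul_right,
        Pi.sub_apply]
      rw [inner_M_retarded hc hQ hlam hψ ht.1]
    · simp only [innerSL_apply_apply, inner_smul_right]
  · have h1 := ((innerSL ℝ (toL2 ψ)).hasFDerivAt.comp_hasDerivWithinAt t (hsol.E_eq t ht)).const_mul
      (4 * Real.pi * K.c ^ 2)
    have h2 := ((hasDerivAt_prim cF t).const_mul K.kappa).hasDerivWithinAt (s := Icc 0 T)
    refine (h1.sub h2).congr_deriv ?_
    have hw := (hsol.A_dom t ht).2.1.weakLap ψ hψ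
    have hs : M (yukawaField hlam (Q t)) = singularField lam (charge K lam (A t)) := by
      rw [hQA t ht]; rfl
    rw [hL _ hψ.laplacian]
    simp only [innerSL_apply_apply, opH, hF, inner_smul_right, inner_sub_right, inner_add_right,
      inner_neg_right]
    rw [← hw, hs]
    simp only [regPart, inner_sub_right, inner_smul_right]
    field_simp
    ring

end Splitting

end

end PointCharge

/-! ### The splitting of the field and the equation of the charge. -/

open PointCharge
theorem theorem3p4 (K : Constants) (lam : ℝ) (hlam : 0 < lam)
    (V : E3 → ℝ) (hV : Differentiable ℝ V) (hVLip : ∃ L, LipschitzWith L (fun x => ∇ V x))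
    (T : ℝ) (hT : 0 < T)
    (A₀ E₀ : L2V) (q₀ p₀ : E3) (A E : ℝ → L2V) (q p : ℝ → E3)
    (hsol : IsStrictSolution K lam V T A₀ E₀ q₀ p₀ A E q p) :
    ∃ Af : ℝ → L2V,
      -- `Af` is the free wave with the given initial data, unique on `[0,T]`
      (IsFreeWave K.c T A₀ ((4 * Real.pi * K.c ^ 2) • E₀) Af ∧
        ∀ Bf : ℝ → L2V, IsFreeWave K.c T A₀ ((4 * Real.pi * K.c ^ 2) • E₀) Bf →
          ∀ t ∈ Icc 0 T, Bf t = Af t) ∧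
      -- the splitting of the field
      (∀ t ∈ Icc 0 T,
        ∃ h : MemLp (retardedPotential K.c (fun s => charge K lam (A s)) t) 2 volume,
          A t = Af t + K.kappa • M (h.toLp _)) ∧
      -- the equation of the charge, where `a t` is the value `A_f(t,0)`
      ∃ a : ℝ → E3,
        (∀ t ∈ Ioc 0 T, HasValueAtZero (Af t) (a t)) ∧
        ContinuousOn a (Icc 0 T) ∧
        ∀ t ∈ Icc 0 T,
          HasDerivWithinAt (fun s => charge K lam (A s))
            ((K.c * √K.lam0) • charge K lam (A t)
              + (3 * K.c ^ 2 / (2 * K.e)) • a t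
              - (3 * K.c ^ 3 / (2 * K.e ^ 2)) • p t) (Icc 0 T) t := by
  have hc := K.c_pos
  have hm := K.m_pos
  have he := K.e_ne
  set Qc : ℝ → E3 := fun s => charge K lam (A s) with hQc
  have hreg : ContDiffOn ℝ 1 Qc (Icc 0 T) := hsol.A_reg.2.1
  -- The charge is extended by constants to a continuous curve on the line. Retarded potentials at
  -- times in `[0, T]` see its values on `[0, T]` only.
  set Q := extendIcc hT Qc with hQdef
  have hQ : Continuous Q := continuous_extendIcc hT hreg.continuousOn
  have hQA : ∀ t ∈ Icc 0 T, Q t = charge K lam (A t) := fun t ht => extendIcc_of_mem hT Qc ht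
  have hud := uniqueDiffOn_Icc hT
  have hder : ∀ t ∈ Icc 0 T, HasDerivWithinAt Qc (derivWithin Qc (Icc 0 T) t) (Icc 0 T) t :=
    fun t ht => ((hreg.differentiableOn one_ne_zero) t ht).hasDerivWithinAt
  have hwave := hsol.isFreeWave hlam hQ hQA
  -- The value at the origin is given by its formula in `Q̇`, `Q` and `p`, which is continuous up to
  -- `t = 0`. With this choice the equation of the charge is algebra, and the content lies in
  -- `HasValueAtZero`.
  refine ⟨_, ⟨hwave, fun Bf hBf t ht => hBf.unique hc hT hwave ht⟩, fun t ht => ?_,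
    fun t => (2 * K.e / (3 * K.c ^ 2)) • derivWithin Qc (Icc 0 T) t
      - (K.m * K.c / K.e) • Qc t + (K.c / K.e) • p t, fun t ht => ?_, ?_, fun t ht => ?_⟩
  · have hcg : retardedPotential K.c Q t = retardedPotential K.c Qc t :=
      retardedPotential_congr hc ht.2 hQA
    have hmem : MemLp (retardedPotential K.c Qc t) 2 volume :=
      hcg ▸ memLp_retardedPotential hc hQ t
    refine ⟨hmem, ?_⟩
    rw [← toL2_eq hmem, ← hcg]
    exact (sub_add_cancel _ _).symm
  · have ht' := Ioc_subset_Icc_self ht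
    refine hasValueAtZero_sub_retarded hlam (hsol.A_dom t ht') hQ ht.1 (hQA t ht') ?_
    have h1 : HasDerivWithinAt Q (derivWithin Qc (Icc 0 T) t) (Icc 0 T) t :=
      (hder t ht').congr (fun s hs => extendIcc_of_mem hT Qc hs) (extendIcc_of_mem hT Qc ht')
    have h2 := h1.mono (Icc_subset_Icc_right ht.2)
    -- Only the derivative from the left is needed, so the end point `t = T` is no exception.
    exact h2.mono_of_mem_nhdsWithin (Icc_mem_nhdsLE ht.1)
  · have c1 : ContinuousOn (derivWithin Qc (Icc 0 T)) (Icc 0 T) :=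
      hreg.continuousOn_derivWithin hud le_rfl
    have c2 : ContinuousOn Qc (Icc 0 T) := hreg.continuousOn
    have c3 : ContinuousOn p (Icc 0 T) := hsol.p_reg.continuousOn
    fun_prop
  · refine (hder t ht).congr_deriv ?_
    have hs : √K.lam0 = 3 * K.m * K.c ^ 2 / (2 * K.e ^ 2) := by
      rw [Constants.lam0, Real.sqrt_sq (by positivity)]
    rw [hs]
    simp only [smul_add, smul_sub, smul_smul]
    have e1 : 3 * K.c ^ 2 / (2 * K.e) * (2 * K.e / (3 * K.c ^ 2)) = 1 := by field_simp
    have e2 : 3 * K.c ^ 2 / (2 * K.e) * (K.m * K.c / K.e)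
        = K.c * (3 * K.m * K.c ^ 2 / (2 * K.e ^ 2)) := by field_simp
    have e3 : 3 * K.c ^ 2 / (2 * K.e) * (K.c / K.e) = 3 * K.c ^ 3 / (2 * K.e ^ 2) := by field_simp
    rw [e1, e2, e3, one_smul]
    abel
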